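/- Let $M$ be a smooth finite-dimensional manifold, $g_0$ a Riemannian metric, $\beta:M\to(0,\infty)$ a smooth function and $\delta$ a smooth vector field on $M$. Consider the standard stationary spacetime $(M\times\mathbb R,l)$ with $$l(x,t)[(v,\tau),(v,\tau)]=g_0(v,v)+2g_0(\delta(x),v)\,\tau-\beta(x)\,\tau^2 ,$$ and write $|\delta|_0^2=g_0(\delta,\delta)$. A light ray is a lightlike geodesic of $l$, that is, a geodesic $\gamma$ on an open interval with $\gamma'\neq 0$ and $l(\gamma',\gamma')=0$. Suppose that for some constant $\sigma\in\mathbb R$ $$\mathcal L_\delta g_0=\left(\frac{\delta(\beta+|\delta|_0^2)}{\beta+|\delta|_0^2}-\sigma\right)g_0 .$$ Then the spatial components of light rays are, up to reparametrization, exactly the curves $x(t)=\phi(t,\rho(t))$, $t\in(-\epsilon,\epsilon)$, $\epsilon>0$, where - $\rho:(-\epsilon,\epsilon)\to M$ is a reparametrized geodesic of the Riemannian metric $g_0/(\beta+|\delta|_0^2)$, with parameter such that $$g_0(\rho'(t),\rho'(t))=\big(\beta(\rho(t))+|\delta(\rho(t))|_0^2\big)\,e^{-\sigma t};$$ - $U\subset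 M$ is an open set with $\rho(t)\in U$ for all $t\in(-\epsilon,\epsilon)$, and $\phi:(-\epsilon,\epsilon)\times U\to M$ is the flow of $-\delta$. Precisely: 1. For every light ray $\gamma$ on an open interval $J$ and every $s_0\in J$ there are $\epsilon$, $\rho$, $U$, $\phi$ as above and a smooth $h:(-\epsilon,\epsilon)\to J$ with nowhere vanishing derivative and $h(0)=s_0$ such that the $M$-component of $\gamma(h(t))$ is $\phi(t,\rho(t))$ and its $\mathbb R$-component has positive derivative, for all $t\in(-\epsilon,\epsilon)$. 2. Conversely, for all $\epsilon$, $\rho$, $U$, $\phi$ as above there are an orientation-preserving smooth diffeomorphism $h$ of $(-\epsilon,\epsilon)$ onto an open interval $J$ and a light ray $\gamma$ on $J$, whose $\mathbb R$-component is strictly increasing with positive derivative along $t\mapsto\gamma(h(t))$, such that the $M$-component of $\gamma(h(t))$ is $\phi(t,\rho(t))$ for all $t\in(-\epsilon,\epsilon)$. -/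

import Mathlib

open Set Bundle
open scoped Manifold ContDiff

noncomputable section

namespace Stationary

section General

variable {E : Type*} [NormedAddCommGroup E] [NormedSpace ℝ E]
  {H : Type*} [TopologicalSpace H] (I : ModelWithCorners ℝ E H)
  {N : Type*} [TopologicalSpace N] [ChartedSpace H N]

/-- The velocity `γ'(s)` of a curve `γ` in a manifold. -/
def velocity (γ : ℝ → N) (s : ℝ) : TangentSpace I (γ s) :=
  mfderiv 𝓘(ℝ, ℝ) I γ s (1 : ℝ)

/-- The components `g_y(u, v)` of a field of bilinear forms `g`, read in the chart of `N`
chosen at the point `p`. The point `y` ranges over the target of the chart. -/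
def chartComponents (g : (x : N) → TangentSpace I x → TangentSpace I x → ℝ)
    (p : N) (y u v : E) : ℝ :=
  g ((extChartAt I p).symm y)
    (mfderiv 𝓘(ℝ, E) I (extChartAt I p).symm y u)
    (mfderiv 𝓘(ℝ, E) I (extChartAt I p).symm y v)

/-- The Christoffel symbols of the first kind of a semi-Riemannian metric `g` in the chart chosen
at `p`: `Γ_y(u, v; w) = (∂_u g(v, w) + ∂_v g(u, w) - ∂_w g(u, v)) / 2`. If `∇` is the Levi-Civita
connection of `g`, this is `g(∇_u v, w)` for constant vector fields `u, v, w` of the chart. -/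
def christoffel (g : (x : N) → TangentSpace I x → TangentSpace I x → ℝ)
    (p : N) (y u v w : E) : ℝ :=
  (fderiv ℝ (fun z => chartComponents I g p z v w) y u
    + fderiv ℝ (fun z => chartComponents I g p z u w) y v
    - fderiv ℝ (fun z => chartComponents I g p z u v) y w) / 2

/-- `γ` is an (affinely parametrized) geodesic on the set `J` (an open interval in all uses) for
the semi-Riemannian metric `g`: it is smooth and, in every chart, `c'' + Γ(c', c') = 0`.
As `g` is nondegenerate, this equation is tested by pairing it with all vectors `w`. -/
def IsGeodesicOn (g : (x : N) → TangentSpace I x → TangentSpace I x → ℝ)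
    (γ : ℝ → N) (J : Set ℝ) : Prop :=
  ContMDiffOn 𝓘(ℝ, ℝ) I ∞ γ J ∧
  ∀ s ∈ J, ∀ p : N, γ s ∈ (extChartAt I p).source → ∀ w : E,
    let c : ℝ → E := fun r => extChartAt I p (γ r)
    chartComponents I g p (c s) (deriv (deriv c) s) w
      + christoffel I g p (c s) (deriv c s) (deriv c s) w = 0

/-- `h` is a regular change of parameter on the open interval `J`: it is smooth with nowhere
vanishing derivative, hence a diffeomorphism of `J` onto the open interval `h '' J`. -/
def IsParameterChange (h : ℝ → ℝ) (J : Set ℝ) : Prop :=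
  ContDiffOn ℝ ∞ h J ∧ ∀ t ∈ J, deriv h t ≠ 0

/-- `ρ` is, on the open interval `J`, a geodesic of `g` up to a regular change of parameter. -/
def IsReparametrizedGeodesicOn (g : (x : N) → TangentSpace I x → TangentSpace I x → ℝ)
    (ρ : ℝ → N) (J : Set ℝ) : Prop :=
  ∃ (c : ℝ → N) (h : ℝ → ℝ), IsParameterChange h J ∧ IsGeodesicOn I g c (h '' J) ∧
    ∀ t ∈ J, ρ t = c (h t)

/-- The Lie derivative of a field of bilinear forms `g` along a vector field `X`, evaluated on
vector fields `Y` and `Z` at the point `x`: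
`(L_X g)(Y, Z) = X(g(Y, Z)) - g([X, Y], Z) - g(Y, [X, Z])`. -/
def lieDerivative (X : (x : N) → TangentSpace I x)
    (g : (x : N) → TangentSpace I x → TangentSpace I x → ℝ)
    (Y Z : (x : N) → TangentSpace I x) (x : N) : ℝ :=
  mvfderiv I (fun y => g y (Y y) (Z y)) x (X x)
    - g x (VectorField.mlieBracket I X Y x) (Z x)
    - g x (Y x) (VectorField.mlieBracket I X Z x)

/-- The vector field `X` is smooth at `x`. -/
def SmoothFieldAt (X : (x : N) → TangentSpace I x) [IsManifold I 1 N] (x : N) : Prop :=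
  ContMDiffAt I I.tangent ∞ (fun y => (⟨y, X y⟩ : TangentBundle I N)) x

/-- `φ` is the (local) flow of the vector field `X` on `(-ε, ε) × U`. -/
def IsLocalFlow (X : (x : N) → TangentSpace I x) (φ : ℝ → N → N) (ε : ℝ) (U : Set N) : Prop :=
  ContMDiffOn (𝓘(ℝ, ℝ).prod I) I ∞ (fun q : ℝ × N => φ q.1 q.2) (Ioo (-ε) ε ×ˢ U) ∧
  ∀ p ∈ U, φ 0 p = p ∧ IsMIntegralCurveOn (fun t => φ t p) X (Ioo (-ε) ε)

end General

section Spacetime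

variable {E : Type*} [NormedAddCommGroup E] [NormedSpace ℝ E]
  {M : Type*} [TopologicalSpace M] [ChartedSpace E M] [IsManifold 𝓘(ℝ, E) ∞ M]

/-- The function `β + |δ|₀²` on `M`. -/
def conformalFactor
    (g₀ : ContMDiffRiemannianMetric 𝓘(ℝ, E) ∞ E (fun x : M => TangentSpace 𝓘(ℝ, E) x))
    (β : M → ℝ) (δ : (x : M) → TangentSpace 𝓘(ℝ, E) x) (x : M) : ℝ :=
  β x + g₀.inner x (δ x) (δ x)

/-- The Riemannian metric `g₀ / (β + |δ|₀²)` on `M`. -/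
def conformalMetric
    (g₀ : ContMDiffRiemannianMetric 𝓘(ℝ, E) ∞ E (fun x : M => TangentSpace 𝓘(ℝ, E) x))
    (β : M → ℝ) (δ : (x : M) → TangentSpace 𝓘(ℝ, E) x)
    (x : M) (u v : TangentSpace 𝓘(ℝ, E) x) : ℝ :=
  g₀.inner x u v / conformalFactor g₀ β δ x

/-- The standard stationary Lorentzian metric on `M × ℝ`, polarized from
`l[(v, τ), (v, τ)] = g₀(v, v) + 2 g₀(δ, v) τ - β τ²`. A tangent vector `ξ` of `M × ℝ` has
components `v = d(pr₁) ξ` and `τ = d(pr₂) ξ`. -/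
def stationaryMetric
    (g₀ : ContMDiffRiemannianMetric 𝓘(ℝ, E) ∞ E (fun x : M => TangentSpace 𝓘(ℝ, E) x))
    (β : M → ℝ) (δ : (x : M) → TangentSpace 𝓘(ℝ, E) x)
    (z : M × ℝ) (ξ η : TangentSpace (𝓘(ℝ, E).prod 𝓘(ℝ, ℝ)) z) : ℝ :=
  let v : TangentSpace 𝓘(ℝ, E) z.1 := mfderiv (𝓘(ℝ, E).prod 𝓘(ℝ, ℝ)) 𝓘(ℝ, E) Prod.fst z ξ
  let w : TangentSpace 𝓘(ℝ, E) z.1 := mfderiv (𝓘(ℝ, E).prod 𝓘(ℝ, ℝ)) 𝓘(ℝ, E) Prod.fst z η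
  let τ : ℝ := mvfderiv (𝓘(ℝ, E).prod 𝓘(ℝ, ℝ)) (Prod.snd : M × ℝ → ℝ) z ξ
  let κ : ℝ := mvfderiv (𝓘(ℝ, E).prod 𝓘(ℝ, ℝ)) (Prod.snd : M × ℝ → ℝ) z η
  g₀.inner z.1 v w + g₀.inner z.1 (δ z.1) v * κ + g₀.inner z.1 (δ z.1) w * τ - β z.1 * τ * κ

/-- `γ` is a light ray on the open interval `J`: a lightlike geodesic of the standard stationary
spacetime `M × ℝ`, its velocity being nonzero and of zero length. -/
def IsLightRayOn
    (g₀ : ContMDiffRiemannianMetric 𝓘(ℝ, E) ∞ E (fun x : M => TangentSpace 𝓘(ℝ, E) x))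
    (β : M → ℝ) (δ : (x : M) → TangentSpace 𝓘(ℝ, E) x)
    (γ : ℝ → M × ℝ) (J : Set ℝ) : Prop :=
  IsGeodesicOn (𝓘(ℝ, E).prod 𝓘(ℝ, ℝ)) (stationaryMetric g₀ β δ) γ J ∧
  ∀ s ∈ J, velocity (𝓘(ℝ, E).prod 𝓘(ℝ, ℝ)) γ s ≠ 0 ∧
    stationaryMetric g₀ β δ (γ s) (velocity (𝓘(ℝ, E).prod 𝓘(ℝ, ℝ)) γ s)
      (velocity (𝓘(ℝ, E).prod 𝓘(ℝ, ℝ)) γ s) = 0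

/-- The data of the description: `ρ` is, on `(-ε, ε)`, a geodesic of `g₀ / (β + |δ|₀²)`
parametrized so that `g₀(ρ', ρ') = (β(ρ) + |δ(ρ)|₀²) e^{-σ t}`, the set `U` is a neighborhood of
`ρ(0)` that contains `ρ(t)` for all `t ∈ (-ε, ε)`, and `φ` is the flow of `-δ` on
`(-ε, ε) × U`. -/
structure IsDraggedGeodesic
    (g₀ : ContMDiffRiemannianMetric 𝓘(ℝ, E) ∞ E (fun x : M => TangentSpace 𝓘(ℝ, E) x))
    (β : M → ℝ) (δ : (x : M) → TangentSpace 𝓘(ℝ, E) x) (σ ε : ℝ)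
    (ρ : ℝ → M) (U : Set M) (φ : ℝ → M → M) : Prop where
  pos : 0 < ε
  geodesic : IsReparametrizedGeodesicOn 𝓘(ℝ, E) (conformalMetric g₀ β δ) ρ (Ioo (-ε) ε)
  speed : ∀ t ∈ Ioo (-ε) ε,
    g₀.inner (ρ t) (velocity 𝓘(ℝ, E) ρ t) (velocity 𝓘(ℝ, E) ρ t)
      = conformalFactor g₀ β δ (ρ t) * Real.exp (-σ * t)
  isOpen : IsOpen U
  mem : ∀ t ∈ Ioo (-ε) ε, ρ t ∈ U
  flow : IsLocalFlow 𝓘(ℝ, E) (fun x => -δ x) φ ε U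

end Spacetime

end Stationary

end

open Filter Topology

namespace Stationary

set_option linter.unusedSectionVars false

section Nemytskii

universe u

variable {K : Type*} [TopologicalSpace K] [CompactSpace K]

/-- A continuous bilinear map applied pointwise to continuous families, as a continuous
bilinear map. -/
noncomputable def pointwiseBilin (K : Type*) [TopologicalSpace K] [CompactSpace K]
    {G E F : Type*} [NormedAddCommGroup G] [NormedSpace ℝ G] [NormedAddCommGroup E]
    [NormedSpace ℝ E] [NormedAddCommGroup F] [NormedSpace ℝ F] (B : G →L[ℝ] E →L[ℝ] F) :
    C(K, G) →L[ℝ] C(K, E) →L[ℝ] C(K, F) :=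
  LinearMap.mkContinuous₂
    (LinearMap.mk₂ ℝ
      (fun (A : C(K, G)) (h : C(K, E)) =>
        (⟨fun s => B (A s) (h s), by fun_prop⟩ : C(K, F)))
      (fun _ _ _ => by ext; simp) (fun _ _ _ => by ext; simp)
      (fun _ _ _ => by ext; simp) (fun _ _ _ => by ext; simp))
    ‖B‖ (fun A h => by
      refine (ContinuousMap.norm_le _ (by positivity)).2 fun s => ?_
      exact (B.le_opNorm₂ (A s) (h s)).trans (by
        gcongr
        · exact A.norm_coe_le_norm s
        · exact h.norm_coe_le_norm s))

@[simp] lemma pointwiseBilin_apply {G E F : Type*} [NormedAddCommGroup G] [NormedSpace ℝ G]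
    [NormedAddCommGroup E] [NormedSpace ℝ E]
    [NormedAddCommGroup F] [NormedSpace ℝ F] (B : G →L[ℝ] E →L[ℝ] F)
    (A : C(K, G)) (h : C(K, E)) (s : K) :
    pointwiseBilin K B A h s = B (A s) (h s) := rfl

/-- Superposition with a continuously differentiable map is differentiable for the sup norm. -/
lemma hasFDerivAt_superposition {G E F : Type*} [NormedAddCommGroup G] [NormedSpace ℝ G]
    [NormedAddCommGroup E] [NormedSpace ℝ E]
    [NormedAddCommGroup F] [NormedSpace ℝ F] {f : E → F} {f' : E → G} (B : G →L[ℝ] E →L[ℝ] F)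
    (hf : ∀ x, HasFDerivAt f (B (f' x)) x) (hc : Continuous f)
    (hf' : Continuous f') (u : C(K, E)) :
    HasFDerivAt (fun v : C(K, E) => (⟨f, hc⟩ : C(E, F)).comp v)
      (pointwiseBilin K B ((⟨f', hf'⟩ : C(E, G)).comp u)) u := by
  rw [hasFDerivAt_iff_isLittleO_nhds_zero, Asymptotics.isLittleO_iff]
  intro c hc
  have hcpt : IsCompact (range u) := isCompact_range u.continuous
  have hunif := hcpt.uniformContinuousAt_of_continuousAt (fun x => B (f' x))
    (fun a _ => (B.continuous.comp hf').continuousAt) (Metric.dist_mem_uniformity hc)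
  obtain ⟨d, hd, hdu⟩ := Metric.mem_uniformity_dist.1 hunif
  filter_upwards [Metric.ball_mem_nhds (0 : C(K, E)) hd] with h hh
  rw [mem_ball_zero_iff] at hh
  refine (ContinuousMap.norm_le _ (by positivity)).2 fun s => ?_
  have hs : ‖h s‖ < d := (h.norm_coe_le_norm s).trans_lt hh
  have key := Convex.norm_image_sub_le_of_norm_fderiv_le' (𝕜 := ℝ) (f := f) (C := c)
    (s := Metric.ball (u s) d) (x := u s) (y := u s + h s) (φ := B (f' (u s)))
    (fun x _ => (hf x).differentiableAt) (fun x hx => ?_) (convex_ball _ _)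
    (Metric.mem_ball_self hd) (by simpa [mem_ball_iff_norm] using hs)
  · rw [add_sub_cancel_left] at key
    exact key.trans (mul_le_mul_of_nonneg_left (h.norm_coe_le_norm s) hc.le)
  · have := @hdu (u s) x (by rw [dist_comm]; exact hx) (mem_range_self s)
    have h2 : dist (B (f' (u s))) (B (f' x)) < c := this
    rw [(hf x).fderiv, ← dist_eq_norm, dist_comm]
    exact h2.le

lemma contDiff_superposition_succ {G E F : Type*} [NormedAddCommGroup G] [NormedSpace ℝ G]
    [NormedAddCommGroup E] [NormedSpace ℝ E]
    [NormedAddCommGroup F] [NormedSpace ℝ F] {f : E → F} {f' : E → G} (B : G →L[ℝ] E →L[ℝ] F)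
    (hf : ∀ x, HasFDerivAt f (B (f' x)) x) (hc : Continuous f) (hf' : Continuous f') (n : ℕ)
    (ih : ContDiff ℝ n (fun v : C(K, E) => (⟨f', hf'⟩ : C(E, G)).comp v)) :
    ContDiff ℝ (n + 1 : ℕ) (fun v : C(K, E) => (⟨f, hc⟩ : C(E, F)).comp v) := by
  have hder := fun u : C(K, E) => hasFDerivAt_superposition B hf hc hf' u
  rw [Nat.cast_succ, contDiff_succ_iff_fderiv]
  refine ⟨fun u => (hder u).differentiableAt, by simp, ?_⟩
  rw [funext fun u => (hder u).fderiv]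
  exact (pointwiseBilin K B).contDiff.comp ih

/-- Superposition with a smooth map is smooth for the sup norm. -/
lemma contDiff_superposition {E F : Type u} [NormedAddCommGroup E] [NormedSpace ℝ E]
    [NormedAddCommGroup F] [NormedSpace ℝ F] {f : E → F} (hf : ContDiff ℝ ∞ f) :
    ContDiff ℝ ∞ (fun v : C(K, E) => (⟨f, hf.continuous⟩ : C(E, F)).comp v) := by
  rw [contDiff_infty]
  intro n
  induction n generalizing F with
  | zero => exact contDiff_zero.2 (ContinuousMap.continuous_postcomp _)
  | succ n ih =>
    have hd : Differentiable ℝ f := hf.differentiable (by simp)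
    have hf' : ContDiff ℝ ∞ (fderiv ℝ f) := hf.fderiv_right (by simp)
    exact contDiff_superposition_succ (ContinuousLinearMap.id ℝ (E →L[ℝ] F))
      (fun x => (hd x).hasFDerivAt) hf.continuous hf'.continuous n (ih hf')

end Nemytskii

section LocalInverse

variable {X Y : Type*} [NormedAddCommGroup X] [NormedSpace ℝ X] [CompleteSpace X]
  [NormedAddCommGroup Y] [NormedSpace ℝ Y]

/-- The inverse function theorem for smooth maps, with a smooth inverse on a whole neighborhood. -/
lemma exists_smooth_local_inverse {f : X → Y} (hf : ContDiff ℝ ∞ f) {a : X} (e : X ≃L[ℝ] Y)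
    (he : HasFDerivAt f (e : X →L[ℝ] Y) a) :
    ∃ Φ : OpenPartialHomeomorph X Y, a ∈ Φ.source ∧ (∀ x, Φ x = f x) ∧
      ContDiffOn ℝ ∞ Φ.symm Φ.target := by
  have hne : (∞ : WithTop ℕ∞) ≠ 0 := by simp
  let Φ := hf.contDiffAt.toOpenPartialHomeomorph f he hne
  have hΦ : ∀ x, Φ x = f x := fun x => rfl
  have hmem : a ∈ Φ.source := hf.contDiffAt.mem_toOpenPartialHomeomorph_source he hne
  have hcont : Continuous (fderiv ℝ f) := hf.continuous_fderiv (by simp)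
  have hopen : IsOpen {x | fderiv ℝ f x ∈ interior
      (range (ContinuousLinearEquiv.toContinuousLinearMap : (X ≃L[ℝ] Y) → X →L[ℝ] Y))} :=
    isOpen_interior.preimage hcont
  have ha : fderiv ℝ f a ∈ interior
      (range (ContinuousLinearEquiv.toContinuousLinearMap : (X ≃L[ℝ] Y) → X →L[ℝ] Y)) := by
    rw [he.fderiv]
    exact mem_interior_iff_mem_nhds.2 e.nhds
  refine ⟨Φ.restrOpen _ hopen, ⟨hmem, ha⟩, hΦ, ?_⟩
  intro y hy
  have hy' := (Φ.restrOpen _ hopen).map_target hy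
  obtain ⟨e', he'⟩ := interior_subset hy'.2
  refine ((Φ.restrOpen _ hopen).contDiffAt_symm (f₀' := e') hy ?_ ?_).contDiffWithinAt
  · change HasFDerivAt f _ _
    change (e' : X →L[ℝ] Y) = _ at he'
    rw [he']
    exact (hf.differentiable (by simp) _).hasFDerivAt
  · exact hf.contDiffAt

end LocalInverse

section Volterra

variable (E : Type*) [NormedAddCommGroup E] [NormedSpace ℝ E]

/-- The primitive vanishing at `0`, as an operator on continuous curves on `[-1, 1]`. -/
noncomputable def primitiveOp :
    C(Icc (-1 : ℝ) 1, E) →L[ℝ] C(Icc (-1 : ℝ) 1, E) :=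
  have hint : ∀ (v : C(Icc (-1 : ℝ) 1, E)), Continuous
      (fun r => v (projIcc (-1 : ℝ) 1 (by norm_num) r)) :=
    fun v => v.continuous.comp continuous_projIcc
  LinearMap.mkContinuous
    { toFun := fun v =>
        ⟨fun s => ∫ r in (0 : ℝ)..s, v (projIcc (-1 : ℝ) 1 (by norm_num) r),
          (intervalIntegral.continuous_primitive
            (fun a b => (hint v).intervalIntegrable a b) 0).comp continuous_subtype_val⟩
      map_add' := fun v w => by
        ext s
        exact intervalIntegral.integral_add ((hint v).intervalIntegrable _ _)
          ((hint w).intervalIntegrable _ _)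
      map_smul' := fun c v => by
        ext s
        exact intervalIntegral.integral_smul c _ }
    1 (fun v => by
      rw [one_mul]
      refine (ContinuousMap.norm_le _ (norm_nonneg _)).2 fun s => ?_
      refine (intervalIntegral.norm_integral_le_of_norm_le_const
        (fun r _ => v.norm_coe_le_norm _)).trans ?_
      have : |(s : ℝ) - 0| ≤ 1 := by rw [sub_zero]; exact abs_le.2 s.2
      exact mul_le_of_le_one_right (norm_nonneg _) this)

variable {E}

lemma primitiveOp_apply (v : C(Icc (-1 : ℝ) 1, E)) (s : Icc (-1 : ℝ) 1) :
    primitiveOp E v s = ∫ r in (0 : ℝ)..s, v (projIcc (-1 : ℝ) 1 (by norm_num) r) := rfl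

end Volterra

section LocalFlow

universe u

variable {E : Type u} [NormedAddCommGroup E] [NormedSpace ℝ E]

/-- Constant curves, as a continuous linear map. -/
noncomputable def constCurve (E : Type*) [NormedAddCommGroup E] [NormedSpace ℝ E] :
    E →L[ℝ] C(Icc (-1 : ℝ) 1, E) :=
  LinearMap.mkContinuous
    { toFun := fun x => ContinuousMap.const _ x
      map_add' := fun _ _ => rfl
      map_smul' := fun _ _ => rfl } 1 (fun x => by
        rw [one_mul]
        exact (ContinuousMap.norm_le _ (norm_nonneg _)).2 fun _ => le_rfl)

@[simp] lemma constCurve_apply (x : E) (s : Icc (-1 : ℝ) 1) : constCurve E x s = x := rfl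

/-- The map whose zero level describes the solutions of `u' = λ f(u)`, `u(0) = x` on `[-1, 1]`. -/
noncomputable def odeMap (f : C(E, E)) (z : E × ℝ × C(Icc (-1 : ℝ) 1, E)) :
    E × ℝ × C(Icc (-1 : ℝ) 1, E) :=
  (z.1, z.2.1, z.2.2 - constCurve E z.1 - z.2.1 • primitiveOp E (f.comp z.2.2))

lemma contDiff_odeMap {f : E → E} (hf : ContDiff ℝ ∞ f) :
    ContDiff ℝ ∞ (odeMap (⟨f, hf.continuous⟩ : C(E, E))) := by
  have h : ContDiff ℝ ∞ (fun z : E × ℝ × C(Icc (-1 : ℝ) 1, E) =>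
      (⟨f, hf.continuous⟩ : C(E, E)).comp z.2.2) :=
    (contDiff_superposition hf).comp contDiff_snd.snd
  exact contDiff_fst.prodMk (contDiff_snd.fst.prodMk
    ((contDiff_snd.snd.sub ((constCurve E).contDiff.comp contDiff_fst)).sub
      (contDiff_snd.fst.smul ((primitiveOp E).contDiff.comp h))))

/-- The shear `(x, l, u) ↦ (x, l, u - x - l v)`. -/
noncomputable def shearEquiv (v : C(Icc (-1 : ℝ) 1, E)) :
    (E × ℝ × C(Icc (-1 : ℝ) 1, E)) ≃L[ℝ] (E × ℝ × C(Icc (-1 : ℝ) 1, E)) :=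
  let L : (E × ℝ × C(Icc (-1 : ℝ) 1, E)) →L[ℝ] C(Icc (-1 : ℝ) 1, E) :=
    (constCurve E).comp (ContinuousLinearMap.fst ℝ _ _) +
      ((ContinuousLinearMap.fst ℝ ℝ _).comp (ContinuousLinearMap.snd ℝ E _)).smulRight v
  let p₁ := ContinuousLinearMap.fst ℝ E (ℝ × C(Icc (-1 : ℝ) 1, E))
  let p₂ := (ContinuousLinearMap.fst ℝ ℝ C(Icc (-1 : ℝ) 1, E)).comp
    (ContinuousLinearMap.snd ℝ E _)
  let p₃ := (ContinuousLinearMap.snd ℝ ℝ C(Icc (-1 : ℝ) 1, E)).comp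
    (ContinuousLinearMap.snd ℝ E _)
  ContinuousLinearEquiv.equivOfInverse
    (p₁.prod (p₂.prod (p₃ - L))) (p₁.prod (p₂.prod (p₃ + L)))
    (fun z => by ext <;> simp [p₁, p₂, p₃, L]) (fun z => by ext <;> simp [p₁, p₂, p₃, L])

lemma shearEquiv_apply (v : C(Icc (-1 : ℝ) 1, E)) (z : E × ℝ × C(Icc (-1 : ℝ) 1, E)) :
    shearEquiv v z = (z.1, z.2.1, z.2.2 - (constCurve E z.1 + z.2.1 • v)) := rfl

lemma hasFDerivAt_odeMap {f : E → E} (hf : ContDiff ℝ ∞ f) (y : E) :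
    HasFDerivAt (odeMap (⟨f, hf.continuous⟩ : C(E, E)))
      (shearEquiv (primitiveOp E ((⟨f, hf.continuous⟩ : C(E, E)).comp (constCurve E y))) :
        (E × ℝ × C(Icc (-1 : ℝ) 1, E)) →L[ℝ] (E × ℝ × C(Icc (-1 : ℝ) 1, E)))
      (y, 0, constCurve E y) := by
  have h : ContDiff ℝ ∞ (fun z : E × ℝ × C(Icc (-1 : ℝ) 1, E) =>
      primitiveOp E ((⟨f, hf.continuous⟩ : C(E, E)).comp z.2.2)) :=
    (primitiveOp E).contDiff.comp ((contDiff_superposition hf).comp contDiff_snd.snd)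
  have h1 := (h.differentiable (by simp) (y, 0, constCurve E y)).hasFDerivAt
  let q := ContinuousLinearMap.snd ℝ E (ℝ × C(Icc (-1 : ℝ) 1, E))
  let L₂ := (ContinuousLinearMap.fst ℝ ℝ C(Icc (-1 : ℝ) 1, E)).comp q
  let L₃ := (ContinuousLinearMap.snd ℝ ℝ C(Icc (-1 : ℝ) 1, E)).comp q
  let L₄ := (constCurve E).comp (ContinuousLinearMap.fst ℝ E (ℝ × C(Icc (-1 : ℝ) 1, E)))
  have h2 := L₂.hasFDerivAt (x := (y, (0 : ℝ), constCurve E y))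
  have h3 := L₃.hasFDerivAt (x := (y, (0 : ℝ), constCurve E y))
  have h4 := L₄.hasFDerivAt (x := (y, (0 : ℝ), constCurve E y))
  refine (hasFDerivAt_fst.prodMk (h2.prodMk ((h3.sub h4).sub (h2.smul h1)))).congr_fderiv ?_
  ext : 1
  · ext : 1 <;> ext : 1 <;> simp [shearEquiv_apply, L₂, L₃, L₄, q]
  · ext <;> simp [shearEquiv_apply, L₂, L₃, L₄, q]

variable [CompleteSpace E]

/-- A smooth vector field on a Banach space has smooth local flows. -/
lemma exists_smooth_flow {f : E → E} (hf : ContDiff ℝ ∞ f) (y : E) :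
    ∃ ε > 0, ∃ α : ℝ → E → E,
      ContDiffOn ℝ ∞ (fun q : ℝ × E => α q.1 q.2) (Ioo (-ε) ε ×ˢ Metric.ball y ε) ∧
      ∀ x ∈ Metric.ball y ε, α 0 x = x ∧
        ∀ t ∈ Ioo (-ε) ε, HasDerivAt (fun t => α t x) (f (α t x)) t := by
  set fc : C(E, E) := ⟨f, hf.continuous⟩ with hfc
  obtain ⟨Φ, hsrc, hΦ, hsymm⟩ :=
    exists_smooth_local_inverse (contDiff_odeMap hf) _ (hasFDerivAt_odeMap hf y)
  obtain ⟨r, hr, hrs⟩ := Metric.isOpen_iff.1 Φ.open_source _ hsrc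
  have himage : Φ (y, 0, constCurve E y) = (y, 0, 0) := by
    rw [hΦ]; simp [odeMap]
  have htgt : (y, (0 : ℝ), (0 : C(Icc (-1 : ℝ) 1, E))) ∈ Φ.target := by
    rw [← himage]; exact Φ.map_source hsrc
  have hinv : Φ.symm (y, 0, 0) = (y, 0, constCurve E y) := by
    rw [← himage]; exact Φ.left_inv hsrc
  -- a neighborhood of `(y, 0)` on which the solution stays in the ball
  have hnhds : Φ.target ∩ Φ.symm ⁻¹' (Metric.ball (y, (0 : ℝ), constCurve E y) r) ∈
      𝓝 (y, (0 : ℝ), (0 : C(Icc (-1 : ℝ) 1, E))) := by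
    refine Filter.inter_mem (Φ.open_target.mem_nhds htgt) ?_
    refine (Φ.continuousAt_symm htgt).preimage_mem_nhds ?_
    rw [hinv]; exact Metric.ball_mem_nhds _ hr
  obtain ⟨d, hd, hdn⟩ := Metric.mem_nhds_iff.1 hnhds
  set e := min d r with he
  have he0 : 0 < e := lt_min hd hr
  have hmem : ∀ x ∈ Metric.ball y e, ∀ l : ℝ, |l| < e →
      (x, l, (0 : C(Icc (-1 : ℝ) 1, E))) ∈ Φ.target ∧
      Φ.symm (x, l, 0) ∈ Metric.ball (y, (0 : ℝ), constCurve E y) r := by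
    intro x hx l hl
    refine hdn ?_
    rw [Metric.mem_ball, Prod.dist_eq, Prod.dist_eq]
    refine max_lt (lt_of_lt_of_le hx (min_le_left _ _)) (max_lt ?_ (by simpa using hd))
    simpa using lt_of_lt_of_le hl (min_le_left _ _)
  set S : E → ℝ → C(Icc (-1 : ℝ) 1, E) := fun x l => (Φ.symm (x, l, 0)).2.2 with hS
  have hSsol : ∀ x ∈ Metric.ball y e, ∀ l : ℝ, |l| < e →
      Φ.symm (x, l, 0) = (x, l, S x l) ∧
      S x l = constCurve E x + l • primitiveOp E (fc.comp (S x l)) := by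
    intro x hx l hl
    have h1 := Φ.right_inv (hmem x hx l hl).1
    rw [hΦ] at h1
    simp only [odeMap, Prod.mk.injEq] at h1
    obtain ⟨h1, h2, h3⟩ := h1
    refine ⟨by ext1; exacts [h1, by ext1; exacts [h2, rfl]], ?_⟩
    rw [h1, h2, sub_sub, sub_eq_zero] at h3
    exact h3
  -- the solution for the parameter `c * l` is a rescaling of the solution for `l`
  have hscale : ∀ x ∈ Metric.ball y e, ∀ l : ℝ, |l| < e → ∀ c : Icc (-1 : ℝ) 1,
      S x (c * l) ⟨1, by norm_num⟩ = S x l c := by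
    intro x hx l hl c
    have hc : |(c : ℝ)| ≤ 1 := abs_le.2 c.2
    have hcl : |c * l| < e := by
      rw [abs_mul]
      exact lt_of_le_of_lt (mul_le_of_le_one_left (abs_nonneg _) hc) hl
    have hmul : ∀ s : Icc (-1 : ℝ) 1, (c : ℝ) * s ∈ Icc (-1 : ℝ) 1 := fun s => by
      rw [mem_Icc, ← abs_le, abs_mul]
      exact mul_le_one₀ hc (abs_nonneg _) (abs_le.2 s.2)
    let w : C(Icc (-1 : ℝ) 1, E) := (S x l).comp
      ⟨fun s => ⟨c * s, hmul s⟩, by fun_prop⟩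
    have hw : ∀ s, w s = S x l ⟨c * s, hmul s⟩ := fun s => rfl
    have hball := (hmem x hx l hl).2
    rw [(hSsol x hx l hl).1, Metric.mem_ball, Prod.dist_eq, Prod.dist_eq] at hball
    have hb3 : dist (S x l) (constCurve E y) < r :=
      lt_of_le_of_lt (le_max_right _ _) (lt_of_le_of_lt (le_max_right _ _) hball)
    have hwsrc : (x, (c : ℝ) * l, w) ∈ Φ.source := by
      refine hrs ?_
      rw [Metric.mem_ball, Prod.dist_eq, Prod.dist_eq]
      refine max_lt (lt_of_lt_of_le hx (min_le_right _ _)) (max_lt ?_ ?_)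
      · simpa using lt_of_lt_of_le hcl (min_le_right _ _)
      · refine lt_of_le_of_lt ?_ hb3
        rw [ContinuousMap.dist_le dist_nonneg]
        intro s
        exact ContinuousMap.dist_apply_le_dist (f := S x l) (g := constCurve E y) ⟨c * s, hmul s⟩
    have hwsol : Φ (x, (c : ℝ) * l, w) = (x, (c : ℝ) * l, 0) := by
      rw [hΦ]
      simp only [odeMap, Prod.mk.injEq, true_and]
      rw [sub_sub, sub_eq_zero]
      ext s
      have h1 := congrArg (fun u : C(Icc (-1 : ℝ) 1, E) => u ⟨c * s, hmul s⟩)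
        (hSsol x hx l hl).2
      simp only [ContinuousMap.add_apply, ContinuousMap.smul_apply, constCurve_apply,
        primitiveOp_apply] at h1
      rw [hw, h1]
      simp only [ContinuousMap.add_apply, ContinuousMap.smul_apply, constCurve_apply,
        primitiveOp_apply]
      rw [mul_comm (c : ℝ) l, mul_smul]
      congr 2
      have h2 := intervalIntegral.smul_integral_comp_mul_left (a := 0) (b := (s : ℝ))
        (fun r => (fc.comp (S x l)) (projIcc (-1 : ℝ) 1 (by norm_num) r)) (c : ℝ)
      rw [mul_zero] at h2
      rw [← h2]
      congr 1
      refine intervalIntegral.integral_congr fun r hr => ?_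
      have hr' : r ∈ Icc (-1 : ℝ) 1 := by
        have : uIcc (0 : ℝ) s ⊆ Icc (-1) 1 :=
          (convex_Icc (-1 : ℝ) 1).ordConnected.uIcc_subset (by norm_num) s.2
        exact this hr
      simp only [ContinuousMap.comp_apply, hw]
      rw [projIcc_of_mem _ hr', projIcc_of_mem _ (hmul ⟨r, hr'⟩)]
    have := Φ.left_inv hwsrc
    rw [hwsol, (hSsol x hx _ hcl).1] at this
    have h5 : S x (c * l) = w := (Prod.mk.inj (Prod.mk.inj this).2).2
    rw [h5, hw]
    congr 2
    exact mul_one _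
  refine ⟨e / 2, by positivity, fun t x => S x t ⟨1, by norm_num⟩, ?_, ?_⟩
  · have h1 : ContDiffOn ℝ ∞ (fun q : ℝ × E => Φ.symm (q.2, q.1, 0))
        (Ioo (-(e / 2)) (e / 2) ×ˢ Metric.ball y (e / 2)) := by
      refine hsymm.comp (contDiff_snd.prodMk (contDiff_fst.prodMk contDiff_const)).contDiffOn ?_
      rintro ⟨t, x⟩ ⟨ht, hx⟩
      refine (hmem x (Metric.ball_subset_ball (by linarith) hx) t ?_).1
      rw [abs_lt]; constructor <;> linarith [ht.1, ht.2]
    exact (ContinuousMap.evalCLM ℝ _).contDiff.comp_contDiffOn h1.snd.snd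
  · intro x hx
    have hx : x ∈ Metric.ball y e := Metric.ball_subset_ball (by linarith) hx
    have hl : |e / 2| < e := by rw [abs_of_pos (by positivity)]; linarith
    have hform : ∀ c : Icc (-1 : ℝ) 1, S x (e / 2) c = x + (e / 2) •
        ∫ r in (0 : ℝ)..c, f (S x (e / 2) (projIcc (-1 : ℝ) 1 (by norm_num) r)) := by
      intro c
      have h1 := congrArg (fun u : C(Icc (-1 : ℝ) 1, E) => u c) (hSsol x hx _ hl).2
      simpa only [ContinuousMap.add_apply, ContinuousMap.smul_apply, constCurve_apply,
        primitiveOp_apply, ContinuousMap.comp_apply, hfc, ContinuousMap.coe_mk] using h1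
    have hα : ∀ t ∈ Ioo (-(e / 2)) (e / 2), S x t ⟨1, by norm_num⟩ =
        S x (e / 2) (projIcc (-1 : ℝ) 1 (by norm_num) (t / (e / 2))) ∧
        S x t ⟨1, by norm_num⟩ = x + (e / 2) • ∫ r in (0 : ℝ)..(t / (e / 2)),
          f (S x (e / 2) (projIcc (-1 : ℝ) 1 (by norm_num) r)) := by
      intro t ht
      have hc : t / (e / 2) ∈ Icc (-1 : ℝ) 1 := by
        constructor
        · rw [le_div_iff₀ (by positivity)]; linarith [ht.1]
        · rw [div_le_iff₀ (by positivity)]; linarith [ht.2]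
      have h1 := hscale x hx _ hl ⟨_, hc⟩
      have h2 : t / (e / 2) * (e / 2) = t := by field_simp
      simp only [h2] at h1
      rw [h1, projIcc_of_mem _ hc]
      exact ⟨rfl, hform _⟩
    refine ⟨?_, fun t ht => ?_⟩
    · refine (hα 0 ⟨by linarith, by linarith⟩).2.trans ?_
      simp
    · have hcont : Continuous
          (fun r => f (S x (e / 2) (projIcc (-1 : ℝ) 1 (by norm_num) r))) :=
        hf.continuous.comp ((S x (e / 2)).continuous.comp continuous_projIcc)
      have h1 : HasDerivAt (fun s => ∫ r in (0 : ℝ)..s,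
          f (S x (e / 2) (projIcc (-1 : ℝ) 1 (by norm_num) r)))
          (f (S x (e / 2) (projIcc (-1 : ℝ) 1 (by norm_num) (t / (e / 2))))) (t / (e / 2)) :=
        intervalIntegral.integral_hasDerivAt_right (hcont.intervalIntegrable _ _)
          (hcont.stronglyMeasurableAtFilter _ _) hcont.continuousAt
      have h2 := ((h1.scomp t ((hasDerivAt_id t).div_const (e / 2))).const_smul (e / 2)).const_add x
      have h3 : (e / 2) • ((1 : ℝ) / (e / 2)) •
          f (S x (e / 2) (projIcc (-1 : ℝ) 1 (by norm_num) (t / (e / 2)))) =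
          f (S x t ⟨1, by norm_num⟩) := by
        rw [smul_smul, mul_one_div_cancel (by positivity), one_smul, (hα t ht).1]
      rw [h3] at h2
      refine h2.congr_of_eventuallyEq ?_
      filter_upwards [Ioo_mem_nhds ht.1 ht.2] with s hs
      exact (hα s hs).2

end LocalFlow

section Forms

variable {V : Type*} [NormedAddCommGroup V] [NormedSpace ℝ V]
  {X : Type*} [NormedAddCommGroup X] [NormedSpace ℝ X]

/-- `g` is, near `y`, a field of symmetric bilinear forms, and it is differentiable at `y`. -/
structure SymmFormAt (g : V → V → V → ℝ) (y : V) : Prop where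
  symm : ∀ᶠ z in 𝓝 y, ∀ u v, g z u v = g z v u
  add : ∀ᶠ z in 𝓝 y, ∀ u u' v, g z (u + u') v = g z u v + g z u' v
  smul : ∀ᶠ z in 𝓝 y, ∀ (c : ℝ) u v, g z (c • u) v = c * g z u v
  diff : ∀ u v, DifferentiableAt ℝ (fun q : V × V × V => g q.1 q.2.1 q.2.2) (y, u, v)

lemma SymmFormAt.symm' {g : V → V → V → ℝ} {y : V} (h : SymmFormAt g y) (u v : V) :
    g y u v = g y v u := h.symm.self_of_nhds u v

lemma SymmFormAt.add_left {g : V → V → V → ℝ} {y : V} (h : SymmFormAt g y) (u u' v : V) :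
    g y (u + u') v = g y u v + g y u' v := h.add.self_of_nhds u u' v

lemma SymmFormAt.smul_left {g : V → V → V → ℝ} {y : V} (h : SymmFormAt g y) (c : ℝ) (u v : V) :
    g y (c • u) v = c * g y u v := h.smul.self_of_nhds c u v

lemma SymmFormAt.add_right {g : V → V → V → ℝ} {y : V} (h : SymmFormAt g y) (u v v' : V) :
    g y u (v + v') = g y u v + g y u v' := by
  rw [h.symm', h.add_left, h.symm' v, h.symm' v']

lemma SymmFormAt.smul_right {g : V → V → V → ℝ} {y : V} (h : SymmFormAt g y) (c : ℝ) (u v : V) :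
    g y u (c • v) = c * g y u v := by
  rw [h.symm', h.smul_left, h.symm' v]

lemma SymmFormAt.differentiableAt {g : V → V → V → ℝ} {y : V} (h : SymmFormAt g y) (u v : V) :
    DifferentiableAt ℝ (fun z => g z u v) y := by
  have h1 : DifferentiableAt ℝ (fun z : V => (z, u, v)) y := by fun_prop
  exact DifferentiableAt.comp (g := fun q : V × V × V => g q.1 q.2.1 q.2.2)
    (f := fun z : V => (z, u, v)) y (h.diff u v) h1

lemma SymmFormAt.hasFDerivAt {g : V → V → V → ℝ} {p u v : X → V} {p' u' v' : X →L[ℝ] V} {x : X}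
    (h : SymmFormAt g (p x)) (hp : HasFDerivAt p p' x) (hu : HasFDerivAt u u' x)
    (hv : HasFDerivAt v v' x) :
    ∃ L : X →L[ℝ] ℝ, HasFDerivAt (fun z => g (p z) (u z) (v z)) L x ∧
      ∀ a, L a = fderiv ℝ (fun y => g y (u x) (v x)) (p x) (p' a) + g (p x) (u' a) (v x)
        + g (p x) (u x) (v' a) := by
  set D := fderiv ℝ (fun q : V × V × V => g q.1 q.2.1 q.2.2) (p x, u x, v x) with hD
  have hDf : HasFDerivAt (fun q : V × V × V => g q.1 q.2.1 q.2.2) D (p x, u x, v x) :=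
    (h.diff _ _).hasFDerivAt
  refine ⟨_, HasFDerivAt.comp (g := fun q : V × V × V => g q.1 q.2.1 q.2.2)
    (f := fun z => (p z, u z, v z)) x hDf (hp.prodMk (hu.prodMk hv)), fun a => ?_⟩
  have h1 : ∀ b, fderiv ℝ (fun y => g y (u x) (v x)) (p x) b = D (b, 0, 0) := fun b => by
    have e := HasFDerivAt.comp (g := fun q : V × V × V => g q.1 q.2.1 q.2.2)
      (f := fun z => (z, u x, v x)) (p x) hDf
      ((hasFDerivAt_id (p x)).prodMk ((hasFDerivAt_const _ _).prodMk (hasFDerivAt_const _ _)))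
    have e' := congrArg (fun L => L b) e.fderiv
    exact e'
  have h2 : ∀ b, g (p x) b (v x) = D (0, b, 0) := fun b => by
    have e1 : HasDerivAt (fun s : ℝ => (p x, u x + s • b, v x)) ((0 : V), b, (0 : V)) 0 := by
      have := ((hasDerivAt_id (0 : ℝ)).smul_const b).const_add (u x)
      simpa using (hasDerivAt_const (0 : ℝ) (p x)).prodMk
        (this.prodMk (hasDerivAt_const (0 : ℝ) (v x)))
    have e2 := hDf.comp_hasDerivAt_of_eq (0 : ℝ) e1 (by simp)
    have e3 : HasDerivAt (fun s : ℝ => g (p x) (u x) (v x) + s * g (p x) b (v x))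
        (g (p x) b (v x)) 0 := by
      simpa using ((hasDerivAt_id (0 : ℝ)).mul_const (g (p x) b (v x))).const_add
        (g (p x) (u x) (v x))
    refine e3.unique (e2.congr_of_eventuallyEq (Eventually.of_forall fun s => ?_))
    simp only [Function.comp_apply]
    rw [h.add_left, h.smul_left]
  have h3 : ∀ b, g (p x) (u x) b = D (0, 0, b) := fun b => by
    have e1 : HasDerivAt (fun s : ℝ => (p x, u x, v x + s • b)) ((0 : V), (0 : V), b) 0 := by
      have := ((hasDerivAt_id (0 : ℝ)).smul_const b).const_add (v x)
      simpa using (hasDerivAt_const (0 : ℝ) (p x)).prodMk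
        ((hasDerivAt_const (0 : ℝ) (u x)).prodMk this)
    have e2 := hDf.comp_hasDerivAt_of_eq (0 : ℝ) e1 (by simp)
    have e3 : HasDerivAt (fun s : ℝ => g (p x) (u x) (v x) + s * g (p x) (u x) b)
        (g (p x) (u x) b) 0 := by
      simpa using ((hasDerivAt_id (0 : ℝ)).mul_const (g (p x) (u x) b)).const_add
        (g (p x) (u x) (v x))
    refine e3.unique (e2.congr_of_eventuallyEq (Eventually.of_forall fun s => ?_))
    simp only [Function.comp_apply]
    rw [h.add_right, h.smul_right]
  rw [h1, h2, h3, ← map_add, ← map_add]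
  simp

lemma SymmFormAt.hasDerivAt {g : V → V → V → ℝ} {p u v : ℝ → V} {p' u' v' : V} {t : ℝ}
    (h : SymmFormAt g (p t)) (hp : HasDerivAt p p' t) (hu : HasDerivAt u u' t)
    (hv : HasDerivAt v v' t) :
    HasDerivAt (fun s => g (p s) (u s) (v s))
      (fderiv ℝ (fun y => g y (u t) (v t)) (p t) p' + g (p t) u' (v t) + g (p t) (u t) v') t := by
  obtain ⟨L, hL, hLa⟩ := h.hasFDerivAt hp.hasFDerivAt hu.hasFDerivAt hv.hasFDerivAt
  refine hL.hasDerivAt.congr_deriv ?_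
  rw [hLa]; simp

/-- A field of symmetric bilinear forms on a finite-dimensional space is differentiable as soon
as its components are. -/
lemma SymmFormAt.of_components [FiniteDimensional ℝ V] {g : V → V → V → ℝ} {y : V}
    (symm : ∀ᶠ z in 𝓝 y, ∀ u v, g z u v = g z v u)
    (add : ∀ᶠ z in 𝓝 y, ∀ u u' v, g z (u + u') v = g z u v + g z u' v)
    (smul : ∀ᶠ z in 𝓝 y, ∀ (c : ℝ) u v, g z (c • u) v = c * g z u v)
    (diff : ∀ u v, DifferentiableAt ℝ (fun z => g z u v) y) : SymmFormAt g y := by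
  refine ⟨symm, add, smul, fun u v => ?_⟩
  let b := Module.finBasis ℝ V
  let L : Fin (Module.finrank ℝ V) → V →L[ℝ] ℝ := fun i => LinearMap.toContinuousLinearMap (b.coord i)
  have hL : ∀ w, w = ∑ i, L i w • b i := fun w => (b.sum_repr w).symm
  have hexp : (fun q : V × V × V => g q.1 q.2.1 q.2.2) =ᶠ[𝓝 (y, u, v)]
      fun q => ∑ i, ∑ j, L i q.2.1 * (L j q.2.2 * g q.1 (b i) (b j)) := by
    have h1 : Tendsto (fun q : V × V × V => q.1) (𝓝 (y, u, v)) (𝓝 y) :=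
      continuous_fst.continuousAt
    filter_upwards [h1.eventually symm, h1.eventually add, h1.eventually smul] with q hs ha hm
    have hsum : ∀ (w : V) (c : Fin (Module.finrank ℝ V) → ℝ),
        g q.1 (∑ i, c i • b i) w = ∑ i, c i * g q.1 (b i) w := fun w c => by
      let l : V →ₗ[ℝ] ℝ :=
        { toFun := fun u => g q.1 u w
          map_add' := fun u u' => ha u u' w
          map_smul' := fun c u => hm c u w }
      change l _ = ∑ i, c i * l (b i)
      simp
    calc g q.1 q.2.1 q.2.2 = ∑ i, L i q.2.1 * g q.1 (b i) q.2.2 := by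
          rw [← hsum, ← hL]
      _ = _ := by
          refine Finset.sum_congr rfl fun i _ => ?_
          rw [← Finset.mul_sum]
          congr 1
          rw [hs, hL q.2.2, hsum]
          refine Finset.sum_congr rfl fun j _ => ?_
          rw [← hL, hs]
  refine DifferentiableAt.congr_of_eventuallyEq ?_ hexp
  refine DifferentiableAt.fun_sum fun i _ => DifferentiableAt.fun_sum fun j _ => ?_
  have h2 : DifferentiableAt ℝ (fun q : V × V × V => g q.1 (b i) (b j)) (y, u, v) :=
    DifferentiableAt.comp (g := fun z => g z (b i) (b j)) (f := fun q : V × V × V => q.1) (y, u, v)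
      (diff _ _) differentiableAt_fst
  have h3 : DifferentiableAt ℝ (fun q : V × V × V => L i q.2.1) (y, u, v) := by fun_prop
  have h4 : DifferentiableAt ℝ (fun q : V × V × V => L j q.2.2) (y, u, v) := by fun_prop
  exact h3.fun_mul (h4.fun_mul h2)

end Forms

section EulerLagrange

variable {V : Type*} [NormedAddCommGroup V] [NormedSpace ℝ V]
  {W : Type*} [NormedAddCommGroup W] [NormedSpace ℝ W]

/-- The left-hand side of the geodesic equation of the field of bilinear forms `g` for the curve
`c`, paired with `w`; it is the Euler-Lagrange operator of the energy `g(c', c') / 2`. -/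
noncomputable def eulerLagrange (g : V → V → V → ℝ) (c : ℝ → V) (s : ℝ) (w : V) : ℝ :=
  g (c s) (deriv (deriv c) s) w
    + (fderiv ℝ (fun z => g z (deriv c s) w) (c s) (deriv c s)
      + fderiv ℝ (fun z => g z (deriv c s) w) (c s) (deriv c s)
      - fderiv ℝ (fun z => g z (deriv c s) (deriv c s)) (c s) w) / 2

lemma eulerLagrange_congr_metric {g g' : V → V → V → ℝ} {c : ℝ → V} {s : ℝ}
    (h : ∀ᶠ z in 𝓝 (c s), ∀ u v, g z u v = g' z u v) (w : V) :
    eulerLagrange g c s w = eulerLagrange g' c s w := by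
  have key : ∀ u v, (fun z => g z u v) =ᶠ[𝓝 (c s)] fun z => g' z u v :=
    fun u v => h.mono fun z hz => hz u v
  simp only [eulerLagrange, (key _ _).fderiv_eq, h.self_of_nhds]

lemma eulerLagrange_congr_curve {g : V → V → V → ℝ} {c c' : ℝ → V} {s : ℝ}
    (h : c =ᶠ[𝓝 s] c') (w : V) : eulerLagrange g c s w = eulerLagrange g c' s w := by
  simp only [eulerLagrange, h.deriv.deriv_eq, h.deriv_eq, h.self_of_nhds]

lemma hasDerivAt_deriv_of_contDiffAt {c : ℝ → V} {s : ℝ} (hc : ContDiffAt ℝ 2 c s) :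
    HasDerivAt c (deriv c s) s ∧ HasDerivAt (deriv c) (deriv (deriv c) s) s ∧
      ∀ᶠ r in 𝓝 s, HasDerivAt c (deriv c r) r := by
  refine ⟨(hc.differentiableAt (by simp)).hasDerivAt, ?_, ?_⟩
  · have h1 : ContDiffAt ℝ 1 (deriv c) s := hc.derivWithin (by norm_num)
    exact (h1.differentiableAt (by simp)).hasDerivAt
  · filter_upwards [hc.eventually (by simp)] with r hr
    exact (hr.differentiableAt (by simp)).hasDerivAt

/-- The first variation of the squared speed. -/
lemma hasDerivAt_speed {g : V → V → V → ℝ} {c : ℝ → V} {s : ℝ}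
    (hc : ContDiffAt ℝ 2 c s) (hg : SymmFormAt g (c s)) :
    HasDerivAt (fun t => g (c t) (deriv c t) (deriv c t))
      (2 * eulerLagrange g c s (deriv c s)) s := by
  obtain ⟨h1, h2, -⟩ := hasDerivAt_deriv_of_contDiffAt hc
  refine (hg.hasDerivAt h1 h2 h2).congr_deriv ?_
  rw [eulerLagrange, hg.symm' (deriv c s)]
  ring

/-- The Euler-Lagrange operator under a change of parameter. -/
lemma eulerLagrange_comp {g : V → V → V → ℝ} {b : ℝ → V} {h : ℝ → ℝ} {t : ℝ}
    (hb : ContDiffAt ℝ 2 b (h t)) (hh : ContDiffAt ℝ 2 h t) (hg : SymmFormAt g (b (h t)))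
    (w : V) :
    eulerLagrange g (b ∘ h) t w =
      deriv h t ^ 2 * eulerLagrange g b (h t) w
        + deriv (deriv h) t * g (b (h t)) (deriv b (h t)) w := by
  obtain ⟨b1, b2, b3⟩ := hasDerivAt_deriv_of_contDiffAt hb
  obtain ⟨h1, h2, h3⟩ := hasDerivAt_deriv_of_contDiffAt hh
  have hd : deriv (b ∘ h) =ᶠ[𝓝 t] fun r => deriv h r • deriv b (h r) := by
    filter_upwards [h3, h1.continuousAt.eventually b3] with r hr1 hr2
    exact (hr2.scomp r hr1).deriv
  have hdd : deriv (deriv (b ∘ h)) t =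
      deriv h t • (deriv h t • deriv (deriv b) (h t)) + deriv (deriv h) t • deriv b (h t) := by
    rw [hd.deriv_eq]
    exact (h2.smul (b2.scomp t h1)).deriv
  have hf : ∀ (c : ℝ) a u v, fderiv ℝ (fun z => g z (c • u) v) (b (h t)) a =
      c * fderiv ℝ (fun z => g z u v) (b (h t)) a := fun c a u v => by
    have e : (fun z => g z (c • u) v) =ᶠ[𝓝 (b (h t))] fun z => c * g z u v :=
      hg.smul.mono fun z hz => hz c u v
    rw [e.fderiv_eq, ((hg.differentiableAt u v).hasFDerivAt.const_mul c).fderiv]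
    simp
  have hf' : ∀ (c : ℝ) a u v, fderiv ℝ (fun z => g z u (c • v)) (b (h t)) a =
      c * fderiv ℝ (fun z => g z u v) (b (h t)) a := fun c a u v => by
    have e : (fun z => g z u (c • v)) =ᶠ[𝓝 (b (h t))] fun z => c * g z u v := by
      filter_upwards [hg.smul, hg.symm] with z hz hs
      rw [hs, hz, hs]
    rw [e.fderiv_eq, ((hg.differentiableAt u v).hasFDerivAt.const_mul c).fderiv]
    simp
  simp only [eulerLagrange, hdd, hd.self_of_nhds, Function.comp_apply, hf, hf', map_smul,
    hg.add_left, hg.smul_left, smul_eq_mul]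
  ring

/-- The Euler-Lagrange operator is natural under pullback. -/
lemma eulerLagrange_pullback {g : V → V → V → ℝ} {g' : W → W → W → ℝ} {Φ : V → W}
    {b : ℝ → V} {s : ℝ} (hb : ContDiffAt ℝ 2 b s) (hΦ : ContDiffAt ℝ 2 Φ (b s))
    (hg' : SymmFormAt g' (Φ (b s)))
    (hg : ∀ᶠ y in 𝓝 (b s), ∀ u v, g y u v = g' (Φ y) (fderiv ℝ Φ y u) (fderiv ℝ Φ y v)) (w : V) :
    eulerLagrange g b s w = eulerLagrange g' (Φ ∘ b) s (fderiv ℝ Φ (b s) w) := by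
  rw [eulerLagrange_congr_metric hg]
  obtain ⟨b1, b2, b3⟩ := hasDerivAt_deriv_of_contDiffAt hb
  have Φ1 : HasFDerivAt Φ (fderiv ℝ Φ (b s)) (b s) :=
    (hΦ.differentiableAt (by simp)).hasFDerivAt
  have Φ2 : HasFDerivAt (fderiv ℝ Φ) (fderiv ℝ (fderiv ℝ Φ) (b s)) (b s) := by
    have h1 : ContDiffAt ℝ 1 (fderiv ℝ Φ) (b s) := hΦ.fderiv_right (by norm_num)
    exact (h1.differentiableAt (by simp)).hasFDerivAt
  have Φ3 : ∀ᶠ y in 𝓝 (b s), HasFDerivAt Φ (fderiv ℝ Φ y) y := by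
    filter_upwards [hΦ.eventually (by simp)] with r hr
    exact (hr.differentiableAt (by simp)).hasFDerivAt
  have hs : IsSymmSndFDerivAt ℝ Φ (b s) := hΦ.isSymmSndFDerivAt (by simp)
  have hd : deriv (Φ ∘ b) =ᶠ[𝓝 s] fun r => fderiv ℝ Φ (b r) (deriv b r) := by
    filter_upwards [b3, b1.continuousAt.eventually Φ3] with r hr1 hr2
    exact (hr2.comp_hasDerivAt r hr1).deriv
  have hdd : deriv (deriv (Φ ∘ b)) s =
      fderiv ℝ (fderiv ℝ Φ) (b s) (deriv b s) (deriv b s)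
        + fderiv ℝ Φ (b s) (deriv (deriv b) s) := by
    rw [hd.deriv_eq]
    exact ((Φ2.comp_hasDerivAt s b1).clm_apply b2).deriv
  have hf' : ∀ a u v,
      fderiv ℝ (fun y => g' (Φ y) (fderiv ℝ Φ y u) (fderiv ℝ Φ y v)) (b s) a =
      fderiv ℝ (fun z => g' z (fderiv ℝ Φ (b s) u) (fderiv ℝ Φ (b s) v)) (Φ (b s))
        (fderiv ℝ Φ (b s) a)
      + g' (Φ (b s)) (fderiv ℝ (fderiv ℝ Φ) (b s) a u) (fderiv ℝ Φ (b s) v)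
      + g' (Φ (b s)) (fderiv ℝ Φ (b s) u) (fderiv ℝ (fderiv ℝ Φ) (b s) a v) := fun a u v => by
    have e2 := Φ2.clm_apply (hasFDerivAt_const u (b s))
    have e3 := Φ2.clm_apply (hasFDerivAt_const v (b s))
    obtain ⟨L, hL, hLa⟩ := hg'.hasFDerivAt Φ1 e2 e3
    rw [hL.fderiv, hLa]
    simp
  simp only [eulerLagrange, hdd, hd.self_of_nhds, Function.comp_apply, hf', hg'.add_left]
  rw [hs w (deriv b s), hg'.symm' _ (fderiv ℝ (fderiv ℝ Φ) (b s) (deriv b s) w)]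
  ring

/-- The Euler-Lagrange operator under a conformal change of the metric. -/
lemma eulerLagrange_conformal {g g' : V → V → V → ℝ} {lam : V → ℝ} {c : ℝ → V} {s : ℝ}
    (hlam : DifferentiableAt ℝ lam (c s))
    (hg : ∀ u v, DifferentiableAt ℝ (fun z => g z u v) (c s))
    (hg' : ∀ᶠ z in 𝓝 (c s), ∀ u v, g' z u v = lam z * g z u v) (w : V) :
    eulerLagrange g' c s w = lam (c s) * eulerLagrange g c s w
      + fderiv ℝ lam (c s) (deriv c s) * g (c s) (deriv c s) w
      - fderiv ℝ lam (c s) w * g (c s) (deriv c s) (deriv c s) / 2 := by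
  rw [eulerLagrange_congr_metric hg']
  have hf : ∀ a u v, fderiv ℝ (fun z => lam z * g z u v) (c s) a =
      lam (c s) * fderiv ℝ (fun z => g z u v) (c s) a + fderiv ℝ lam (c s) a * g (c s) u v :=
    fun a u v => by
      have h := hlam.hasFDerivAt.fun_mul (hg u v).hasFDerivAt
      rw [h.fderiv]
      simp [mul_comm]
  simp only [eulerLagrange, hf]
  ring

/-- The Euler-Lagrange operator of the warped product `g - e^{-σ t} dt²` along a graph. -/
lemma eulerLagrange_warped {g : V → V → V → ℝ} {r : ℝ → V} {t : ℝ} (σ : ℝ)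
    (hr : ContDiffAt ℝ 2 r t) (hg : SymmFormAt g (r t)) (w : V) (a : ℝ) :
    (∀ u v : V × ℝ, DifferentiableAt ℝ
      (fun z : V × ℝ => g z.1 u.1 v.1 - Real.exp (-σ * z.2) * u.2 * v.2) (r t, t)) ∧
    eulerLagrange (fun (z : V × ℝ) u v => g z.1 u.1 v.1 - Real.exp (-σ * z.2) * u.2 * v.2)
      (fun s => (r s, s)) t (w, a) =
    eulerLagrange g r t w + σ / 2 * Real.exp (-σ * t) * a := by
  obtain ⟨r1, r2, r3⟩ := hasDerivAt_deriv_of_contDiffAt hr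
  have hd : deriv (fun s => (r s, s)) =ᶠ[𝓝 t] fun s => (deriv r s, (1 : ℝ)) := by
    filter_upwards [r3] with s hs
    exact (hs.prodMk (hasDerivAt_id s)).deriv
  have hdd : deriv (deriv (fun s => (r s, s))) t = (deriv (deriv r) t, (0 : ℝ)) := by
    rw [hd.deriv_eq]
    exact (r2.prodMk (hasDerivAt_const t (1 : ℝ))).deriv
  have hf' : ∀ u v : V × ℝ, ∃ L : V × ℝ →L[ℝ] ℝ,
      HasFDerivAt (fun z : V × ℝ => g z.1 u.1 v.1 - Real.exp (-σ * z.2) * u.2 * v.2) L (r t, t) ∧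
      ∀ a, L a = fderiv ℝ (fun z => g z u.1 v.1) (r t) a.1
        + σ * a.2 * Real.exp (-σ * t) * u.2 * v.2 := fun u v => by
    have e0 : HasFDerivAt (fun z : V × ℝ => z.1) (ContinuousLinearMap.fst ℝ V ℝ) (r t, t) :=
      hasFDerivAt_fst
    have e2 := HasFDerivAt.comp (r t, t) (g := fun z => g z u.1 v.1) (f := fun z : V × ℝ => z.1)
      (hg.differentiableAt u.1 v.1).hasFDerivAt e0
    have e3 : HasFDerivAt (fun z : V × ℝ => -σ * z.2)
        ((-σ) • ContinuousLinearMap.snd ℝ V ℝ) (r t, t) :=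
      (hasFDerivAt_snd (𝕜 := ℝ) (E := V) (F := ℝ)).const_mul (-σ)
    have e4 := (e3.exp.mul_const u.2).mul_const v.2
    have e5 := e2.fun_sub e4
    refine ⟨_, e5, fun a => ?_⟩
    simp
    ring
  refine ⟨fun u v => let ⟨L, hL, _⟩ := hf' u v; hL.differentiableAt, ?_⟩
  have hf : ∀ a u v : V × ℝ, fderiv ℝ (fun z : V × ℝ => g z.1 u.1 v.1
      - Real.exp (-σ * z.2) * u.2 * v.2) (r t, t) a = fderiv ℝ (fun z => g z u.1 v.1) (r t) a.1
        + σ * a.2 * Real.exp (-σ * t) * u.2 * v.2 := fun a u v => by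
    obtain ⟨L, hL, hLa⟩ := hf' u v
    rw [hL.fderiv, hLa]
  have hf1 := fun b => hf b (deriv r t, 1) (w, a)
  have hf2 := hf (w, a) (deriv r t, 1) (deriv r t, 1)
  simp only at hf1 hf2
  simp only [eulerLagrange, hdd, hd.self_of_nhds, hf1, hf2]
  ring

/-- If the pullback of `g'` under `Φ` is conformal to `g - e^{-σ t} dt²`, the Euler-Lagrange
operator of `g'` along the image of the graph of `r`. -/
lemma eulerLagrange_conformal_graph {g : V → V → V → ℝ} {g' : W → W → W → ℝ}
    {Φ : V × ℝ → W} {lam : V × ℝ → ℝ} {r : ℝ → V} {t σ : ℝ}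
    (hr : ContDiffAt ℝ 2 r t) (hg : SymmFormAt g (r t))
    (hΦ : ContDiffAt ℝ 2 Φ (r t, t)) (hg' : SymmFormAt g' (Φ (r t, t)))
    (hlam : DifferentiableAt ℝ lam (r t, t))
    (hpull : ∀ᶠ z in 𝓝 (r t, t), ∀ u v, g' (Φ z) (fderiv ℝ Φ z u) (fderiv ℝ Φ z v) =
      lam z * (g z.1 u.1 v.1 - Real.exp (-σ * z.2) * u.2 * v.2))
    (hnull : g (r t) (deriv r t) (deriv r t) = Real.exp (-σ * t)) (w : V) (a : ℝ) :
    eulerLagrange g' (fun s => Φ (r s, s)) t (fderiv ℝ Φ (r t, t) (w, a)) =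
      lam (r t, t) * (eulerLagrange g r t w + σ / 2 * Real.exp (-σ * t) * a)
      + deriv (fun s => lam (r s, s)) t *
        (g (r t) (deriv r t) w - Real.exp (-σ * t) * a) := by
  have hb : ContDiffAt ℝ 2 (fun s => (r s, s)) t := hr.prodMk contDiffAt_id
  have h1 : HasDerivAt (fun s => (r s, s)) (deriv r t, (1 : ℝ)) t :=
    (hr.differentiableAt (by simp)).hasDerivAt.prodMk (hasDerivAt_id t)
  have key := eulerLagrange_pullback (b := fun s => (r s, s)) hb hΦ hg'
    (g := fun z u v => g' (Φ z) (fderiv ℝ Φ z u) (fderiv ℝ Φ z v))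
    (Eventually.of_forall fun _ _ _ => rfl) (w, a)
  obtain ⟨hdiff, hwarp⟩ := eulerLagrange_warped σ hr hg w a
  have hl : deriv (fun s => lam (r s, s)) t = fderiv ℝ lam (r t, t) (deriv r t, 1) :=
    (hlam.hasFDerivAt.comp_hasDerivAt_of_eq t h1 rfl).deriv
  change _ = eulerLagrange g' (fun s => Φ (r s, s)) t _ at key
  rw [← key, eulerLagrange_conformal (c := fun s => (r s, s)) hlam hdiff hpull, hwarp, h1.deriv, hl]
  simp only [hnull]
  ring

end EulerLagrange

section Charts

variable {E : Type*} [NormedAddCommGroup E] [NormedSpace ℝ E]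
  {H : Type*} [TopologicalSpace H] {I : ModelWithCorners ℝ E H} [I.Boundaryless]
  {N : Type*} [TopologicalSpace N] [ChartedSpace H N] [IsManifold I ∞ N]
  {X : Type*} [NormedAddCommGroup X] [NormedSpace ℝ X]

lemma extChartAt_target_mem_nhds_of_mem {p : N} {y : E} (hy : y ∈ (extChartAt I p).target) :
    (extChartAt I p).target ∈ 𝓝 y :=
  (isOpen_extChartAt_target p).mem_nhds hy

lemma contMDiffAt_chart_symm {p : N} {y : E} (hy : y ∈ (extChartAt I p).target) :
    ContMDiffAt 𝓘(ℝ, E) I ∞ (extChartAt I p).symm y :=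
  (contMDiffOn_extChartAt_symm p y hy).contMDiffAt (extChartAt_target_mem_nhds_of_mem hy)

lemma contMDiffAt_chart {p x : N} (hx : x ∈ (extChartAt I p).source) :
    ContMDiffAt I 𝓘(ℝ, E) ∞ (extChartAt I p) x :=
  contMDiffAt_extChartAt' (by rwa [extChartAt_source] at hx)

lemma mdifferentiableAt_chart_symm {p : N} {y : E} (hy : y ∈ (extChartAt I p).target) :
    MDifferentiableAt 𝓘(ℝ, E) I (extChartAt I p).symm y :=
  (contMDiffAt_chart_symm hy).mdifferentiableAt (by simp)

lemma mdifferentiableAt_chart {p x : N} (hx : x ∈ (extChartAt I p).source) :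
    MDifferentiableAt I 𝓘(ℝ, E) (extChartAt I p) x :=
  (contMDiffAt_chart hx).mdifferentiableAt (by simp)

lemma mfderiv_chart_mfderiv_symm {p : N} {y : E} (hy : y ∈ (extChartAt I p).target) (u : E) :
    mfderiv I 𝓘(ℝ, E) (extChartAt I p) ((extChartAt I p).symm y)
      (mfderiv 𝓘(ℝ, E) I (extChartAt I p).symm y u) = u := by
  have h := mfderiv_extChartAt_comp_mfderivWithin_extChartAt_symm (I := I) hy
  rw [I.range_eq_univ, mfderivWithin_univ] at h
  exact congrArg (fun L => L u) h

lemma mfderiv_symm_mfderiv_chart {p x : N} (hx : x ∈ (extChartAt I p).source)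
    (v : TangentSpace I x) :
    mfderiv 𝓘(ℝ, E) I (extChartAt I p).symm (extChartAt I p x)
      (mfderiv I 𝓘(ℝ, E) (extChartAt I p) x v) = v := by
  have h := mfderivWithin_extChartAt_symm_comp_mfderiv_extChartAt' (I := I) hx
  rw [I.range_eq_univ, mfderivWithin_univ] at h
  exact congrArg (fun L => L v) h

/-- The derivative of a map read in a chart of the target. -/
lemma fderiv_chart_comp {f : X → N} {x : X} {q : N} (hf : MDifferentiableAt 𝓘(ℝ, X) I f x)
    (hx : f x ∈ (extChartAt I q).source) (u : X) :
    fderiv ℝ (fun z => extChartAt I q (f z)) x u =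
      mfderiv I 𝓘(ℝ, E) (extChartAt I q) (f x) (mfderiv 𝓘(ℝ, X) I f x u) := by
  rw [← mfderiv_eq_fderiv]
  have := mfderiv_comp x (mdifferentiableAt_chart hx) hf
  exact congrArg (fun L => L u) this

lemma mfderiv_symm_fderiv_chart_comp {f : X → N} {x : X} {q : N}
    (hf : MDifferentiableAt 𝓘(ℝ, X) I f x)
    (hx : f x ∈ (extChartAt I q).source) (u : X) :
    mfderiv 𝓘(ℝ, E) I (extChartAt I q).symm (extChartAt I q (f x))
      (fderiv ℝ (fun z => extChartAt I q (f z)) x u) = mfderiv 𝓘(ℝ, X) I f x u := by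
  rw [fderiv_chart_comp hf hx]
  exact mfderiv_symm_mfderiv_chart hx _

lemma chartComponents_fderiv_chart_comp
    (g : (x : N) → TangentSpace I x → TangentSpace I x → ℝ) {f : X → N} {x : X} {q : N}
    (hf : MDifferentiableAt 𝓘(ℝ, X) I f x) (hx : f x ∈ (extChartAt I q).source) (u v : X) :
    chartComponents I g q (extChartAt I q (f x))
      (fderiv ℝ (fun z => extChartAt I q (f z)) x u)
      (fderiv ℝ (fun z => extChartAt I q (f z)) x v) =
    g (f x) (mfderiv 𝓘(ℝ, X) I f x u) (mfderiv 𝓘(ℝ, X) I f x v) := by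
  have key : ∀ (x' : N) (_ : x' = f x) (a b : E), g x' a b = g (f x) a b := by
    rintro x' rfl a b; rfl
  rw [chartComponents]
  refine (key _ ((extChartAt I q).left_inv hx) _ _).trans ?_
  congr 1
  · exact mfderiv_symm_fderiv_chart_comp hf hx u
  · exact mfderiv_symm_fderiv_chart_comp hf hx v

lemma contDiffAt_chart_comp {n : WithTop ℕ∞} (hn : n ≤ ∞) {f : X → N} {x : X} {q : N}
    (hf : ContMDiffAt 𝓘(ℝ, X) I n f x)
    (hx : f x ∈ (extChartAt I q).source) :
    ContDiffAt ℝ n (fun z => extChartAt I q (f z)) x :=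
  (((contMDiffAt_chart hx).of_le hn).comp x hf).contDiffAt

/-- The components of a smooth field of symmetric bilinear forms. -/
lemma symmFormAt_chartComponents [FiniteDimensional ℝ E]
    (g : (x : N) → TangentSpace I x → TangentSpace I x → ℝ)
    (hsymm : ∀ x u v, g x u v = g x v u)
    (hadd : ∀ x u u' v, g x (u + u') v = g x u v + g x u' v)
    (hsmul : ∀ x (c : ℝ) u v, g x (c • u) v = c * g x u v) (p : N) (y : E)
    (hdiff : ∀ u v, DifferentiableAt ℝ (fun z => chartComponents I g p z u v) y) :
    SymmFormAt (chartComponents I g p) y := by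
  refine SymmFormAt.of_components (Eventually.of_forall fun z u v => hsymm _ _ _)
    (Eventually.of_forall fun z u u' v => ?_) (Eventually.of_forall fun z c u v => ?_) hdiff
  · exact (congrArg (fun a => g _ a _)
      (map_add (mfderiv 𝓘(ℝ, E) I (extChartAt I p).symm z) u u')).trans (hadd _ _ _ _)
  · exact (congrArg (fun a => g _ a _)
      (map_smul (mfderiv 𝓘(ℝ, E) I (extChartAt I p).symm z) c u)).trans (hsmul _ _ _ _)

end Charts

section TangentMap

variable {E : Type*} [NormedAddCommGroup E] [NormedSpace ℝ E]
  {H : Type*} [TopologicalSpace H] {I : ModelWithCorners ℝ E H}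
  {N : Type*} [TopologicalSpace N] [ChartedSpace H N] [IsManifold I ∞ N]
  {E' : Type*} [NormedAddCommGroup E'] [NormedSpace ℝ E']
  {H' : Type*} [TopologicalSpace H'] {I' : ModelWithCorners ℝ E' H'}
  {N' : Type*} [TopologicalSpace N'] [ChartedSpace H' N'] [IsManifold I' ∞ N']

lemma contMDiffAt_tangentMap {f : N → N'} {s : Set N} (hs : IsOpen s)
    (hf : ContMDiffOn I I' ∞ f s) {q : TangentBundle I N} (hq : q.proj ∈ s) :
    ContMDiffAt I.tangent I'.tangent ∞ (tangentMap I I' f) q := by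
  have h1 := (hf.contMDiffOn_tangentMapWithin (m := ∞) (by simp) hs.uniqueMDiffOn)
  have hopen : IsOpen (π E (TangentSpace I : N → Type _) ⁻¹' s) :=
    hs.preimage (FiberBundle.continuous_proj E (TangentSpace I : N → Type _))
  refine (h1.contMDiffAt (hopen.mem_nhds hq)).congr_of_eventuallyEq ?_
  filter_upwards [hopen.mem_nhds hq] with z hz
  exact (tangentMapWithin_eq_tangentMap (hs.uniqueMDiffWithinAt hz)
    ((hf.contMDiffAt (hs.mem_nhds hz)).mdifferentiableAt (by simp))).symm

end TangentMap

section Riemannian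

variable {E : Type*} [NormedAddCommGroup E] [NormedSpace ℝ E]
  {M : Type*} [TopologicalSpace M] [ChartedSpace E M] [IsManifold 𝓘(ℝ, E) ∞ M]
  {EX : Type*} [NormedAddCommGroup EX] [NormedSpace ℝ EX]
  {HX : Type*} [TopologicalSpace HX] {IX : ModelWithCorners ℝ EX HX}
  {X : Type*} [TopologicalSpace X] [ChartedSpace HX X]

lemma contMDiffAt_inner
    (g₀ : ContMDiffRiemannianMetric 𝓘(ℝ, E) ∞ E (fun x : M => TangentSpace 𝓘(ℝ, E) x))
    {b : X → M} {v w : (m : X) → TangentSpace 𝓘(ℝ, E) (b m)} {x : X}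
    (hv : ContMDiffAt IX 𝓘(ℝ, E).tangent ∞ (fun m => (⟨b m, v m⟩ : TangentBundle 𝓘(ℝ, E) M)) x)
    (hw : ContMDiffAt IX 𝓘(ℝ, E).tangent ∞ (fun m => (⟨b m, w m⟩ : TangentBundle 𝓘(ℝ, E) M)) x) :
    ContMDiffAt IX 𝓘(ℝ, ℝ) ∞ (fun m => g₀.inner (b m) (v m) (w m)) x := by
  have hb : ContMDiffAt IX 𝓘(ℝ, E) ∞ b x :=
    ((contMDiff_proj (TangentSpace 𝓘(ℝ, E) : M → Type _)).contMDiffAt).comp x hv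
  have hψ := (g₀.contMDiff (b x)).comp x hb
  have h := ContMDiffAt.clm_bundle_apply₂ (F₁ := E) (F₂ := E) (F₃ := ℝ)
    (E₁ := fun x : M => TangentSpace 𝓘(ℝ, E) x) (E₂ := fun x : M => TangentSpace 𝓘(ℝ, E) x)
    (E₃ := Bundle.Trivial M ℝ) hψ hv hw
  simp only [contMDiffAt_totalSpace] at h
  exact h.2

lemma tangentBundle_mk_congr {x x' : M} (h : x = x') (a : E) :
    (⟨x, a⟩ : TangentBundle 𝓘(ℝ, E) M) = ⟨x', a⟩ := by
  subst h; rfl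

lemma contMDiffAt_chart_frame {p : M} {y : E} (hy : y ∈ (extChartAt 𝓘(ℝ, E) p).target) (u : E) :
    ContMDiffAt 𝓘(ℝ, E) 𝓘(ℝ, E).tangent ∞
      (fun z => (⟨(extChartAt 𝓘(ℝ, E) p).symm z,
        mfderiv 𝓘(ℝ, E) 𝓘(ℝ, E) (extChartAt 𝓘(ℝ, E) p).symm z u⟩ : TangentBundle 𝓘(ℝ, E) M)) y := by
  have h1 : ContMDiffAt 𝓘(ℝ, E) 𝓘(ℝ, E).tangent ∞
      (fun z => (⟨z, u⟩ : TangentBundle 𝓘(ℝ, E) E)) y :=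
    contMDiffAt_vectorSpace_iff_contDiffAt.2 contDiffAt_const
  have h2 := contMDiffAt_tangentMap (isOpen_extChartAt_target p) (contMDiffOn_extChartAt_symm p)
    (q := (⟨y, u⟩ : TangentBundle 𝓘(ℝ, E) E)) hy
  exact h2.comp y h1

/-- The vector field on `M` with constant components `u` in the chart at `p`. -/
noncomputable def chartFrame (p : M) (u : E) (x : M) : TangentSpace 𝓘(ℝ, E) x :=
  (mfderiv 𝓘(ℝ, E) 𝓘(ℝ, E) (extChartAt 𝓘(ℝ, E) p).symm (extChartAt 𝓘(ℝ, E) p x) u : E)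

lemma smoothFieldAt_chartFrame {p x : M} (hx : x ∈ (extChartAt 𝓘(ℝ, E) p).source) (u : E) :
    SmoothFieldAt 𝓘(ℝ, E) (chartFrame p u) x := by
  have h1 := (contMDiffAt_chart_frame ((extChartAt 𝓘(ℝ, E) p).map_source hx) u).comp x
    (contMDiffAt_chart hx)
  refine h1.congr_of_eventuallyEq ?_
  filter_upwards [(isOpen_extChartAt_source (I := 𝓘(ℝ, E)) p).mem_nhds hx] with z hz
  exact (tangentBundle_mk_congr ((extChartAt 𝓘(ℝ, E) p).left_inv hz) _).symm

/-- The components of the vector field `δ` in the chart at `p`. -/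
noncomputable def fieldComponents (δ : (x : M) → TangentSpace 𝓘(ℝ, E) x) (p : M) (z : E) : E :=
  mfderiv 𝓘(ℝ, E) 𝓘(ℝ, E) (extChartAt 𝓘(ℝ, E) p) ((extChartAt 𝓘(ℝ, E) p).symm z)
    (δ ((extChartAt 𝓘(ℝ, E) p).symm z))

lemma contDiffAt_fieldComponents {δ : (x : M) → TangentSpace 𝓘(ℝ, E) x}
    (hδ : ∀ x, SmoothFieldAt 𝓘(ℝ, E) δ x) {p : M} {y : E}
    (hy : y ∈ (extChartAt 𝓘(ℝ, E) p).target) : ContDiffAt ℝ ∞ (fieldComponents δ p) y := by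
  have hsrc := (extChartAt 𝓘(ℝ, E) p).map_target hy
  have h1 : ContMDiffAt 𝓘(ℝ, E) 𝓘(ℝ, E).tangent ∞
      (fun x => (⟨x, δ x⟩ : TangentBundle 𝓘(ℝ, E) M)) ((extChartAt 𝓘(ℝ, E) p).symm y) := hδ _
  have h2 := contMDiffAt_tangentMap (isOpen_extChartAt_source (I := 𝓘(ℝ, E)) p)
    (f := extChartAt 𝓘(ℝ, E) p) (fun x hx => (contMDiffAt_chart hx).contMDiffWithinAt)
    (q := (⟨(extChartAt 𝓘(ℝ, E) p).symm y, δ ((extChartAt 𝓘(ℝ, E) p).symm y)⟩ :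
      TangentBundle 𝓘(ℝ, E) M)) hsrc
  have h3 := (h2.comp ((extChartAt 𝓘(ℝ, E) p).symm y) h1).comp y (contMDiffAt_chart_symm hy)
  refine contMDiffAt_vectorSpace_iff_contDiffAt.1 (h3.congr_of_eventuallyEq ?_)
  filter_upwards [extChartAt_target_mem_nhds_of_mem hy] with z hz
  exact (tangentBundle_mk_congr ((extChartAt 𝓘(ℝ, E) p).right_inv hz) _).symm

lemma mfderiv_symm_fieldComponents {δ : (x : M) → TangentSpace 𝓘(ℝ, E) x} {p x : M}
    (hx : x ∈ (extChartAt 𝓘(ℝ, E) p).source) :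
    fieldComponents δ p (extChartAt 𝓘(ℝ, E) p x) =
      mfderiv 𝓘(ℝ, E) 𝓘(ℝ, E) (extChartAt 𝓘(ℝ, E) p) x (δ x) := by
  have key : ∀ x' : M, x' = x → (mfderiv 𝓘(ℝ, E) 𝓘(ℝ, E) (extChartAt 𝓘(ℝ, E) p) x' (δ x') : E) =
      mfderiv 𝓘(ℝ, E) 𝓘(ℝ, E) (extChartAt 𝓘(ℝ, E) p) x (δ x) := by
    rintro x' rfl; rfl
  exact key _ ((extChartAt 𝓘(ℝ, E) p).left_inv hx)

lemma contDiffAt_chartComponents_inner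
    (g₀ : ContMDiffRiemannianMetric 𝓘(ℝ, E) ∞ E (fun x : M => TangentSpace 𝓘(ℝ, E) x))
    {p : M} {y : E} (hy : y ∈ (extChartAt 𝓘(ℝ, E) p).target) (u v : E) :
    ContDiffAt ℝ ∞
      (fun z => chartComponents 𝓘(ℝ, E) (fun x u v => g₀.inner x u v) p z u v) y :=
  (contMDiffAt_inner g₀ (contMDiffAt_chart_frame hy u) (contMDiffAt_chart_frame hy v)).contDiffAt

variable {g₀ : ContMDiffRiemannianMetric 𝓘(ℝ, E) ∞ E (fun x : M => TangentSpace 𝓘(ℝ, E) x)}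
    {β : M → ℝ} {δ : (x : M) → TangentSpace 𝓘(ℝ, E) x}

lemma contMDiffAt_conformalFactor (hβ : ContMDiff 𝓘(ℝ, E) 𝓘(ℝ, ℝ) ∞ β)
    (hδ : ∀ x, SmoothFieldAt 𝓘(ℝ, E) δ x) (x : M) :
    ContMDiffAt 𝓘(ℝ, E) 𝓘(ℝ, ℝ) ∞ (conformalFactor g₀ β δ) x :=
  (hβ x).add (contMDiffAt_inner g₀ (hδ x) (hδ x))

lemma inner_self_nonneg (x : M) (v : TangentSpace 𝓘(ℝ, E) x) : 0 ≤ g₀.inner x v v := by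
  by_cases hv : v = 0
  · simp [hv]
  · exact (g₀.pos x v hv).le

lemma conformalFactor_pos (hβ : ∀ x, 0 < β x) (x : M) : 0 < conformalFactor g₀ β δ x :=
  add_pos_of_pos_of_nonneg (hβ x) (inner_self_nonneg x _)

end Riemannian

section LieDerivative

variable {E : Type*} [NormedAddCommGroup E] [NormedSpace ℝ E]
  {M : Type*} [TopologicalSpace M] [ChartedSpace E M] [IsManifold 𝓘(ℝ, E) ∞ M]

lemma mpullback_chart_symm_eventuallyEq (V : (x : M) → TangentSpace 𝓘(ℝ, E) x) (x₀ : M) :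
    VectorField.mpullbackWithin 𝓘(ℝ, E) 𝓘(ℝ, E) (extChartAt 𝓘(ℝ, E) x₀).symm V
      (range 𝓘(ℝ, E)) =ᶠ[𝓝 (extChartAt 𝓘(ℝ, E) x₀ x₀)] fieldComponents V x₀ := by
  filter_upwards [extChartAt_target_mem_nhds (I := 𝓘(ℝ, E)) x₀] with z hz
  have hinv := ContinuousLinearMap.inverse_eq
    (mfderivWithin_extChartAt_symm_comp_mfderiv_extChartAt (I := 𝓘(ℝ, E)) hz)
    (mfderiv_extChartAt_comp_mfderivWithin_extChartAt_symm (I := 𝓘(ℝ, E)) hz)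
  rw [VectorField.mpullbackWithin_apply, hinv]
  rfl

lemma fieldComponents_chartFrame {p : M} {z : E} (hz : z ∈ (extChartAt 𝓘(ℝ, E) p).target) (u : E) :
    fieldComponents (chartFrame p u) p z = u := by
  have h := mfderiv_chart_mfderiv_symm hz u
  rw [fieldComponents, chartFrame]
  rw [(extChartAt 𝓘(ℝ, E) p).right_inv hz]
  exact h

lemma lieBracketWithin_univ_const {V W A : E → E} {y u : E} (hV : V =ᶠ[𝓝 y] A)
    (hW : W =ᶠ[𝓝 y] fun _ => u) :
    VectorField.lieBracketWithin ℝ V W univ y = -(fderiv ℝ A y u) := by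
  rw [VectorField.lieBracketWithin_univ, (hV.lieBracket_vectorField hW).self_of_nhds,
    VectorField.lieBracket]
  simp

/-- The bracket with a constant vector field of the chart. -/
lemma mlieBracket_chartFrame {δ : (x : M) → TangentSpace 𝓘(ℝ, E) x} (x₀ : M) (u : E) :
    VectorField.mlieBracket 𝓘(ℝ, E) δ (chartFrame x₀ u) x₀ =
      mfderiv 𝓘(ℝ, E) 𝓘(ℝ, E) (extChartAt 𝓘(ℝ, E) x₀).symm (extChartAt 𝓘(ℝ, E) x₀ x₀)
        (-(fderiv ℝ (fieldComponents δ x₀) (extChartAt 𝓘(ℝ, E) x₀ x₀) u) : E) := by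
  have hconst : fieldComponents (chartFrame x₀ u) x₀ =ᶠ[𝓝 (extChartAt 𝓘(ℝ, E) x₀ x₀)]
      fun _ => u := by
    filter_upwards [extChartAt_target_mem_nhds (I := 𝓘(ℝ, E)) x₀] with z hz
    exact fieldComponents_chartFrame hz u
  have hmem := mem_extChartAt_source (I := 𝓘(ℝ, E)) x₀
  have hinv := ContinuousLinearMap.inverse_eq
    (mfderiv_extChartAt_comp_mfderivWithin_extChartAt_symm' (I := 𝓘(ℝ, E)) hmem)
    (mfderivWithin_extChartAt_symm_comp_mfderiv_extChartAt' (I := 𝓘(ℝ, E)) hmem)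
  rw [← VectorField.mlieBracketWithin_univ, VectorField.mlieBracketWithin_apply, hinv]
  have hset : (extChartAt 𝓘(ℝ, E) x₀).symm ⁻¹' univ ∩ range 𝓘(ℝ, E) = univ := by simp
  have hbr : VectorField.lieBracketWithin ℝ
      (VectorField.mpullbackWithin 𝓘(ℝ, E) 𝓘(ℝ, E) (extChartAt 𝓘(ℝ, E) x₀).symm δ (range 𝓘(ℝ, E)))
      (VectorField.mpullbackWithin 𝓘(ℝ, E) 𝓘(ℝ, E) (extChartAt 𝓘(ℝ, E) x₀).symm
        (chartFrame x₀ u) (range 𝓘(ℝ, E)))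
      ((extChartAt 𝓘(ℝ, E) x₀).symm ⁻¹' univ ∩ range 𝓘(ℝ, E)) (extChartAt 𝓘(ℝ, E) x₀ x₀) =
      -(fderiv ℝ (fieldComponents δ x₀) (extChartAt 𝓘(ℝ, E) x₀ x₀) u) := by
    rw [hset]
    exact lieBracketWithin_univ_const (mpullback_chart_symm_eventuallyEq δ x₀)
      ((mpullback_chart_symm_eventuallyEq (chartFrame x₀ u) x₀).trans hconst)
  rw [hbr, 𝓘(ℝ, E).range_eq_univ, mfderivWithin_univ]
  rfl

variable {g₀ : ContMDiffRiemannianMetric 𝓘(ℝ, E) ∞ E (fun x : M => TangentSpace 𝓘(ℝ, E) x)}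
    {β : M → ℝ} {δ : (x : M) → TangentSpace 𝓘(ℝ, E) x}

lemma mvfderiv_eq_fderiv_chart {f : M → ℝ} {x₀ : M}
    (hf : ContMDiffAt 𝓘(ℝ, E) 𝓘(ℝ, ℝ) ∞ f x₀) (v : TangentSpace 𝓘(ℝ, E) x₀) :
    mvfderiv 𝓘(ℝ, E) f x₀ v =
      fderiv ℝ (fun z => f ((extChartAt 𝓘(ℝ, E) x₀).symm z)) (extChartAt 𝓘(ℝ, E) x₀ x₀)
        (mfderiv 𝓘(ℝ, E) 𝓘(ℝ, E) (extChartAt 𝓘(ℝ, E) x₀) x₀ v) := by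
  have hmem := mem_extChartAt_source (I := 𝓘(ℝ, E)) x₀
  have hf' : MDifferentiableAt 𝓘(ℝ, E) 𝓘(ℝ, ℝ) f
      ((extChartAt 𝓘(ℝ, E) x₀).symm (extChartAt 𝓘(ℝ, E) x₀ x₀)) := by
    rw [(extChartAt 𝓘(ℝ, E) x₀).left_inv hmem]
    exact hf.mdifferentiableAt (by simp)
  have h1 : MDifferentiableAt 𝓘(ℝ, E) 𝓘(ℝ, ℝ) (fun z => f ((extChartAt 𝓘(ℝ, E) x₀).symm z))
      (extChartAt 𝓘(ℝ, E) x₀ x₀) :=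
    hf'.comp _ (mdifferentiableAt_chart_symm (mem_extChartAt_target x₀))
  have h2 := mfderiv_comp x₀ h1 (mdifferentiableAt_chart hmem)
  have h3 : (fun z => f ((extChartAt 𝓘(ℝ, E) x₀).symm z)) ∘ extChartAt 𝓘(ℝ, E) x₀ =ᶠ[𝓝 x₀] f := by
    filter_upwards [extChartAt_source_mem_nhds (I := 𝓘(ℝ, E)) x₀] with z hz
    rw [Function.comp_apply, (extChartAt 𝓘(ℝ, E) x₀).left_inv hz]
  rw [h3.mfderiv_eq, mfderiv_eq_fderiv] at h2
  exact congrArg (fun L => L v) h2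

/-- The Lie derivative of the metric in the chart at the base point. -/
lemma lieDerivative_chartFrame (x₀ : M) (u v : E) :
    lieDerivative 𝓘(ℝ, E) δ (fun y u v => g₀.inner y u v) (chartFrame x₀ u) (chartFrame x₀ v) x₀ =
      fderiv ℝ (fun z => chartComponents 𝓘(ℝ, E) (fun x u v => g₀.inner x u v) x₀ z u v)
        (extChartAt 𝓘(ℝ, E) x₀ x₀) (fieldComponents δ x₀ (extChartAt 𝓘(ℝ, E) x₀ x₀))
      + chartComponents 𝓘(ℝ, E) (fun x u v => g₀.inner x u v) x₀ (extChartAt 𝓘(ℝ, E) x₀ x₀)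
        (fderiv ℝ (fieldComponents δ x₀) (extChartAt 𝓘(ℝ, E) x₀ x₀) u) v
      + chartComponents 𝓘(ℝ, E) (fun x u v => g₀.inner x u v) x₀ (extChartAt 𝓘(ℝ, E) x₀ x₀)
        u (fderiv ℝ (fieldComponents δ x₀) (extChartAt 𝓘(ℝ, E) x₀ x₀) v) := by
  have hmem := mem_extChartAt_source (I := 𝓘(ℝ, E)) x₀
  have hleft := (extChartAt 𝓘(ℝ, E) x₀).left_inv hmem
  have hpt : ∀ a b : E, chartComponents 𝓘(ℝ, E) (fun x u v => g₀.inner x u v) x₀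
      (extChartAt 𝓘(ℝ, E) x₀ x₀) a b = g₀.inner x₀
        (mfderiv 𝓘(ℝ, E) 𝓘(ℝ, E) (extChartAt 𝓘(ℝ, E) x₀).symm (extChartAt 𝓘(ℝ, E) x₀ x₀) a : E)
        (mfderiv 𝓘(ℝ, E) 𝓘(ℝ, E) (extChartAt 𝓘(ℝ, E) x₀).symm (extChartAt 𝓘(ℝ, E) x₀ x₀) b : E) := by
    intro a b
    have key : ∀ (x' : M) (_ : x' = x₀) (a b : E), g₀.inner x' a b = g₀.inner x₀ a b := by
      rintro x' rfl a b; rfl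
    exact key _ hleft _ _
  have hsm : ContMDiffAt 𝓘(ℝ, E) 𝓘(ℝ, ℝ) ∞
      (fun y => g₀.inner y (chartFrame x₀ u y) (chartFrame x₀ v y)) x₀ :=
    contMDiffAt_inner g₀ (smoothFieldAt_chartFrame hmem u) (smoothFieldAt_chartFrame hmem v)
  have h1 : (fun z => g₀.inner ((extChartAt 𝓘(ℝ, E) x₀).symm z)
      (chartFrame x₀ u ((extChartAt 𝓘(ℝ, E) x₀).symm z))
      (chartFrame x₀ v ((extChartAt 𝓘(ℝ, E) x₀).symm z))) =ᶠ[𝓝 (extChartAt 𝓘(ℝ, E) x₀ x₀)]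
      fun z => chartComponents 𝓘(ℝ, E) (fun x u v => g₀.inner x u v) x₀ z u v := by
    filter_upwards [extChartAt_target_mem_nhds (I := 𝓘(ℝ, E)) x₀] with z hz
    simp only [chartComponents, chartFrame]
    rw [(extChartAt 𝓘(ℝ, E) x₀).right_inv hz]
  rw [lieDerivative, mvfderiv_eq_fderiv_chart hsm, h1.fderiv_eq, mlieBracket_chartFrame,
    mlieBracket_chartFrame, hpt, hpt, mfderiv_symm_fieldComponents hmem]
  have hneg : ∀ a : E, mfderiv 𝓘(ℝ, E) 𝓘(ℝ, E) (extChartAt 𝓘(ℝ, E) x₀).symm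
      (extChartAt 𝓘(ℝ, E) x₀ x₀) (-a : E) = -(mfderiv 𝓘(ℝ, E) 𝓘(ℝ, E)
        (extChartAt 𝓘(ℝ, E) x₀).symm (extChartAt 𝓘(ℝ, E) x₀ x₀) a) := fun a => map_neg _ a
  rw [hneg, hneg]
  have e1 : ∀ a b : E, g₀.inner x₀ (-a : E) b = -(g₀.inner x₀ a b) := fun a b => by
    exact (congrArg (fun L => L b) (map_neg (g₀.inner x₀) a))
  have e2 : ∀ a b : E, g₀.inner x₀ a (-b : E) = -(g₀.inner x₀ a b) := fun a b =>
    map_neg (g₀.inner x₀ a) b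
  erw [e1, e2]
  rw [sub_neg_eq_add, sub_neg_eq_add]
  rfl

end LieDerivative

section FlowDerivative

variable {E : Type*} [NormedAddCommGroup E] [NormedSpace ℝ E]

/-- Along the flow of `-d`, the pullback of a form `g` with `L_d g = -σ g` grows with rate `σ`. -/
lemma hasDerivAt_pullback_flow {g : E → E → E → ℝ} {d : E → E} {Φ : E × ℝ → E} {y : E} {t σ : ℝ}
    (hg : SymmFormAt g (Φ (y, t))) (hΦ : ContDiffAt ℝ 2 Φ (y, t))
    (hd : DifferentiableAt ℝ d (Φ (y, t)))
    (hflow : ∀ᶠ z in 𝓝 (y, t), fderiv ℝ Φ z (0, 1) = -d (Φ z))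
    (hlie : ∀ a b, fderiv ℝ (fun z => g z a b) (Φ (y, t)) (d (Φ (y, t)))
      + g (Φ (y, t)) (fderiv ℝ d (Φ (y, t)) a) b + g (Φ (y, t)) a (fderiv ℝ d (Φ (y, t)) b)
      = -σ * g (Φ (y, t)) a b) (u v : E) :
    HasDerivAt (fun s => g (Φ (y, s)) (fderiv ℝ Φ (y, s) (u, 0)) (fderiv ℝ Φ (y, s) (v, 0)))
      (σ * g (Φ (y, t)) (fderiv ℝ Φ (y, t) (u, 0)) (fderiv ℝ Φ (y, t) (v, 0))) t := by
  have h1 : HasDerivAt (fun s : ℝ => (y, s)) ((0 : E), (1 : ℝ)) t :=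
    (hasDerivAt_const t y).prodMk (hasDerivAt_id t)
  have Φ1 : HasFDerivAt Φ (fderiv ℝ Φ (y, t)) (y, t) :=
    (hΦ.differentiableAt (by simp)).hasFDerivAt
  have Φ2 : HasFDerivAt (fderiv ℝ Φ) (fderiv ℝ (fderiv ℝ Φ) (y, t)) (y, t) := by
    have h1 : ContDiffAt ℝ 1 (fderiv ℝ Φ) (y, t) := hΦ.fderiv_right (by norm_num)
    exact (h1.differentiableAt (by simp)).hasFDerivAt
  have hs : IsSymmSndFDerivAt ℝ Φ (y, t) := hΦ.isSymmSndFDerivAt (by simp)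
  have hc : HasDerivAt (fun s => Φ (y, s)) (-d (Φ (y, t))) t := by
    have := Φ1.comp_hasDerivAt_of_eq t h1 rfl
    rwa [hflow.self_of_nhds] at this
  have hu : ∀ u : E, HasDerivAt (fun s => fderiv ℝ Φ (y, s) (u, 0))
      (-(fderiv ℝ d (Φ (y, t)) (fderiv ℝ Φ (y, t) (u, 0)))) t := by
    intro u
    have e1 := (Φ2.comp_hasDerivAt_of_eq t h1 rfl).clm_apply
      (hasDerivAt_const t ((u, 0) : E × ℝ))
    have e2 : fderiv ℝ (fderiv ℝ Φ) (y, t) (0, 1) (u, 0) =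
        -(fderiv ℝ d (Φ (y, t)) (fderiv ℝ Φ (y, t) (u, 0))) := by
      rw [hs (0, 1) (u, 0)]
      have e3 := Φ2.clm_apply (hasFDerivAt_const ((0, 1) : E × ℝ) (y, t))
      have e4 : HasFDerivAt (fun z => -d (Φ z)) _ (y, t) :=
        (hd.hasFDerivAt.comp (y, t) Φ1).neg
      have e5 := (e3.congr_of_eventuallyEq (hflow.mono fun z hz => hz.symm)).unique e4
      have e6 := congrArg (fun L => L (u, 0)) e5
      simpa using e6
    refine e1.congr_deriv ?_
    rw [← e2]; simp
  refine (hg.hasDerivAt hc (hu u) (hu v)).congr_deriv ?_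
  have hneg_left : ∀ a b, g (Φ (y, t)) (-a) b = -g (Φ (y, t)) a b := fun a b => by
    rw [← neg_one_smul ℝ a, hg.smul_left]; ring
  have hneg_right : ∀ a b, g (Φ (y, t)) a (-b) = -g (Φ (y, t)) a b := fun a b => by
    rw [← neg_one_smul ℝ b, hg.smul_right]; ring
  rw [map_neg, hneg_left, hneg_right]
  linarith [hlie (fderiv ℝ Φ (y, t) (u, 0)) (fderiv ℝ Φ (y, t) (v, 0))]

lemma eq_exp_mul_of_hasDerivAt {m : ℝ → ℝ} {σ ε : ℝ}
    (hm : ∀ t ∈ Ioo (-ε) ε, HasDerivAt m (σ * m t) t) {t : ℝ} (ht : t ∈ Ioo (-ε) ε) :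
    m t = Real.exp (σ * t) * m 0 := by
  have h0 : (0 : ℝ) ∈ Ioo (-ε) ε := by constructor <;> linarith [ht.1, ht.2]
  have hd : ∀ s ∈ Ioo (-ε) ε, HasDerivAt (fun s => Real.exp (-σ * s) * m s) 0 s := by
    intro s hs
    have h1 : HasDerivAt (fun s : ℝ => -σ * s) (-σ) s := by
      simpa using (hasDerivAt_id s).const_mul (-σ)
    refine (h1.exp.mul (hm s hs)).congr_deriv ?_
    ring
  have key := isOpen_Ioo.is_const_of_deriv_eq_zero isPreconnected_Ioo
    (fun s hs => (hd s hs).differentiableAt.differentiableWithinAt)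
    (fun s hs => (hd s hs).deriv) ht h0
  simp only [mul_zero, Real.exp_zero, one_mul] at key
  rw [← key, ← mul_assoc, ← Real.exp_add]
  simp

end FlowDerivative

section FlowMap

variable {E : Type*} [NormedAddCommGroup E] [NormedSpace ℝ E]
  {M : Type*} [TopologicalSpace M] [ChartedSpace E M] [IsManifold 𝓘(ℝ, E) ∞ M]

/-- A flow on `M` with the initial point read in the chart at `p`. -/
noncomputable def flowMap (φ : ℝ → M → M) (p : M) (z : E × ℝ) : M :=
  φ z.2 ((extChartAt 𝓘(ℝ, E) p).symm z.1)

/-- The domain on which `flowMap` is smooth. -/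
def flowDomain (ε : ℝ) (U : Set M) (p : M) : Set (E × ℝ) :=
  {z | (z.1 ∈ (extChartAt 𝓘(ℝ, E) p).target ∧ (extChartAt 𝓘(ℝ, E) p).symm z.1 ∈ U) ∧
    z.2 ∈ Ioo (-ε) ε}

lemma isOpen_flowDomain {ε : ℝ} {U : Set M} (hU : IsOpen U) (p : M) :
    IsOpen (flowDomain ε U p : Set (E × ℝ)) :=
  ((continuousOn_extChartAt_symm p).isOpen_inter_preimage (isOpen_extChartAt_target p) hU).prod
    isOpen_Ioo

variable {δ : (x : M) → TangentSpace 𝓘(ℝ, E) x} {φ : ℝ → M → M} {ε : ℝ} {U : Set M}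

lemma contMDiffAt_flowMap (hU : IsOpen U)
    (hφ : IsLocalFlow 𝓘(ℝ, E) (fun x => -δ x) φ ε U) {p : M} {z : E × ℝ}
    (hz : z ∈ (flowDomain ε U p : Set (E × ℝ))) :
    ContMDiffAt 𝓘(ℝ, E × ℝ) 𝓘(ℝ, E) ∞ (flowMap φ p) z := by
  have h1 : ContMDiffAt (𝓘(ℝ, ℝ).prod 𝓘(ℝ, E)) 𝓘(ℝ, E) ∞ (fun q : ℝ × M => φ q.1 q.2)
      (z.2, (extChartAt 𝓘(ℝ, E) p).symm z.1) :=
    (hφ.1 _ ⟨hz.2, hz.1.2⟩).contMDiffAt ((isOpen_Ioo.prod hU).mem_nhds ⟨hz.2, hz.1.2⟩)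
  have h2 : ContMDiffAt 𝓘(ℝ, E × ℝ) 𝓘(ℝ, ℝ) ∞ (fun z : E × ℝ => z.2) z :=
    contDiff_snd.contMDiff z
  have h3 : ContMDiffAt 𝓘(ℝ, E × ℝ) 𝓘(ℝ, E) ∞ (fun z : E × ℝ => z.1) z :=
    contDiff_fst.contMDiff z
  have h4 : ContMDiffAt 𝓘(ℝ, E × ℝ) 𝓘(ℝ, E) ∞
      (fun z : E × ℝ => (extChartAt 𝓘(ℝ, E) p).symm z.1) z :=
    ContMDiffAt.comp z (g := (extChartAt 𝓘(ℝ, E) p).symm) (contMDiffAt_chart_symm hz.1.1) h3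
  exact h1.comp z (h2.prodMk h4)

lemma mdifferentiableAt_flowMap (hU : IsOpen U)
    (hφ : IsLocalFlow 𝓘(ℝ, E) (fun x => -δ x) φ ε U) {p : M} {z : E × ℝ}
    (hz : z ∈ (flowDomain ε U p : Set (E × ℝ))) :
    MDifferentiableAt 𝓘(ℝ, E × ℝ) 𝓘(ℝ, E) (flowMap φ p) z :=
  (contMDiffAt_flowMap hU hφ hz).mdifferentiableAt (by simp)

lemma mfderiv_flowMap_time (hU : IsOpen U)
    (hφ : IsLocalFlow 𝓘(ℝ, E) (fun x => -δ x) φ ε U) {p : M} {z : E × ℝ}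
    (hz : z ∈ (flowDomain ε U p : Set (E × ℝ))) :
    mfderiv 𝓘(ℝ, E × ℝ) 𝓘(ℝ, E) (flowMap φ p) z ((0, 1) : E × ℝ) = -δ (flowMap φ p z) := by
  have h1 : HasMFDerivAt 𝓘(ℝ, ℝ) 𝓘(ℝ, E) (fun t => φ t ((extChartAt 𝓘(ℝ, E) p).symm z.1)) z.2
      (ContinuousLinearMap.smulRight (1 : ℝ →L[ℝ] ℝ) (-δ (flowMap φ p z))) :=
    ((hφ.2 _ hz.1.2).2 z.2 hz.2).hasMFDerivAt (isOpen_Ioo.mem_nhds hz.2)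
  have h2 : HasDerivAt (fun s : ℝ => (z.1, s)) ((0 : E), (1 : ℝ)) z.2 :=
    (hasDerivAt_const z.2 z.1).prodMk (hasDerivAt_id z.2)
  have h3 := (mdifferentiableAt_flowMap hU hφ hz).hasMFDerivAt.comp z.2
    (f := fun s : ℝ => (z.1, s)) h2.hasFDerivAt.hasMFDerivAt
  have h4 := hasMFDerivAt_unique h3 h1
  have h5 := congrArg (fun L => L (1 : ℝ)) h4
  have h6 : mfderiv 𝓘(ℝ, E × ℝ) 𝓘(ℝ, E) (flowMap φ p) z ((1 : ℝ) • ((0, 1) : E × ℝ)) =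
      (1 : ℝ) • (-δ (flowMap φ p z)) := h5
  rw [one_smul, one_smul] at h6
  exact h6

lemma mfderiv_flowMap_zero (hU : IsOpen U)
    (hφ : IsLocalFlow 𝓘(ℝ, E) (fun x => -δ x) φ ε U) {p : M} {y : E}
    (hy : (y, (0 : ℝ)) ∈ (flowDomain ε U p : Set (E × ℝ))) (u : E) :
    flowMap φ p (y, 0) = (extChartAt 𝓘(ℝ, E) p).symm y ∧
    (mfderiv 𝓘(ℝ, E × ℝ) 𝓘(ℝ, E) (flowMap φ p) (y, 0) ((u, 0) : E × ℝ) : E) =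
      mfderiv 𝓘(ℝ, E) 𝓘(ℝ, E) (extChartAt 𝓘(ℝ, E) p).symm y u := by
  have h0 : ∀ y', (y', (0 : ℝ)) ∈ (flowDomain ε U p : Set (E × ℝ)) →
      flowMap φ p (y', 0) = (extChartAt 𝓘(ℝ, E) p).symm y' := fun y' hy' => (hφ.2 _ hy'.1.2).1
  refine ⟨h0 y hy, ?_⟩
  have h2 : HasFDerivAt (fun y : E => (y, (0 : ℝ))) (ContinuousLinearMap.inl ℝ E ℝ) y :=
    (hasFDerivAt_id y).prodMk (hasFDerivAt_const (0 : ℝ) y)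
  have h3 := (mdifferentiableAt_flowMap hU hφ hy).hasMFDerivAt.comp y
    (f := fun y : E => (y, (0 : ℝ))) h2.hasMFDerivAt
  have hev : (fun y => flowMap φ p (y, (0 : ℝ))) =ᶠ[𝓝 y] (extChartAt 𝓘(ℝ, E) p).symm := by
    have hc : ContinuousAt (fun y : E => (y, (0 : ℝ))) y := by fun_prop
    filter_upwards [hc.preimage_mem_nhds ((isOpen_flowDomain hU p).mem_nhds hy)] with y' hy'
    exact h0 y' hy'
  have h4 : HasMFDerivAt 𝓘(ℝ, E) 𝓘(ℝ, E) (fun y => flowMap φ p (y, (0 : ℝ))) y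
      (mfderiv 𝓘(ℝ, E) 𝓘(ℝ, E) (extChartAt 𝓘(ℝ, E) p).symm y) :=
    (mdifferentiableAt_chart_symm hy.1.1).hasMFDerivAt.congr_of_eventuallyEq hev
  have h5 := hasMFDerivAt_unique h3 h4
  exact congrArg (fun L => L u) h5

end FlowMap

section ConformalMetric

variable {E : Type*} [NormedAddCommGroup E] [NormedSpace ℝ E]
  {M : Type*} [TopologicalSpace M] [ChartedSpace E M] [IsManifold 𝓘(ℝ, E) ∞ M]
  {g₀ : ContMDiffRiemannianMetric 𝓘(ℝ, E) ∞ E (fun x : M => TangentSpace 𝓘(ℝ, E) x)}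
  {β : M → ℝ} {δ : (x : M) → TangentSpace 𝓘(ℝ, E) x}

lemma chartComponents_conformalMetric (p : M) (z u v : E) :
    chartComponents 𝓘(ℝ, E) (conformalMetric g₀ β δ) p z u v =
      chartComponents 𝓘(ℝ, E) (fun x u v => g₀.inner x u v) p z u v /
        conformalFactor g₀ β δ ((extChartAt 𝓘(ℝ, E) p).symm z) :=
  rfl

lemma contDiffAt_conformalFactor_chart (hβ : ContMDiff 𝓘(ℝ, E) 𝓘(ℝ, ℝ) ∞ β)
    (hδ : ∀ x, SmoothFieldAt 𝓘(ℝ, E) δ x) {p : M} {y : E}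
    (hy : y ∈ (extChartAt 𝓘(ℝ, E) p).target) :
    ContDiffAt ℝ ∞ (fun z => conformalFactor g₀ β δ ((extChartAt 𝓘(ℝ, E) p).symm z)) y :=
  ((contMDiffAt_conformalFactor (g₀ := g₀) hβ hδ ((extChartAt 𝓘(ℝ, E) p).symm y)).comp y
    (contMDiffAt_chart_symm hy)).contDiffAt

lemma inner_add_left (x : M) (u u' v : TangentSpace 𝓘(ℝ, E) x) :
    g₀.inner x (u + u') v = g₀.inner x u v + g₀.inner x u' v :=
  congrArg (fun L => L v) (map_add (g₀.inner x) u u')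

lemma inner_smul_left (x : M) (c : ℝ) (u v : TangentSpace 𝓘(ℝ, E) x) :
    g₀.inner x (c • u) v = c * g₀.inner x u v :=
  congrArg (fun L => L v) (map_smul (g₀.inner x) c u)

lemma inner_add_right (x : M) (u v v' : TangentSpace 𝓘(ℝ, E) x) :
    g₀.inner x u (v + v') = g₀.inner x u v + g₀.inner x u v' :=
  map_add (g₀.inner x u) v v'

lemma inner_smul_right (x : M) (c : ℝ) (u v : TangentSpace 𝓘(ℝ, E) x) :
    g₀.inner x u (c • v) = c * g₀.inner x u v :=
  map_smul (g₀.inner x u) c v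

lemma symmFormAt_conformalMetric [FiniteDimensional ℝ E]
    (hβ : ContMDiff 𝓘(ℝ, E) 𝓘(ℝ, ℝ) ∞ β) (hβ_pos : ∀ x, 0 < β x)
    (hδ : ∀ x, SmoothFieldAt 𝓘(ℝ, E) δ x) {p : M} {y : E}
    (hy : y ∈ (extChartAt 𝓘(ℝ, E) p).target) :
    SymmFormAt (chartComponents 𝓘(ℝ, E) (conformalMetric g₀ β δ) p) y := by
  refine symmFormAt_chartComponents _ (fun x u v => ?_) (fun x u u' v => ?_)
    (fun x c u v => ?_) p y (fun u v => ?_)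
  · rw [conformalMetric, conformalMetric, g₀.symm]
  · rw [conformalMetric, inner_add_left, add_div]; rfl
  · rw [conformalMetric, inner_smul_left, mul_div_assoc]; rfl
  · have h1 := (contDiffAt_chartComponents_inner g₀ hy u v).differentiableAt (by simp)
    have h2 := (contDiffAt_conformalFactor_chart (g₀ := g₀) hβ hδ hy).differentiableAt (by simp)
    simp only [chartComponents_conformalMetric, div_eq_mul_inv]
    exact h1.fun_mul (h2.inv (conformalFactor_pos hβ_pos _).ne')

lemma fderiv_div_apply {a b : E → ℝ} {x : E} (ha : DifferentiableAt ℝ a x)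
    (hb : DifferentiableAt ℝ b x) (hx : b x ≠ 0) (d : E) :
    fderiv ℝ (fun z => a z / b z) x d =
      (fderiv ℝ a x d * b x - a x * fderiv ℝ b x d) / b x ^ 2 := by
  have h3 := ha.hasFDerivAt.fun_mul ((hasDerivAt_inv hx).comp_hasFDerivAt x hb.hasFDerivAt)
  simp only [div_eq_mul_inv]
  erw [h3.fderiv]
  simp only [_root_.smul_apply, _root_.add_apply, smul_eq_mul, Function.comp_apply]
  field_simp
  ring

lemma chartComponents_self (g : (x : M) → TangentSpace 𝓘(ℝ, E) x → TangentSpace 𝓘(ℝ, E) x → ℝ)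
    (x₀ : M) (u v : E) :
    chartComponents 𝓘(ℝ, E) g x₀ (extChartAt 𝓘(ℝ, E) x₀ x₀) u v =
      g x₀ (chartFrame x₀ u x₀) (chartFrame x₀ v x₀) := by
  have key : ∀ (x' : M) (_ : x' = x₀) (a b : E), g x' a b = g x₀ a b := by
    rintro x' rfl a b; rfl
  exact key _ ((extChartAt 𝓘(ℝ, E) x₀).left_inv (mem_extChartAt_source x₀)) _ _

/-- The conformal metric is homothetic along `δ`, in the chart at the base point. -/
lemma lie_conformalMetric (hβ : ContMDiff 𝓘(ℝ, E) 𝓘(ℝ, ℝ) ∞ β) (hβ_pos : ∀ x, 0 < β x)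
    (hδ : ∀ x, SmoothFieldAt 𝓘(ℝ, E) δ x) {σ : ℝ}
    (hL : ∀ (x : M) (Y Z : (x : M) → TangentSpace 𝓘(ℝ, E) x),
      SmoothFieldAt 𝓘(ℝ, E) Y x → SmoothFieldAt 𝓘(ℝ, E) Z x →
      lieDerivative 𝓘(ℝ, E) δ (fun y u v => g₀.inner y u v) Y Z x
        = (mvfderiv 𝓘(ℝ, E) (conformalFactor g₀ β δ) x (δ x)
            / conformalFactor g₀ β δ x - σ) * g₀.inner x (Y x) (Z x)) (x₀ : M) (u v : E) :
    fderiv ℝ (fun z => chartComponents 𝓘(ℝ, E) (conformalMetric g₀ β δ) x₀ z u v)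
        (extChartAt 𝓘(ℝ, E) x₀ x₀) (fieldComponents δ x₀ (extChartAt 𝓘(ℝ, E) x₀ x₀))
      + chartComponents 𝓘(ℝ, E) (conformalMetric g₀ β δ) x₀ (extChartAt 𝓘(ℝ, E) x₀ x₀)
        (fderiv ℝ (fieldComponents δ x₀) (extChartAt 𝓘(ℝ, E) x₀ x₀) u) v
      + chartComponents 𝓘(ℝ, E) (conformalMetric g₀ β δ) x₀ (extChartAt 𝓘(ℝ, E) x₀ x₀)
        u (fderiv ℝ (fieldComponents δ x₀) (extChartAt 𝓘(ℝ, E) x₀ x₀) v) =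
      -σ * chartComponents 𝓘(ℝ, E) (conformalMetric g₀ β δ) x₀ (extChartAt 𝓘(ℝ, E) x₀ x₀) u v := by
  have hmem := mem_extChartAt_source (I := 𝓘(ℝ, E)) x₀
  have hy := mem_extChartAt_target (I := 𝓘(ℝ, E)) x₀
  have key := hL x₀ (chartFrame x₀ u) (chartFrame x₀ v) (smoothFieldAt_chartFrame hmem u)
    (smoothFieldAt_chartFrame hmem v)
  rw [lieDerivative_chartFrame, mvfderiv_eq_fderiv_chart (contMDiffAt_conformalFactor hβ hδ x₀),
    ← mfderiv_symm_fieldComponents hmem,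
    ← chartComponents_self (fun y u v => g₀.inner y u v) x₀ u v] at key
  have h1 := (contDiffAt_chartComponents_inner g₀ hy u v).differentiableAt (by simp)
  have h2 := (contDiffAt_conformalFactor_chart (g₀ := g₀) hβ hδ hy).differentiableAt (by simp)
  have hpos := (conformalFactor_pos (g₀ := g₀) (δ := δ) hβ_pos
    ((extChartAt 𝓘(ℝ, E) x₀).symm (extChartAt 𝓘(ℝ, E) x₀ x₀)))
  have hx : conformalFactor g₀ β δ ((extChartAt 𝓘(ℝ, E) x₀).symm (extChartAt 𝓘(ℝ, E) x₀ x₀)) =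
    conformalFactor g₀ β δ x₀ := by rw [(extChartAt 𝓘(ℝ, E) x₀).left_inv hmem]
  simp only [chartComponents_conformalMetric]
  rw [fderiv_div_apply h1 h2 hpos.ne']
  rw [hx] at hpos
  simp only [hx]
  set G := chartComponents 𝓘(ℝ, E) (fun y u v => g₀.inner y u v) x₀ (extChartAt 𝓘(ℝ, E) x₀ x₀)
  set A := fderiv ℝ (fun z => conformalFactor g₀ β δ ((extChartAt 𝓘(ℝ, E) x₀).symm z))
    (extChartAt 𝓘(ℝ, E) x₀ x₀)
  set F := conformalFactor g₀ β δ x₀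
  have hF : F ≠ 0 := hpos.ne'
  field_simp at key ⊢
  linear_combination key

variable {φ : ℝ → M → M} {ε σ : ℝ} {U : Set M}

/-- The flow of `-δ` at time `t` scales the conformal metric by `e^{σ t}`. -/
lemma conformalMetric_flowMap [FiniteDimensional ℝ E]
    (hβ : ContMDiff 𝓘(ℝ, E) 𝓘(ℝ, ℝ) ∞ β) (hβ_pos : ∀ x, 0 < β x)
    (hδ : ∀ x, SmoothFieldAt 𝓘(ℝ, E) δ x)
    (hL : ∀ (x : M) (Y Z : (x : M) → TangentSpace 𝓘(ℝ, E) x),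
      SmoothFieldAt 𝓘(ℝ, E) Y x → SmoothFieldAt 𝓘(ℝ, E) Z x →
      lieDerivative 𝓘(ℝ, E) δ (fun y u v => g₀.inner y u v) Y Z x
        = (mvfderiv 𝓘(ℝ, E) (conformalFactor g₀ β δ) x (δ x)
            / conformalFactor g₀ β δ x - σ) * g₀.inner x (Y x) (Z x))
    (hU : IsOpen U) (hφ : IsLocalFlow 𝓘(ℝ, E) (fun x => -δ x) φ ε U) {p : M} {z : E × ℝ}
    (hz : z ∈ (flowDomain ε U p : Set (E × ℝ))) (u v : E) :
    conformalMetric g₀ β δ (flowMap φ p z)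
      (mfderiv 𝓘(ℝ, E × ℝ) 𝓘(ℝ, E) (flowMap φ p) z ((u, 0) : E × ℝ))
      (mfderiv 𝓘(ℝ, E × ℝ) 𝓘(ℝ, E) (flowMap φ p) z ((v, 0) : E × ℝ)) =
    Real.exp (σ * z.2) * chartComponents 𝓘(ℝ, E) (conformalMetric g₀ β δ) p z.1 u v := by
  obtain ⟨y, t⟩ := z
  set m : ℝ → ℝ := fun s => conformalMetric g₀ β δ (flowMap φ p (y, s))
      (mfderiv 𝓘(ℝ, E × ℝ) 𝓘(ℝ, E) (flowMap φ p) (y, s) ((u, 0) : E × ℝ))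
      (mfderiv 𝓘(ℝ, E × ℝ) 𝓘(ℝ, E) (flowMap φ p) (y, s) ((v, 0) : E × ℝ)) with hm
  have hdom : ∀ s ∈ Ioo (-ε) ε, (y, s) ∈ (flowDomain ε U p : Set (E × ℝ)) :=
    fun s hs => ⟨hz.1, hs⟩
  have h0 : (0 : ℝ) ∈ Ioo (-ε) ε := by
    have h1 : -ε < t := hz.2.1
    have h2 : t < ε := hz.2.2
    constructor <;> linarith
  have hderiv : ∀ s ∈ Ioo (-ε) ε, HasDerivAt m (σ * m s) s := by
    intro s hs
    set x₀ := flowMap φ p (y, s) with hx₀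
    set Φ : E × ℝ → E := fun z => extChartAt 𝓘(ℝ, E) x₀ (flowMap φ p z) with hΦ
    have hsm := contMDiffAt_flowMap hU hφ (hdom s hs)
    have hnear : ∀ᶠ z in 𝓝 (y, s), z ∈ (flowDomain ε U p : Set (E × ℝ)) ∧
        flowMap φ p z ∈ (extChartAt 𝓘(ℝ, E) x₀).source :=
      Filter.Eventually.and ((isOpen_flowDomain hU p).mem_nhds (hdom s hs))
        (hsm.continuousAt.preimage_mem_nhds (extChartAt_source_mem_nhds (I := 𝓘(ℝ, E)) x₀))
    have hpull : ∀ z, z ∈ (flowDomain ε U p : Set (E × ℝ)) ∧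
        flowMap φ p z ∈ (extChartAt 𝓘(ℝ, E) x₀).source → ∀ a b : E × ℝ,
        chartComponents 𝓘(ℝ, E) (conformalMetric g₀ β δ) x₀ (Φ z) (fderiv ℝ Φ z a)
          (fderiv ℝ Φ z b) = conformalMetric g₀ β δ (flowMap φ p z)
          (mfderiv 𝓘(ℝ, E × ℝ) 𝓘(ℝ, E) (flowMap φ p) z a)
          (mfderiv 𝓘(ℝ, E × ℝ) 𝓘(ℝ, E) (flowMap φ p) z b) := fun z hz a b =>
      chartComponents_fderiv_chart_comp _ (mdifferentiableAt_flowMap hU hφ hz.1) hz.2 a b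
    have hcont : ContinuousAt (fun s : ℝ => (y, s)) s := by fun_prop
    have key := hasDerivAt_pullback_flow (σ := σ) (d := fieldComponents δ x₀)
      (g := chartComponents 𝓘(ℝ, E) (conformalMetric g₀ β δ) x₀) (Φ := Φ) (y := y) (t := s)
      (symmFormAt_conformalMetric hβ hβ_pos hδ (mem_extChartAt_target x₀))
      ((contDiffAt_chart_comp le_rfl hsm (mem_extChartAt_source x₀)).of_le (WithTop.coe_le_coe.2 le_top))
      ((contDiffAt_fieldComponents hδ (mem_extChartAt_target x₀)).differentiableAt (by simp))
      (hnear.mono fun z hz => by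
        rw [hΦ, fderiv_chart_comp (mdifferentiableAt_flowMap hU hφ hz.1) hz.2,
          mfderiv_flowMap_time hU hφ hz.1, mfderiv_symm_fieldComponents hz.2]
        exact map_neg _ _)
      (lie_conformalMetric hβ hβ_pos hδ hL x₀) u v
    rw [hpull (y, s) hnear.self_of_nhds] at key
    refine key.congr_of_eventuallyEq ?_
    filter_upwards [hcont.eventually hnear] with r hr
    exact (hpull (y, r) hr _ _).symm
  have h1 := eq_exp_mul_of_hasDerivAt hderiv hz.2
  refine h1.trans (congrArg _ ?_)
  have e := mfderiv_flowMap_zero hU hφ (hdom 0 h0)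
  have key : ∀ (x' x : M) (_ : x' = x) (a a' b b' : E), a = a' → b = b' →
      conformalMetric g₀ β δ x' a b = conformalMetric g₀ β δ x a' b' := by
    rintro x' x rfl a a' b b' rfl rfl; rfl
  exact key _ _ (e u).1 _ _ _ _ (e u).2 (e v).2

end ConformalMetric

section StationaryMetric

variable {E : Type*} [NormedAddCommGroup E] [NormedSpace ℝ E]
  {M : Type*} [TopologicalSpace M] [ChartedSpace E M] [IsManifold 𝓘(ℝ, E) ∞ M]
  {g₀ : ContMDiffRiemannianMetric 𝓘(ℝ, E) ∞ E (fun x : M => TangentSpace 𝓘(ℝ, E) x)}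
  {β : M → ℝ} {δ : (x : M) → TangentSpace 𝓘(ℝ, E) x}
  {X : Type*} [NormedAddCommGroup X] [NormedSpace ℝ X]

/-- The stationary metric in terms of the components of tangent vectors. -/
noncomputable def stationaryForm
    (g₀ : ContMDiffRiemannianMetric 𝓘(ℝ, E) ∞ E (fun x : M => TangentSpace 𝓘(ℝ, E) x))
    (β : M → ℝ) (δ : (x : M) → TangentSpace 𝓘(ℝ, E) x) (x : M) (v : TangentSpace 𝓘(ℝ, E) x) (τ : ℝ)
    (w : TangentSpace 𝓘(ℝ, E) x) (κ : ℝ) : ℝ :=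
  g₀.inner x v w + g₀.inner x (δ x) v * κ + g₀.inner x (δ x) w * τ - β x * τ * κ

lemma stationaryMetric_eq (z : M × ℝ) (ξ η : E × ℝ) :
    stationaryMetric g₀ β δ z ξ η = stationaryForm g₀ β δ z.1 ξ.1 ξ.2 η.1 η.2 := by
  simp only [stationaryMetric, mvfderiv, mfderiv_fst, mfderiv_snd]
  rfl

lemma stationaryForm_symm (x : M) (v : TangentSpace 𝓘(ℝ, E) x) (τ : ℝ)
    (w : TangentSpace 𝓘(ℝ, E) x) (κ : ℝ) :
    stationaryForm g₀ β δ x v τ w κ = stationaryForm g₀ β δ x w κ v τ := by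
  rw [stationaryForm, stationaryForm, g₀.symm x v w]
  ring

lemma stationaryForm_add (x : M) (v v' : TangentSpace 𝓘(ℝ, E) x) (τ τ' : ℝ)
    (w : TangentSpace 𝓘(ℝ, E) x) (κ : ℝ) :
    stationaryForm g₀ β δ x (v + v') (τ + τ') w κ =
      stationaryForm g₀ β δ x v τ w κ + stationaryForm g₀ β δ x v' τ' w κ := by
  rw [stationaryForm, stationaryForm, stationaryForm, inner_add_left, inner_add_right]
  ring

lemma stationaryForm_smul (x : M) (c : ℝ) (v : TangentSpace 𝓘(ℝ, E) x) (τ : ℝ)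
    (w : TangentSpace 𝓘(ℝ, E) x) (κ : ℝ) :
    stationaryForm g₀ β δ x (c • v) (c * τ) w κ = c * stationaryForm g₀ β δ x v τ w κ := by
  rw [stationaryForm, stationaryForm, inner_smul_left, inner_smul_right]
  ring

/-- The stationary metric in the frame dragged along by `-δ`. -/
lemma stationaryForm_sub_smul (x : M) (v w : TangentSpace 𝓘(ℝ, E) x) (a b : ℝ) :
    stationaryForm g₀ β δ x (v + a • -δ x) a (w + b • -δ x) b =
      g₀.inner x v w - conformalFactor g₀ β δ x * (a * b) := by
  have hneg : ∀ (c : ℝ) (u : TangentSpace 𝓘(ℝ, E) x), c • -u = (-c) • u := fun c u => by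
    rw [smul_neg, neg_smul]
  simp only [stationaryForm, conformalFactor, hneg, inner_add_left, inner_add_right,
    inner_smul_left, inner_smul_right, g₀.symm x v (δ x)]
  ring

lemma mfderiv_prod_components {f : X → M × ℝ} {x : X}
    (hf : MDifferentiableAt 𝓘(ℝ, X) (𝓘(ℝ, E).prod 𝓘(ℝ, ℝ)) f x) (u : X) :
    (mfderiv 𝓘(ℝ, X) (𝓘(ℝ, E).prod 𝓘(ℝ, ℝ)) f x u : E × ℝ) =
      ((mfderiv 𝓘(ℝ, X) 𝓘(ℝ, E) (fun z => (f z).1) x u : E),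
        fderiv ℝ (fun z => (f z).2) x u) := by
  have h := hf.fst.mfderiv_prod hf.snd
  have h2 := congrArg (fun L => L u) h
  rw [← mfderiv_eq_fderiv]
  exact h2

lemma stationaryMetric_mfderiv {f : X → M × ℝ} {x : X}
    (hf : MDifferentiableAt 𝓘(ℝ, X) (𝓘(ℝ, E).prod 𝓘(ℝ, ℝ)) f x) (u v : X) :
    stationaryMetric g₀ β δ (f x) (mfderiv 𝓘(ℝ, X) (𝓘(ℝ, E).prod 𝓘(ℝ, ℝ)) f x u)
      (mfderiv 𝓘(ℝ, X) (𝓘(ℝ, E).prod 𝓘(ℝ, ℝ)) f x v) =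
    stationaryForm g₀ β δ (f x).1 (mfderiv 𝓘(ℝ, X) 𝓘(ℝ, E) (fun z => (f z).1) x u)
      (fderiv ℝ (fun z => (f z).2) x u) (mfderiv 𝓘(ℝ, X) 𝓘(ℝ, E) (fun z => (f z).1) x v)
      (fderiv ℝ (fun z => (f z).2) x v) := by
  have key : ∀ ξ ξ' η η' : E × ℝ, ξ = ξ' → η = η' → stationaryMetric g₀ β δ (f x) ξ η =
      stationaryForm g₀ β δ (f x).1 ξ'.1 ξ'.2 η'.1 η'.2 := by
    rintro ξ _ η _ rfl rfl; exact stationaryMetric_eq _ _ _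
  exact key _ _ _ _ (mfderiv_prod_components hf u) (mfderiv_prod_components hf v)

lemma contMDiffAt_mfderiv_section {f : X → M} {s : Set X} (hs : IsOpen s)
    (hf : ContMDiffOn 𝓘(ℝ, X) 𝓘(ℝ, E) ∞ f s) {y : X} (hy : y ∈ s) (u : X) :
    ContMDiffAt 𝓘(ℝ, X) 𝓘(ℝ, E).tangent ∞
      (fun z => (⟨f z, mfderiv 𝓘(ℝ, X) 𝓘(ℝ, E) f z u⟩ : TangentBundle 𝓘(ℝ, E) M)) y := by
  have h1 : ContMDiffAt 𝓘(ℝ, X) 𝓘(ℝ, X).tangent ∞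
      (fun z => (⟨z, u⟩ : TangentBundle 𝓘(ℝ, X) X)) y :=
    contMDiffAt_vectorSpace_iff_contDiffAt.2 contDiffAt_const
  have h2 := contMDiffAt_tangentMap hs hf (q := (⟨y, u⟩ : TangentBundle 𝓘(ℝ, X) X)) hy
  exact h2.comp y h1

lemma symmFormAt_stationaryMetric [FiniteDimensional ℝ E]
    (hβ : ContMDiff 𝓘(ℝ, E) 𝓘(ℝ, ℝ) ∞ β) (hδ : ∀ x, SmoothFieldAt 𝓘(ℝ, E) δ x) {q : M × ℝ}
    {y : E × ℝ} (hy : y ∈ (extChartAt (𝓘(ℝ, E).prod 𝓘(ℝ, ℝ)) q).target) :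
    SymmFormAt (chartComponents (𝓘(ℝ, E).prod 𝓘(ℝ, ℝ)) (stationaryMetric g₀ β δ) q) y := by
  refine symmFormAt_chartComponents _ (fun x u v => ?_) (fun x u u' v => ?_)
    (fun x c u v => ?_) q y (fun u v => ?_)
  · exact (stationaryMetric_eq x u v).trans
      ((stationaryForm_symm _ _ _ _ _).trans (stationaryMetric_eq x v u).symm)
  · exact (stationaryMetric_eq x ((u : E × ℝ) + (u' : E × ℝ)) v).trans
      ((stationaryForm_add _ _ _ _ _ _ _).trans
        (congrArg₂ (· + ·) (stationaryMetric_eq x u v).symm (stationaryMetric_eq x u' v).symm))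
  · exact (stationaryMetric_eq x (c • (u : E × ℝ)) v).trans
      ((stationaryForm_smul _ _ _ _ _ _).trans
        (congrArg (c * ·) (stationaryMetric_eq x u v).symm))
  · set ψ := (extChartAt (𝓘(ℝ, E).prod 𝓘(ℝ, ℝ)) q).symm with hψ
    have hs := isOpen_extChartAt_target (I := 𝓘(ℝ, E).prod 𝓘(ℝ, ℝ)) q
    have hsm : ContMDiffOn 𝓘(ℝ, E × ℝ) (𝓘(ℝ, E).prod 𝓘(ℝ, ℝ)) ∞ ψ
        (extChartAt (𝓘(ℝ, E).prod 𝓘(ℝ, ℝ)) q).target := contMDiffOn_extChartAt_symm q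
    have h1 : ContMDiffOn 𝓘(ℝ, E × ℝ) 𝓘(ℝ, E) ∞ (fun z => (ψ z).1)
        (extChartAt (𝓘(ℝ, E).prod 𝓘(ℝ, ℝ)) q).target :=
      fun z hz => (hsm z hz).fst
    have h2 : ContDiffAt ℝ ∞ (fun z => (ψ z).2) y :=
      ((hsm y hy).contMDiffAt (hs.mem_nhds hy)).snd.contDiffAt
    have h1y := (h1 y hy).contMDiffAt (hs.mem_nhds hy)
    have a1 := contMDiffAt_mfderiv_section hs h1 hy u
    have a2 := contMDiffAt_mfderiv_section hs h1 hy v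
    have hδ' : ContMDiffAt 𝓘(ℝ, E × ℝ) 𝓘(ℝ, E).tangent ∞
      (fun z => (⟨(ψ z).1, δ (ψ z).1⟩ : TangentBundle 𝓘(ℝ, E) M)) y := (hδ _).comp y h1y
    have c1 := (contMDiffAt_inner g₀ a1 a2).contDiffAt.differentiableAt (by simp)
    have c2 := (contMDiffAt_inner g₀ hδ' a1).contDiffAt.differentiableAt (by simp)
    have c3 := (contMDiffAt_inner g₀ hδ' a2).contDiffAt.differentiableAt (by simp)
    have c4 := ((hβ _).comp y h1y).contDiffAt.differentiableAt (by simp)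
    have c5 : ∀ w, DifferentiableAt ℝ (fun z => fderiv ℝ (fun z => (ψ z).2) z w) y := fun w => by
      have := (h2.fderiv_right (m := 1) (by decide)).differentiableAt (by simp)
      exact this.clm_apply (differentiableAt_const w)
    have c6 := (((c1.fun_add (c2.fun_mul (c5 v))).fun_add (c3.fun_mul (c5 u))).fun_sub
      ((c4.fun_mul (c5 u)).fun_mul (c5 v)))
    refine c6.congr_of_eventuallyEq ?_
    filter_upwards [hs.mem_nhds hy] with z hz
    exact stationaryMetric_mfderiv (mdifferentiableAt_chart_symm hz) u v

end StationaryMetric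

section GraphMap

variable {E : Type*} [NormedAddCommGroup E] [NormedSpace ℝ E]
  {M : Type*} [TopologicalSpace M] [ChartedSpace E M] [IsManifold 𝓘(ℝ, E) ∞ M]

/-- Smooth stationary data such that `δ` is homothetic for the metric `g₀ / (β + |δ|₀²)`. -/
structure IsHomotheticData
    (g₀ : ContMDiffRiemannianMetric 𝓘(ℝ, E) ∞ E (fun x : M => TangentSpace 𝓘(ℝ, E) x))
    (β : M → ℝ) (δ : (x : M) → TangentSpace 𝓘(ℝ, E) x) (σ : ℝ) : Prop where
  smooth_lapse : ContMDiff 𝓘(ℝ, E) 𝓘(ℝ, ℝ) ∞ β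
  lapse_pos : ∀ x, 0 < β x
  smooth_shift : ∀ x, SmoothFieldAt 𝓘(ℝ, E) δ x
  lie : ∀ (x : M) (Y Z : (x : M) → TangentSpace 𝓘(ℝ, E) x),
    SmoothFieldAt 𝓘(ℝ, E) Y x → SmoothFieldAt 𝓘(ℝ, E) Z x →
    lieDerivative 𝓘(ℝ, E) δ (fun y u v => g₀.inner y u v) Y Z x
      = (mvfderiv 𝓘(ℝ, E) (conformalFactor g₀ β δ) x (δ x)
          / conformalFactor g₀ β δ x - σ) * g₀.inner x (Y x) (Z x)

variable {g₀ : ContMDiffRiemannianMetric 𝓘(ℝ, E) ∞ E (fun x : M => TangentSpace 𝓘(ℝ, E) x)}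
  {β : M → ℝ} {δ : (x : M) → TangentSpace 𝓘(ℝ, E) x}
  {φ : ℝ → M → M} {ε σ : ℝ} {U : Set M}

/-- The coordinates of spacetime dragged along by the flow `φ`, with time shifted by `k`. -/
noncomputable def graphMap (φ : ℝ → M → M) (p : M) (k : ℝ) (z : E × ℝ) : M × ℝ :=
  (flowMap φ p z, z.2 + k)

/-- The conformal factor of the stationary metric in the coordinates `graphMap`. -/
noncomputable def graphFactor
    (g₀ : ContMDiffRiemannianMetric 𝓘(ℝ, E) ∞ E (fun x : M => TangentSpace 𝓘(ℝ, E) x))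
    (β : M → ℝ) (δ : (x : M) → TangentSpace 𝓘(ℝ, E) x) (σ : ℝ) (φ : ℝ → M → M) (p : M)
    (z : E × ℝ) : ℝ :=
  conformalFactor g₀ β δ (flowMap φ p z) * Real.exp (σ * z.2)

lemma contMDiffAt_graphMap (hU : IsOpen U)
    (hφ : IsLocalFlow 𝓘(ℝ, E) (fun x => -δ x) φ ε U) {p : M} {z : E × ℝ}
    (hz : z ∈ (flowDomain ε U p : Set (E × ℝ))) (k : ℝ) :
    ContMDiffAt 𝓘(ℝ, E × ℝ) (𝓘(ℝ, E).prod 𝓘(ℝ, ℝ)) ∞ (graphMap φ p k) z := by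
  have h2 : ContDiff ℝ ∞ (fun z : E × ℝ => z.2 + k) := by fun_prop
  exact (contMDiffAt_flowMap hU hφ hz).prodMk (h2.contMDiff z)

lemma stationaryMetric_graphMap [FiniteDimensional ℝ E] (hd : IsHomotheticData g₀ β δ σ)
    (hU : IsOpen U) (hφ : IsLocalFlow 𝓘(ℝ, E) (fun x => -δ x) φ ε U) {p : M} {z : E × ℝ}
    (hz : z ∈ (flowDomain ε U p : Set (E × ℝ))) (k : ℝ) (ξ η : E × ℝ) :
    stationaryMetric g₀ β δ (graphMap φ p k z)
      (mfderiv 𝓘(ℝ, E × ℝ) (𝓘(ℝ, E).prod 𝓘(ℝ, ℝ)) (graphMap φ p k) z ξ)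
      (mfderiv 𝓘(ℝ, E × ℝ) (𝓘(ℝ, E).prod 𝓘(ℝ, ℝ)) (graphMap φ p k) z η) =
    graphFactor g₀ β δ σ φ p z *
      (chartComponents 𝓘(ℝ, E) (conformalMetric g₀ β δ) p z.1 ξ.1 η.1
        - Real.exp (-σ * z.2) * ξ.2 * η.2) := by
  rw [stationaryMetric_mfderiv ((contMDiffAt_graphMap hU hφ hz k).mdifferentiableAt (by simp))]
  have hD : ∀ ζ : E × ℝ, mfderiv 𝓘(ℝ, E × ℝ) 𝓘(ℝ, E) (flowMap φ p) z ζ =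
      mfderiv 𝓘(ℝ, E × ℝ) 𝓘(ℝ, E) (flowMap φ p) z ((ζ.1, 0) : E × ℝ) +
        ζ.2 • -δ (flowMap φ p z) := by
    rintro ⟨u, a⟩
    rw [← mfderiv_flowMap_time hU hφ hz]
    have h1 : ((u, a) : E × ℝ) = (u, 0) + a • (0, 1) := by ext <;> simp
    have h2 := map_add (mfderiv 𝓘(ℝ, E × ℝ) 𝓘(ℝ, E) (flowMap φ p) z) ((u, 0) : E × ℝ)
      (a • (0, 1) : E × ℝ)
    have h3 := map_smul (mfderiv 𝓘(ℝ, E × ℝ) 𝓘(ℝ, E) (flowMap φ p) z) a ((0, 1) : E × ℝ)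
    exact (congrArg _ h1).trans (h2.trans (congrArg _ h3))
  have hτ : ∀ ζ : E × ℝ, fderiv ℝ (fun z : E × ℝ => (graphMap φ p k z).2) z ζ = ζ.2 := by
    intro ζ
    have : HasFDerivAt (fun z : E × ℝ => z.2 + k) (ContinuousLinearMap.snd ℝ E ℝ) z :=
      hasFDerivAt_snd.add_const k
    exact congrArg (fun L => L ζ) this.fderiv
  have key : ∀ (v v' w w' : TangentSpace 𝓘(ℝ, E) (flowMap φ p z)) (τ τ' κ κ' : ℝ), v = v' → w = w' →
      τ = τ' → κ = κ' → stationaryForm g₀ β δ (flowMap φ p z) v τ w κ =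
      stationaryForm g₀ β δ (flowMap φ p z) v' τ' w' κ' := by
    rintro v _ w _ τ _ κ _ rfl rfl rfl rfl; rfl
  refine (key _ _ _ _ _ _ _ _ (hD ξ) (hD η) (hτ ξ) (hτ η)).trans ?_
  rw [stationaryForm_sub_smul, graphFactor]
  have h4 := conformalMetric_flowMap hd.smooth_lapse hd.lapse_pos hd.smooth_shift hd.lie hU hφ hz
    ξ.1 η.1
  have hpos := conformalFactor_pos (g₀ := g₀) (δ := δ) hd.lapse_pos (flowMap φ p z)
  rw [conformalMetric, div_eq_iff hpos.ne'] at h4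
  rw [h4]
  have h5 : Real.exp (σ * z.2) * Real.exp (-σ * z.2) = 1 := by
    rw [← Real.exp_add]; simp
  linear_combination (conformalFactor g₀ β δ (flowMap φ p z) * (ξ.2 * η.2)) * h5

lemma graphFactor_pos (hd : IsHomotheticData g₀ β δ σ) (p : M) (z : E × ℝ) :
    0 < graphFactor g₀ β δ σ φ p z :=
  mul_pos (conformalFactor_pos hd.lapse_pos _) (Real.exp_pos _)

lemma contDiffAt_graphFactor (hd : IsHomotheticData g₀ β δ σ) (hU : IsOpen U)
    (hφ : IsLocalFlow 𝓘(ℝ, E) (fun x => -δ x) φ ε U) {p : M} {z : E × ℝ}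
    (hz : z ∈ (flowDomain ε U p : Set (E × ℝ))) :
    ContDiffAt ℝ ∞ (graphFactor g₀ β δ σ φ p) z := by
  have h1 : ContDiffAt ℝ ∞ (fun z => conformalFactor g₀ β δ (flowMap φ p z)) z :=
    ((contMDiffAt_conformalFactor (g₀ := g₀) hd.smooth_lapse hd.smooth_shift _).comp z
      (contMDiffAt_flowMap hU hφ hz)).contDiffAt
  have h2 : ContDiffAt ℝ ∞ (fun z : E × ℝ => Real.exp (σ * z.2)) z := by fun_prop
  exact h1.mul h2

lemma chartComponents_conformalMetric_self_pos (hd : IsHomotheticData g₀ β δ σ) {p : M} {y : E}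
    (hy : y ∈ (extChartAt 𝓘(ℝ, E) p).target) {u : E} (hu : u ≠ 0) :
    0 < chartComponents 𝓘(ℝ, E) (conformalMetric g₀ β δ) p y u u := by
  refine div_pos (g₀.pos _ _ fun h => hu ?_) (conformalFactor_pos hd.lapse_pos _)
  rw [← mfderiv_chart_mfderiv_symm hy u, h]
  exact map_zero _

/-- `graphMap` read in a chart of spacetime. -/
noncomputable def graphMapChart (φ : ℝ → M → M) (p : M) (k : ℝ) (q : M × ℝ) (z : E × ℝ) : E × ℝ :=
  extChartAt (𝓘(ℝ, E).prod 𝓘(ℝ, ℝ)) q (graphMap φ p k z)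

lemma stationaryMetric_graphMapChart [FiniteDimensional ℝ E] (hd : IsHomotheticData g₀ β δ σ)
    (hU : IsOpen U) (hφ : IsLocalFlow 𝓘(ℝ, E) (fun x => -δ x) φ ε U) {p : M} {z : E × ℝ}
    (hz : z ∈ (flowDomain ε U p : Set (E × ℝ))) {k : ℝ} {q : M × ℝ}
    (hq : graphMap φ p k z ∈ (extChartAt (𝓘(ℝ, E).prod 𝓘(ℝ, ℝ)) q).source) (ξ η : E × ℝ) :
    chartComponents (𝓘(ℝ, E).prod 𝓘(ℝ, ℝ)) (stationaryMetric g₀ β δ) q (graphMapChart φ p k q z)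
      (fderiv ℝ (graphMapChart φ p k q) z ξ) (fderiv ℝ (graphMapChart φ p k q) z η) =
    graphFactor g₀ β δ σ φ p z *
      (chartComponents 𝓘(ℝ, E) (conformalMetric g₀ β δ) p z.1 ξ.1 η.1
        - Real.exp (-σ * z.2) * ξ.2 * η.2) :=
  (chartComponents_fderiv_chart_comp _
    ((contMDiffAt_graphMap hU hφ hz k).mdifferentiableAt (by simp)) hq ξ η).trans
    (stationaryMetric_graphMap hd hU hφ hz k ξ η)

lemma surjective_fderiv_graphMapChart [FiniteDimensional ℝ E] (hd : IsHomotheticData g₀ β δ σ)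
    (hU : IsOpen U) (hφ : IsLocalFlow 𝓘(ℝ, E) (fun x => -δ x) φ ε U) {p : M} {z : E × ℝ}
    (hz : z ∈ (flowDomain ε U p : Set (E × ℝ))) {k : ℝ} {q : M × ℝ}
    (hq : graphMap φ p k z ∈ (extChartAt (𝓘(ℝ, E).prod 𝓘(ℝ, ℝ)) q).source) :
    Function.Surjective (fderiv ℝ (graphMapChart φ p k q) z) := by
  have hinj : Function.Injective (fderiv ℝ (graphMapChart φ p k q) z).toLinearMap := by
    rw [← LinearMap.ker_eq_bot, LinearMap.ker_eq_bot']
    rintro ⟨u, a⟩ h0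
    have h0' : fderiv ℝ (graphMapChart φ p k q) z (u, a) = 0 := h0
    have hsymm := symmFormAt_stationaryMetric (g₀ := g₀) hd.smooth_lapse hd.smooth_shift
      (y := graphMapChart φ p k q z) ((extChartAt (𝓘(ℝ, E).prod 𝓘(ℝ, ℝ)) q).map_source hq)
    have hbar := symmFormAt_conformalMetric (g₀ := g₀) hd.smooth_lapse hd.lapse_pos
      hd.smooth_shift hz.1.1
    have hz0 : ∀ η : E × ℝ, chartComponents 𝓘(ℝ, E) (conformalMetric g₀ β δ) p z.1 u η.1
        - Real.exp (-σ * z.2) * a * η.2 = 0 := by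
      intro η
      have h1 := stationaryMetric_graphMapChart hd hU hφ hz hq (u, a) η
      rw [h0'] at h1
      have h2 := hsymm.smul_left 0 0 (fderiv ℝ (graphMapChart φ p k q) z η)
      rw [zero_smul, zero_mul] at h2
      rw [h2] at h1
      exact (mul_eq_zero.1 h1.symm).resolve_left (graphFactor_pos hd p z).ne'
    have ha : a = 0 := by
      have h1 := hz0 (0, 1)
      have h2 := hbar.smul_right 0 u 0
      rw [zero_smul, zero_mul] at h2
      simpa [h2, Real.exp_ne_zero] using h1
    have hu : u = 0 := by
      by_contra hu
      have h1 := hz0 (u, 0)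
      have h2 := chartComponents_conformalMetric_self_pos hd hz.1.1 hu
      simp at h1
      linarith
    rw [ha, hu]; rfl
  exact LinearMap.surjective_of_injective hinj

end GraphMap

section ParameterChange

lemma exists_contDiffAt_rightInverse {h : ℝ → ℝ} {t : ℝ} (hh : ContDiffAt ℝ ∞ h t)
    (h0 : deriv h t ≠ 0) :
    ∃ L : ℝ → ℝ, ContDiffAt ℝ ∞ L (h t) ∧ L (h t) = t ∧ ∀ᶠ s in 𝓝 (h t), h (L s) = s := by
  have hd : HasDerivAt h (deriv h t) t := (hh.differentiableAt (by simp)).hasDerivAt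
  have he : HasFDerivAt h ((ContinuousLinearEquiv.unitsEquivAut ℝ (Units.mk0 (deriv h t) h0) :
      ℝ ≃L[ℝ] ℝ) : ℝ →L[ℝ] ℝ) t := by
    refine hd.hasFDerivAt.congr_fderiv ?_
    ext; simp
  have hne : (∞ : WithTop ℕ∞) ≠ 0 := by simp
  exact ⟨hh.localInverse he hne, hh.to_localInverse he hne, hh.localInverse_apply_image he hne,
    (hh.hasStrictFDerivAt' he hne).eventually_right_inverse⟩

lemma IsParameterChange.contDiffAt {h : ℝ → ℝ} {J : Set ℝ} (hh : IsParameterChange h J)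
    (hJ : IsOpen J) {t : ℝ} (ht : t ∈ J) : ContDiffAt ℝ ∞ h t :=
  hh.1.contDiffAt (hJ.mem_nhds ht)

lemma IsParameterChange.injOn {h : ℝ → ℝ} {J : Set ℝ} (hh : IsParameterChange h J)
    (hJ' : J.OrdConnected) : InjOn h J := by
  have key : ∀ a ∈ J, ∀ b ∈ J, a < b → h a ≠ h b := by
    intro a ha b hb hab heq
    have hsub : Icc a b ⊆ J := hJ'.out ha hb
    obtain ⟨c, hc, hc0⟩ := exists_deriv_eq_zero hab (hh.1.continuousOn.mono hsub) heq
    exact hh.2 c (hsub (Ioo_subset_Icc_self hc)) hc0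
  intro a ha b hb heq
  rcases lt_trichotomy a b with hab | hab | hab
  · exact absurd heq (key a ha b hb hab)
  · exact hab
  · exact absurd heq.symm (key b hb a ha hab)

/-- A regular change of parameter has a smooth inverse on its open image. -/
lemma IsParameterChange.exists_inverse {h : ℝ → ℝ} {J : Set ℝ} (hh : IsParameterChange h J)
    (hJ : IsOpen J) (hJ' : J.OrdConnected) :
    IsOpen (h '' J) ∧ ∃ k : ℝ → ℝ, ContDiffOn ℝ ∞ k (h '' J) ∧ ∀ t ∈ J, k (h t) = t := by
  have hinj := hh.injOn hJ'
  have hloc : ∀ t ∈ J, ∃ L : ℝ → ℝ, ContDiffAt ℝ ∞ L (h t) ∧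
      ∀ᶠ s in 𝓝 (h t), L s ∈ J ∧ h (L s) = s := by
    intro t ht
    obtain ⟨L, hL, hLt, hLs⟩ := exists_contDiffAt_rightInverse (hh.contDiffAt hJ ht) (hh.2 t ht)
    refine ⟨L, hL, (hL.continuousAt.eventually_mem ?_).and hLs⟩
    rw [hLt]
    exact hJ.mem_nhds ht
  have hleft : ∀ t ∈ J, Function.invFunOn h J (h t) = t := fun t ht =>
    hinj.leftInvOn_invFunOn ht
  refine ⟨?_, Function.invFunOn h J, ?_, hleft⟩
  · rw [isOpen_iff_mem_nhds]
    rintro _ ⟨t, ht, rfl⟩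
    obtain ⟨L, -, hLs⟩ := hloc t ht
    filter_upwards [hLs] with s hs
    exact ⟨L s, hs.1, hs.2⟩
  · rintro _ ⟨t, ht, rfl⟩
    obtain ⟨L, hL, hLs⟩ := hloc t ht
    refine (hL.congr_of_eventuallyEq ?_).contDiffWithinAt
    filter_upwards [hLs] with s hs
    rw [← hs.2, hleft _ hs.1, hs.2]

/-- A smooth function on a symmetric open interval has a smooth primitive. -/
lemma exists_contDiffOn_primitive {f : ℝ → ℝ} {ε : ℝ} (hf : ContDiffOn ℝ ∞ f (Ioo (-ε) ε)) :
    ∃ h : ℝ → ℝ, ContDiffOn ℝ ∞ h (Ioo (-ε) ε) ∧ ∀ t ∈ Ioo (-ε) ε, HasDerivAt h (f t) t := by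
  have hder : ∀ t ∈ Ioo (-ε) ε, HasDerivAt (fun u => ∫ x in (0 : ℝ)..u, f x) (f t) t := by
    intro t ht
    have h0 : (0 : ℝ) ∈ Ioo (-ε) ε := by constructor <;> linarith [ht.1, ht.2]
    have hsub : uIcc 0 t ⊆ Ioo (-ε) ε := ordConnected_Ioo.uIcc_subset h0 ht
    exact intervalIntegral.integral_hasDerivAt_right
      (hf.continuousOn.mono hsub).intervalIntegrable
      (hf.continuousOn.stronglyMeasurableAtFilter isOpen_Ioo t ht)
      (hf.continuousOn.continuousAt (isOpen_Ioo.mem_nhds ht))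
  refine ⟨_, ?_, hder⟩
  rw [contDiffOn_infty_iff_deriv_of_isOpen isOpen_Ioo]
  exact ⟨fun t ht => (hder t ht).differentiableAt.differentiableWithinAt,
    hf.congr fun t ht => (hder t ht).deriv⟩

variable {V : Type*} [NormedAddCommGroup V] [NormedSpace ℝ V]

lemma eulerLagrange_eq_zero_iff_comp {g : V → V → V → ℝ} {b c : ℝ → V} {h : ℝ → ℝ} {t : ℝ}
    (hb : ContDiffAt ℝ 2 b (h t)) (hh : ContDiffAt ℝ 2 h t) (h0 : deriv h t ≠ 0)
    (hg : SymmFormAt g (b (h t))) (hc : c =ᶠ[𝓝 t] b ∘ h) (w : V) :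
    eulerLagrange g b (h t) w = 0 ↔
      eulerLagrange g c t w = deriv (deriv h) t / deriv h t * g (c t) (deriv c t) w := by
  have h1 : deriv c t = deriv h t • deriv b (h t) := by
    rw [hc.deriv_eq]
    exact ((hb.differentiableAt (by simp)).hasDerivAt.scomp t
      (hh.differentiableAt (by simp)).hasDerivAt).deriv
  rw [eulerLagrange_congr_curve hc, eulerLagrange_comp hb hh hg, h1, hc.self_of_nhds]
  simp only [Function.comp_apply]
  rw [hg.smul_left]
  have h2 : deriv (deriv h) t / deriv h t * (deriv h t * g (b (h t)) (deriv b (h t)) w) =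
    deriv (deriv h) t * g (b (h t)) (deriv b (h t)) w := by field_simp
  rw [h2]
  constructor
  · intro hz; rw [hz]; ring
  · intro hz
    have h3 : deriv h t ^ 2 * eulerLagrange g b (h t) w = 0 := by linarith
    exact (mul_eq_zero.1 h3).resolve_left (pow_ne_zero _ h0)

end ParameterChange

section Reparametrization

variable {E : Type*} [NormedAddCommGroup E] [NormedSpace ℝ E]
  {H : Type*} [TopologicalSpace H] {I : ModelWithCorners ℝ E H} [I.Boundaryless]
  {N : Type*} [TopologicalSpace N] [ChartedSpace H N] [IsManifold I ∞ N]
  {g : (x : N) → TangentSpace I x → TangentSpace I x → ℝ}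

/-- The geodesic equation for a reparametrized curve, in a chart. -/
lemma eulerLagrange_chart_eq_zero_iff_comp {p : N} {γ x : ℝ → N} {h : ℝ → ℝ} {t : ℝ}
    (hγ : ContMDiffAt 𝓘(ℝ, ℝ) I ∞ γ (h t)) (hh : ContDiffAt ℝ ∞ h t) (h0 : deriv h t ≠ 0)
    (hx : x =ᶠ[𝓝 t] γ ∘ h) (hp : x t ∈ (extChartAt I p).source)
    (hg : ∀ y ∈ (extChartAt I p).target, SymmFormAt (chartComponents I g p) y) (w : E) :
    eulerLagrange (chartComponents I g p) (fun r => extChartAt I p (γ r)) (h t) w = 0 ↔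
      eulerLagrange (chartComponents I g p) (fun r => extChartAt I p (x r)) t w =
        deriv (deriv h) t / deriv h t * chartComponents I g p (extChartAt I p (x t))
          (deriv (fun r => extChartAt I p (x r)) t) w := by
  have hp' : γ (h t) ∈ (extChartAt I p).source := by
    have := hx.self_of_nhds
    rw [Function.comp_apply] at this
    exact this ▸ hp
  refine eulerLagrange_eq_zero_iff_comp (b := fun r => extChartAt I p (γ r))
    ((contDiffAt_chart_comp le_rfl hγ hp').of_le (by decide)) (hh.of_le (by decide)) h0
    (hg _ ((extChartAt I p).map_source hp')) ?_ w
  filter_upwards [hx] with r hr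
  rw [hr]; rfl

end Reparametrization

section GraphCurve

variable {E : Type*} [NormedAddCommGroup E] [NormedSpace ℝ E]
  {M : Type*} [TopologicalSpace M] [ChartedSpace E M] [IsManifold 𝓘(ℝ, E) ∞ M]
  {g₀ : ContMDiffRiemannianMetric 𝓘(ℝ, E) ∞ E (fun x : M => TangentSpace 𝓘(ℝ, E) x)}
  {β : M → ℝ} {δ : (x : M) → TangentSpace 𝓘(ℝ, E) x}
  {φ : ℝ → M → M} {ε σ : ℝ} {U : Set M}

/-- The curve `ρ` dragged along by the flow, as a spacetime curve parametrized by shifted time. -/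
def graphCurve (φ : ℝ → M → M) (ρ : ℝ → M) (k : ℝ) (t : ℝ) : M × ℝ := (φ t (ρ t), t + k)

/-- The conformal factor along the curve dragged along by the flow. -/
noncomputable def curveFactor
    (g₀ : ContMDiffRiemannianMetric 𝓘(ℝ, E) ∞ E (fun x : M => TangentSpace 𝓘(ℝ, E) x))
    (β : M → ℝ) (δ : (x : M) → TangentSpace 𝓘(ℝ, E) x) (σ : ℝ) (φ : ℝ → M → M) (ρ : ℝ → M)
    (t : ℝ) : ℝ :=
  conformalFactor g₀ β δ (φ t (ρ t)) * Real.exp (σ * t)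

lemma chartComponents_deriv_chart {H : Type*} [TopologicalSpace H] {I : ModelWithCorners ℝ E H}
    [I.Boundaryless] {N : Type*} [TopologicalSpace N] [ChartedSpace H N] [IsManifold I ∞ N]
    (g : (x : N) → TangentSpace I x → TangentSpace I x → ℝ) {γ : ℝ → N} {t : ℝ} {p : N}
    (hγ : MDifferentiableAt 𝓘(ℝ, ℝ) I γ t) (hp : γ t ∈ (extChartAt I p).source) :
    chartComponents I g p (extChartAt I p (γ t)) (deriv (fun r => extChartAt I p (γ r)) t)
      (deriv (fun r => extChartAt I p (γ r)) t) = g (γ t) (velocity I γ t) (velocity I γ t) :=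
  chartComponents_fderiv_chart_comp g hγ hp (1 : ℝ) (1 : ℝ)

lemma mem_flowDomain_chart {p x : M} {t : ℝ} (hx : x ∈ (extChartAt 𝓘(ℝ, E) p).source)
    (hxU : x ∈ U) (ht : t ∈ Ioo (-ε) ε) :
    (extChartAt 𝓘(ℝ, E) p x, t) ∈ (flowDomain ε U p : Set (E × ℝ)) := by
  refine ⟨⟨(extChartAt 𝓘(ℝ, E) p).map_source hx, ?_⟩, ht⟩
  change (extChartAt 𝓘(ℝ, E) p).symm (extChartAt 𝓘(ℝ, E) p x) ∈ U
  rwa [(extChartAt 𝓘(ℝ, E) p).left_inv hx]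

lemma flowMap_chart {p x : M} {t : ℝ} (hx : x ∈ (extChartAt 𝓘(ℝ, E) p).source) :
    flowMap φ p (extChartAt 𝓘(ℝ, E) p x, t) = φ t x := by
  rw [flowMap, (extChartAt 𝓘(ℝ, E) p).left_inv hx]

lemma contMDiffAt_graphCurve (hU : IsOpen U)
    (hφ : IsLocalFlow 𝓘(ℝ, E) (fun x => -δ x) φ ε U) {ρ : ℝ → M} {t : ℝ}
    (hρ : ContMDiffAt 𝓘(ℝ, ℝ) 𝓘(ℝ, E) ∞ ρ t) (ht : t ∈ Ioo (-ε) ε) (hρU : ρ t ∈ U) (k : ℝ) :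
    ContMDiffAt 𝓘(ℝ, ℝ) (𝓘(ℝ, E).prod 𝓘(ℝ, ℝ)) ∞ (graphCurve φ ρ k) t := by
  have h1 : ContMDiffAt (𝓘(ℝ, ℝ).prod 𝓘(ℝ, E)) 𝓘(ℝ, E) ∞ (fun q : ℝ × M => φ q.1 q.2)
      (t, ρ t) := (hφ.1 _ ⟨ht, hρU⟩).contMDiffAt ((isOpen_Ioo.prod hU).mem_nhds ⟨ht, hρU⟩)
  have h2 : ContDiff ℝ ∞ (fun t : ℝ => t + k) := by fun_prop
  exact (h1.comp t (f := fun t => (t, ρ t)) (contMDiffAt_id.prodMk hρ)).prodMk (h2.contMDiff t)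

/-- The geodesic equations of the stationary metric along a graph and of the conformal metric. -/
lemma eulerLagrange_graphCurve [FiniteDimensional ℝ E] (hd : IsHomotheticData g₀ β δ σ)
    (hU : IsOpen U) (hφ : IsLocalFlow 𝓘(ℝ, E) (fun x => -δ x) φ ε U) {ρ : ℝ → M} {t k : ℝ}
    (hρ : ContMDiffAt 𝓘(ℝ, ℝ) 𝓘(ℝ, E) ∞ ρ t) (ht : t ∈ Ioo (-ε) ε) (hρU : ρ t ∈ U)
    {p : M} (hp : ρ t ∈ (extChartAt 𝓘(ℝ, E) p).source) {q : M × ℝ}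
    (hq : graphCurve φ ρ k t ∈ (extChartAt (𝓘(ℝ, E).prod 𝓘(ℝ, ℝ)) q).source)
    (hnull : conformalMetric g₀ β δ (ρ t) (velocity 𝓘(ℝ, E) ρ t) (velocity 𝓘(ℝ, E) ρ t) =
      Real.exp (-σ * t)) (μ : ℝ) :
    (∀ W, eulerLagrange (chartComponents (𝓘(ℝ, E).prod 𝓘(ℝ, ℝ)) (stationaryMetric g₀ β δ) q)
        (fun s => extChartAt (𝓘(ℝ, E).prod 𝓘(ℝ, ℝ)) q (graphCurve φ ρ k s)) t W =
      μ * chartComponents (𝓘(ℝ, E).prod 𝓘(ℝ, ℝ)) (stationaryMetric g₀ β δ) q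
        (extChartAt (𝓘(ℝ, E).prod 𝓘(ℝ, ℝ)) q (graphCurve φ ρ k t))
        (deriv (fun s => extChartAt (𝓘(ℝ, E).prod 𝓘(ℝ, ℝ)) q (graphCurve φ ρ k s)) t) W) ↔
    (∀ w, eulerLagrange (chartComponents 𝓘(ℝ, E) (conformalMetric g₀ β δ) p)
        (fun s => extChartAt 𝓘(ℝ, E) p (ρ s)) t w =
      -(σ / 2) * chartComponents 𝓘(ℝ, E) (conformalMetric g₀ β δ) p (extChartAt 𝓘(ℝ, E) p (ρ t))
        (deriv (fun s => extChartAt 𝓘(ℝ, E) p (ρ s)) t) w) ∧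
    μ = deriv (curveFactor g₀ β δ σ φ ρ) t / curveFactor g₀ β δ σ φ ρ t - σ / 2 := by
  set r : ℝ → E := fun s => extChartAt 𝓘(ℝ, E) p (ρ s) with hr
  set c : ℝ → E × ℝ := fun s => extChartAt (𝓘(ℝ, E).prod 𝓘(ℝ, ℝ)) q (graphCurve φ ρ k s) with hc
  set Φ : E × ℝ → E × ℝ := graphMapChart φ p k q with hΦ
  set G := chartComponents 𝓘(ℝ, E) (conformalMetric g₀ β δ) p with hG
  set G' := chartComponents (𝓘(ℝ, E).prod 𝓘(ℝ, ℝ)) (stationaryMetric g₀ β δ) q with hG'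
  have hdom : (r t, t) ∈ (flowDomain ε U p : Set (E × ℝ)) := mem_flowDomain_chart hp hρU ht
  have hgm : ∀ s, ρ s ∈ (extChartAt 𝓘(ℝ, E) p).source →
      graphMap φ p k (r s, s) = graphCurve φ ρ k s := fun s hs => by
    rw [graphMap, graphCurve, flowMap_chart hs]
  have hq' : graphMap φ p k (r t, t) ∈ (extChartAt (𝓘(ℝ, E).prod 𝓘(ℝ, ℝ)) q).source := by
    rwa [hgm t hp]
  have hnear : ∀ᶠ s in 𝓝 t, ρ s ∈ (extChartAt 𝓘(ℝ, E) p).source :=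
    hρ.continuousAt.eventually_mem ((isOpen_extChartAt_source p).mem_nhds hp)
  have hcΦ : c =ᶠ[𝓝 t] fun s => Φ (r s, s) := hnear.mono fun s hs =>
    congrArg (extChartAt (𝓘(ℝ, E).prod 𝓘(ℝ, ℝ)) q) (hgm s hs).symm
  have hfac : curveFactor g₀ β δ σ φ ρ =ᶠ[𝓝 t] fun s => graphFactor g₀ β δ σ φ p (r s, s) :=
    hnear.mono fun s hs => by
      have h1 : flowMap φ p (r s, s) = φ s (ρ s) := flowMap_chart hs
      simp only [curveFactor, graphFactor, h1]
  have hrd : ContDiffAt ℝ ∞ r t := contDiffAt_chart_comp le_rfl hρ hp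
  have hΦd : ContDiffAt ℝ ∞ Φ (r t, t) :=
    contDiffAt_chart_comp le_rfl (contMDiffAt_graphMap hU hφ hdom k) hq'
  have hsymm : SymmFormAt G (r t) := symmFormAt_conformalMetric hd.smooth_lapse hd.lapse_pos
    hd.smooth_shift hdom.1.1
  have hsymm' : SymmFormAt G' (Φ (r t, t)) := symmFormAt_stationaryMetric hd.smooth_lapse
    hd.smooth_shift ((extChartAt _ q).map_source hq')
  have hpull : ∀ᶠ z in 𝓝 (r t, t), ∀ u v, G' (Φ z) (fderiv ℝ Φ z u) (fderiv ℝ Φ z v) =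
      graphFactor g₀ β δ σ φ p z * (G z.1 u.1 v.1 - Real.exp (-σ * z.2) * u.2 * v.2) := by
    filter_upwards [(isOpen_flowDomain hU p).mem_nhds hdom,
      (contMDiffAt_graphMap hU hφ hdom k).continuousAt.eventually_mem
        ((isOpen_extChartAt_source q).mem_nhds hq')] with z hz hzq u v
    exact stationaryMetric_graphMapChart hd hU hφ hz hzq u v
  have hnull' : G (r t) (deriv r t) (deriv r t) = Real.exp (-σ * t) :=
    (chartComponents_deriv_chart _ (hρ.mdifferentiableAt (by simp)) hp).trans hnull
  have hEL : ∀ w a, eulerLagrange G' c t (fderiv ℝ Φ (r t, t) (w, a)) =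
      curveFactor g₀ β δ σ φ ρ t * (eulerLagrange G r t w + σ / 2 * Real.exp (-σ * t) * a)
      + deriv (curveFactor g₀ β δ σ φ ρ) t *
        (G (r t) (deriv r t) w - Real.exp (-σ * t) * a) := fun w a => by
    rw [eulerLagrange_congr_curve hcΦ, hfac.deriv_eq, hfac.self_of_nhds]
    exact eulerLagrange_conformal_graph (hrd.of_le (by decide)) hsymm (hΦd.of_le (by decide)) hsymm'
      ((contDiffAt_graphFactor hd hU hφ hdom).differentiableAt (by simp)) hpull hnull' w a
  have hc' : deriv c t = fderiv ℝ Φ (r t, t) (deriv r t, 1) := by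
    have h1 : HasDerivAt (fun s => (r s, s)) (deriv r t, (1 : ℝ)) t :=
      (hrd.differentiableAt (by simp)).hasDerivAt.prodMk (hasDerivAt_id t)
    rw [hcΦ.deriv_eq]
    exact ((hΦd.differentiableAt (by simp)).hasFDerivAt.comp_hasDerivAt_of_eq t h1 rfl).deriv
  have hG'c : ∀ w a, G' (c t) (deriv c t) (fderiv ℝ Φ (r t, t) (w, a)) =
      curveFactor g₀ β δ σ φ ρ t * (G (r t) (deriv r t) w - Real.exp (-σ * t) * a) := fun w a => by
    rw [hc', hcΦ.self_of_nhds, hpull.self_of_nhds, hfac.self_of_nhds]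
    simp
  have hpos : 0 < curveFactor g₀ β δ σ φ ρ t := by
    rw [hfac.self_of_nhds]; exact graphFactor_pos hd p _
  have hexp := Real.exp_pos (-σ * t)
  change (∀ W, eulerLagrange G' c t W = μ * G' (c t) (deriv c t) W) ↔
    (∀ w, eulerLagrange G r t w = -(σ / 2) * G (r t) (deriv r t) w) ∧ _
  constructor
  · intro h
    have h1 : ∀ w a, _ := fun w a => (hEL w a).symm.trans
      ((h (fderiv ℝ Φ (r t, t) (w, a))).trans (congrArg (μ * ·) (hG'c w a)))
    have hμ : μ = deriv (curveFactor g₀ β δ σ φ ρ) t / curveFactor g₀ β δ σ φ ρ t - σ / 2 := by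
      have h2 := h1 0 0
      have h3 := h1 0 1
      have h4 : Real.exp (-σ * t) * (curveFactor g₀ β δ σ φ ρ t * (σ / 2) -
        deriv (curveFactor g₀ β δ σ φ ρ) t + μ * curveFactor g₀ β δ σ φ ρ t) = 0 := by
        linear_combination h3 - h2
      have h5 := (mul_eq_zero.1 h4).resolve_left hexp.ne'
      field_simp
      linarith
    refine ⟨fun w => ?_, hμ⟩
    have h2 := h1 w 0
    simp only [hμ, mul_zero, add_zero, sub_zero] at h2
    field_simp at h2
    refine mul_left_cancel₀ hpos.ne' ?_
    linear_combination h2 / 2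
  · rintro ⟨h1, hμ⟩ W
    obtain ⟨⟨w, a⟩, rfl⟩ := surjective_fderiv_graphMapChart hd hU hφ hdom hq' W
    rw [hEL, hG'c, h1, hμ]
    field_simp
    ring

end GraphCurve

section Velocity

variable {E : Type*} [NormedAddCommGroup E] [NormedSpace ℝ E]
  {H : Type*} [TopologicalSpace H] {I : ModelWithCorners ℝ E H}
  {N : Type*} [TopologicalSpace N] [ChartedSpace H N]

lemma velocity_comp {γ x : ℝ → N} {h : ℝ → ℝ} {t : ℝ}
    (hγ : MDifferentiableAt 𝓘(ℝ, ℝ) I γ (h t)) (hh : DifferentiableAt ℝ h t)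
    (hx : x =ᶠ[𝓝 t] γ ∘ h) :
    (velocity I x t : E) = deriv h t • (velocity I γ (h t) : E) := by
  have h1 := (hγ.hasMFDerivAt.comp t hh.hasFDerivAt.hasMFDerivAt).congr_of_eventuallyEq hx
  have h2 : mfderiv 𝓘(ℝ, ℝ) I x t = (mfderiv 𝓘(ℝ, ℝ) I γ (h t)).comp (fderiv ℝ h t) := h1.mfderiv
  have h3 : (velocity I x t : E) =
    mfderiv 𝓘(ℝ, ℝ) I γ (h t) (fderiv ℝ h t (1 : ℝ)) := congrArg (fun L => L (1 : ℝ)) h2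
  have h4 : fderiv ℝ h t (1 : ℝ) = deriv h t • (1 : ℝ) := by simp
  refine h3.trans ((congrArg (mfderiv 𝓘(ℝ, ℝ) I γ (h t)) h4).trans ?_)
  exact map_smul (mfderiv 𝓘(ℝ, ℝ) I γ (h t)) (deriv h t) (1 : ℝ)

end Velocity

section ToLightRay

variable {E : Type*} [NormedAddCommGroup E] [NormedSpace ℝ E]
  {M : Type*} [TopologicalSpace M] [ChartedSpace E M] [IsManifold 𝓘(ℝ, E) ∞ M]
  {g₀ : ContMDiffRiemannianMetric 𝓘(ℝ, E) ∞ E (fun x : M => TangentSpace 𝓘(ℝ, E) x)}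
  {β : M → ℝ} {δ : (x : M) → TangentSpace 𝓘(ℝ, E) x}
  {φ : ℝ → M → M} {ε σ : ℝ} {U : Set M}

lemma stationaryMetric_smul (z : M × ℝ) (c : ℝ) (ξ : E × ℝ) :
    stationaryMetric g₀ β δ z (c • ξ) (c • ξ) = c ^ 2 * stationaryMetric g₀ β δ z ξ ξ := by
  refine (stationaryMetric_eq z (c • ξ) (c • ξ)).trans ?_
  refine (stationaryForm_smul z.1 c ξ.1 ξ.2 (c • ξ.1) (c * ξ.2)).trans ?_
  refine (congrArg (c * ·) ((stationaryForm_symm z.1 ξ.1 ξ.2 (c • ξ.1) (c * ξ.2)).trans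
    ((stationaryForm_smul z.1 c ξ.1 ξ.2 ξ.1 ξ.2).trans
      (congrArg (c * ·) (stationaryMetric_eq z ξ ξ).symm)))).trans ?_
  ring

lemma stationaryMetric_velocity_comp {γ x : ℝ → M × ℝ} {h : ℝ → ℝ} {t : ℝ}
    (hγ : MDifferentiableAt 𝓘(ℝ, ℝ) (𝓘(ℝ, E).prod 𝓘(ℝ, ℝ)) γ (h t))
    (hh : DifferentiableAt ℝ h t) (hx : x =ᶠ[𝓝 t] γ ∘ h) :
    stationaryMetric g₀ β δ (x t) (velocity (𝓘(ℝ, E).prod 𝓘(ℝ, ℝ)) x t)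
      (velocity (𝓘(ℝ, E).prod 𝓘(ℝ, ℝ)) x t) =
    deriv h t ^ 2 * stationaryMetric g₀ β δ (γ (h t))
      (velocity (𝓘(ℝ, E).prod 𝓘(ℝ, ℝ)) γ (h t)) (velocity (𝓘(ℝ, E).prod 𝓘(ℝ, ℝ)) γ (h t)) := by
  have key : ∀ (z z' : M × ℝ) (_ : z = z') (ξ ξ' : E × ℝ), ξ = ξ' →
      stationaryMetric g₀ β δ z ξ ξ = stationaryMetric g₀ β δ z' ξ' ξ' := by
    rintro z _ rfl ξ _ rfl; rfl
  exact (key _ _ hx.self_of_nhds _ _ (velocity_comp hγ hh hx)).trans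
    (stationaryMetric_smul _ _ _)

lemma velocity_graphCurve_snd {ρ : ℝ → M} {t k : ℝ}
    (hγ : MDifferentiableAt 𝓘(ℝ, ℝ) (𝓘(ℝ, E).prod 𝓘(ℝ, ℝ)) (graphCurve φ ρ k) t) :
    (velocity (𝓘(ℝ, E).prod 𝓘(ℝ, ℝ)) (graphCurve φ ρ k) t : E × ℝ).2 = 1 := by
  have h1 := congrArg Prod.snd (mfderiv_prod_components hγ (1 : ℝ))
  refine h1.trans ?_
  have h2 : HasDerivAt (fun s : ℝ => s + k) 1 t := (hasDerivAt_id t).add_const k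
  exact h2.deriv

lemma stationaryMetric_velocity_graphCurve [FiniteDimensional ℝ E]
    (hd : IsHomotheticData g₀ β δ σ) (hU : IsOpen U)
    (hφ : IsLocalFlow 𝓘(ℝ, E) (fun x => -δ x) φ ε U) {ρ : ℝ → M} {t : ℝ}
    (hρ : ContMDiffAt 𝓘(ℝ, ℝ) 𝓘(ℝ, E) ∞ ρ t) (ht : t ∈ Ioo (-ε) ε) (hρU : ρ t ∈ U) (k : ℝ) :
    stationaryMetric g₀ β δ (graphCurve φ ρ k t)
      (velocity (𝓘(ℝ, E).prod 𝓘(ℝ, ℝ)) (graphCurve φ ρ k) t)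
      (velocity (𝓘(ℝ, E).prod 𝓘(ℝ, ℝ)) (graphCurve φ ρ k) t) =
    curveFactor g₀ β δ σ φ ρ t *
      (conformalMetric g₀ β δ (ρ t) (velocity 𝓘(ℝ, E) ρ t) (velocity 𝓘(ℝ, E) ρ t)
        - Real.exp (-σ * t)) := by
  set p := ρ t with hpdef
  set r : ℝ → E := fun s => extChartAt 𝓘(ℝ, E) p (ρ s) with hr
  have hp : ρ t ∈ (extChartAt 𝓘(ℝ, E) p).source := mem_extChartAt_source p
  have hdom : (r t, t) ∈ (flowDomain ε U p : Set (E × ℝ)) := mem_flowDomain_chart hp hρU ht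
  have hnear : ∀ᶠ s in 𝓝 t, ρ s ∈ (extChartAt 𝓘(ℝ, E) p).source :=
    hρ.continuousAt.eventually_mem ((isOpen_extChartAt_source p).mem_nhds hp)
  have hev : graphCurve φ ρ k =ᶠ[𝓝 t] graphMap φ p k ∘ fun s => (r s, s) :=
    hnear.mono fun s hs => by
      rw [Function.comp_apply, graphMap, graphCurve, flowMap_chart hs]
  have hrd : ContDiffAt ℝ ∞ r t := contDiffAt_chart_comp le_rfl hρ hp
  have h1 : HasDerivAt (fun s => (r s, s)) (deriv r t, (1 : ℝ)) t :=
    (hrd.differentiableAt (by simp)).hasDerivAt.prodMk (hasDerivAt_id t)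
  have h2 := ((contMDiffAt_graphMap hU hφ hdom k).mdifferentiableAt
    (by simp)).hasMFDerivAt.comp t (f := fun s => (r s, s)) h1.hasFDerivAt.hasMFDerivAt
  have h3 := (h2.congr_of_eventuallyEq hev).mfderiv
  have h4 : (velocity (𝓘(ℝ, E).prod 𝓘(ℝ, ℝ)) (graphCurve φ ρ k) t : E × ℝ) =
      mfderiv 𝓘(ℝ, E × ℝ) (𝓘(ℝ, E).prod 𝓘(ℝ, ℝ)) (graphMap φ p k) (r t, t)
        ((1 : ℝ) • ((deriv r t, 1) : E × ℝ)) := congrArg (fun L => L (1 : ℝ)) h3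
  rw [one_smul] at h4
  have key : ∀ (z z' : M × ℝ) (_ : z = z') (ξ ξ' : E × ℝ), ξ = ξ' →
      stationaryMetric g₀ β δ z ξ ξ = stationaryMetric g₀ β δ z' ξ' ξ' := by
    rintro z _ rfl ξ _ rfl; rfl
  refine (key _ _ hev.self_of_nhds _ _ h4).trans ?_
  refine (stationaryMetric_graphMap hd hU hφ hdom k (deriv r t, 1) (deriv r t, 1)).trans ?_
  have h5 : chartComponents 𝓘(ℝ, E) (conformalMetric g₀ β δ) p (r t) (deriv r t) (deriv r t) = _ :=
    chartComponents_deriv_chart _ (hρ.mdifferentiableAt (by simp)) hp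
  have h6 : flowMap φ p (r t, t) = φ t (ρ t) := flowMap_chart hp
  simp only [graphFactor, curveFactor, h5, h6]
  ring

lemma curveFactor_pos (hd : IsHomotheticData g₀ β δ σ) (ρ : ℝ → M) (t : ℝ) :
    0 < curveFactor g₀ β δ σ φ ρ t :=
  mul_pos (conformalFactor_pos hd.lapse_pos _) (Real.exp_pos _)

lemma contDiffAt_curveFactor (hd : IsHomotheticData g₀ β δ σ) (hU : IsOpen U)
    (hφ : IsLocalFlow 𝓘(ℝ, E) (fun x => -δ x) φ ε U) {ρ : ℝ → M} {t : ℝ}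
    (hρ : ContMDiffAt 𝓘(ℝ, ℝ) 𝓘(ℝ, E) ∞ ρ t) (ht : t ∈ Ioo (-ε) ε) (hρU : ρ t ∈ U) :
    ContDiffAt ℝ ∞ (curveFactor g₀ β δ σ φ ρ) t := by
  have h1 : ContMDiffAt 𝓘(ℝ, ℝ) 𝓘(ℝ, E) ∞ (fun s => φ s (ρ s)) t :=
    (contMDiffAt_graphCurve hU hφ hρ ht hρU 0).fst
  have h2 : ContDiffAt ℝ ∞ (fun s => conformalFactor g₀ β δ (φ s (ρ s))) t :=
    ((contMDiffAt_conformalFactor (g₀ := g₀) hd.smooth_lapse hd.smooth_shift _).comp t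
      h1).contDiffAt
  have h3 : ContDiffAt ℝ ∞ (fun s : ℝ => Real.exp (σ * s)) t := by fun_prop
  exact h2.mul h3

variable {ρ : ℝ → M}

lemma IsDraggedGeodesic.contMDiffAt (h : IsDraggedGeodesic g₀ β δ σ ε ρ U φ) {t : ℝ}
    (ht : t ∈ Ioo (-ε) ε) : ContMDiffAt 𝓘(ℝ, ℝ) 𝓘(ℝ, E) ∞ ρ t := by
  obtain ⟨c, k, hk, hc, hρ⟩ := h.geodesic
  have h1 : ContMDiffAt 𝓘(ℝ, ℝ) 𝓘(ℝ, E) ∞ c (k t) :=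
    (hc.1 _ ⟨t, ht, rfl⟩).contMDiffAt
      ((hk.exists_inverse isOpen_Ioo ordConnected_Ioo).1.mem_nhds ⟨t, ht, rfl⟩)
  refine (h1.comp t (hk.contDiffAt isOpen_Ioo ht).contMDiffAt).congr_of_eventuallyEq ?_
  filter_upwards [isOpen_Ioo.mem_nhds ht] with s hs using hρ s hs

lemma IsDraggedGeodesic.conformalMetric_velocity (hd : IsHomotheticData g₀ β δ σ)
    (h : IsDraggedGeodesic g₀ β δ σ ε ρ U φ) {t : ℝ} (ht : t ∈ Ioo (-ε) ε) :
    conformalMetric g₀ β δ (ρ t) (velocity 𝓘(ℝ, E) ρ t) (velocity 𝓘(ℝ, E) ρ t) =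
      Real.exp (-σ * t) := by
  rw [conformalMetric, h.speed t ht]
  exact mul_div_cancel_left₀ _ (conformalFactor_pos hd.lapse_pos _).ne'

/-- A reparametrized geodesic with speed `e^{-σ t}` solves the geodesic equation with
friction `σ / 2`. -/
lemma IsDraggedGeodesic.eulerLagrange_eq [FiniteDimensional ℝ E]
    (hd : IsHomotheticData g₀ β δ σ) (h : IsDraggedGeodesic g₀ β δ σ ε ρ U φ) {t : ℝ}
    (ht : t ∈ Ioo (-ε) ε) {p : M} (hp : ρ t ∈ (extChartAt 𝓘(ℝ, E) p).source) (w : E) :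
    eulerLagrange (chartComponents 𝓘(ℝ, E) (conformalMetric g₀ β δ) p)
        (fun s => extChartAt 𝓘(ℝ, E) p (ρ s)) t w =
      -(σ / 2) * chartComponents 𝓘(ℝ, E) (conformalMetric g₀ β δ) p (extChartAt 𝓘(ℝ, E) p (ρ t))
        (deriv (fun s => extChartAt 𝓘(ℝ, E) p (ρ s)) t) w := by
  have hρt := h.contMDiffAt ht
  obtain ⟨c, k, hk, hc, hρ⟩ := h.geodesic
  have hopen := (hk.exists_inverse isOpen_Ioo ordConnected_Ioo).1
  have hct : ContMDiffAt 𝓘(ℝ, ℝ) 𝓘(ℝ, E) ∞ c (k t) :=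
    (hc.1 _ ⟨t, ht, rfl⟩).contMDiffAt (hopen.mem_nhds ⟨t, ht, rfl⟩)
  have hev : ρ =ᶠ[𝓝 t] c ∘ k := by
    filter_upwards [isOpen_Ioo.mem_nhds ht] with s hs using hρ s hs
  have hg : ∀ y ∈ (extChartAt 𝓘(ℝ, E) p).target,
      SymmFormAt (chartComponents 𝓘(ℝ, E) (conformalMetric g₀ β δ) p) y := fun y hy =>
    symmFormAt_conformalMetric hd.smooth_lapse hd.lapse_pos hd.smooth_shift hy
  have hcp : c (k t) ∈ (extChartAt 𝓘(ℝ, E) p).source := by rw [← hρ t ht]; exact hp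
  have hEL := fun w => (eulerLagrange_chart_eq_zero_iff_comp hct (hk.contDiffAt isOpen_Ioo ht)
    (hk.2 t ht) hev hp hg w).1 (hc.2 _ ⟨t, ht, rfl⟩ p hcp w)
  have hnear : ∀ᶠ s in 𝓝 t, s ∈ Ioo (-ε) ε ∧ ρ s ∈ (extChartAt 𝓘(ℝ, E) p).source :=
    (isOpen_Ioo.eventually_mem ht).and
      (hρt.continuousAt.eventually_mem ((isOpen_extChartAt_source p).mem_nhds hp))
  set r : ℝ → E := fun s => extChartAt 𝓘(ℝ, E) p (ρ s) with hr
  set G := chartComponents 𝓘(ℝ, E) (conformalMetric g₀ β δ) p with hG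
  have hspeed : (fun s => G (r s) (deriv r s) (deriv r s)) =ᶠ[𝓝 t] fun s => Real.exp (-σ * s) := by
    filter_upwards [hnear] with s hs
    exact (chartComponents_deriv_chart _ ((h.contMDiffAt hs.1).mdifferentiableAt (by simp))
      hs.2).trans (h.conformalMetric_velocity hd hs.1)
  have h1 := hasDerivAt_speed ((contDiffAt_chart_comp le_rfl hρt hp).of_le (by decide))
    (hg _ ((extChartAt 𝓘(ℝ, E) p).map_source hp))
  have h2 : HasDerivAt (fun s : ℝ => Real.exp (-σ * s)) (Real.exp (-σ * t) * -σ) t := by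
    have : HasDerivAt (fun s : ℝ => -σ * s) (-σ) t := by
      simpa using (hasDerivAt_id t).const_mul (-σ)
    exact this.exp
  have h3 := (h1.congr_of_eventuallyEq hspeed.symm).unique h2
  have h4 : eulerLagrange G r t (deriv r t) = _ := hEL (deriv r t)
  have h5 : G (r t) (deriv r t) (deriv r t) = Real.exp (-σ * t) := hspeed.self_of_nhds
  have h6 : deriv (deriv k) t / deriv k t = -(σ / 2) := by
    have h7 : 2 * (deriv (deriv k) t / deriv k t * Real.exp (-σ * t)) = Real.exp (-σ * t) * -σ := by
      rw [← h5, ← h4, h5]; exact h3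
    refine mul_right_cancel₀ (Real.exp_pos (-σ * t)).ne' ?_
    linarith
  have h8 := hEL w
  rwa [h6] at h8

/-- A dragged geodesic is the spatial part of a light ray. -/
lemma IsDraggedGeodesic.exists_lightRay [FiniteDimensional ℝ E]
    (hd : IsHomotheticData g₀ β δ σ) (h : IsDraggedGeodesic g₀ β δ σ ε ρ U φ) :
    ∃ (γ : ℝ → M × ℝ) (k : ℝ → ℝ), IsParameterChange k (Ioo (-ε) ε) ∧
      IsLightRayOn g₀ β δ γ (k '' Ioo (-ε) ε) ∧
      ∀ t ∈ Ioo (-ε) ε, 0 < deriv k t ∧ (γ (k t)).1 = φ t (ρ t) ∧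
        0 < deriv (fun r => (γ (k r)).2) t := by
  have hfac : ∀ t ∈ Ioo (-ε) ε, ContDiffAt ℝ ∞ (curveFactor g₀ β δ σ φ ρ) t := fun t ht =>
    contDiffAt_curveFactor hd h.isOpen h.flow (h.contMDiffAt ht) ht (h.mem t ht)
  have hexp : ContDiff ℝ ∞ (fun t : ℝ => Real.exp (-(σ / 2) * t)) := by fun_prop
  obtain ⟨k, hk, hk'⟩ := exists_contDiffOn_primitive
    (f := fun t => curveFactor g₀ β δ σ φ ρ t * Real.exp (-(σ / 2) * t)) (ε := ε)
    (fun t ht => ((hfac t ht).mul hexp.contDiffAt).contDiffWithinAt)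
  have hpos : ∀ t, 0 < curveFactor g₀ β δ σ φ ρ t * Real.exp (-(σ / 2) * t) := fun t =>
    mul_pos (curveFactor_pos hd ρ t) (Real.exp_pos _)
  have hderiv : ∀ t ∈ Ioo (-ε) ε, 0 < deriv k t := fun t ht => by
    rw [(hk' t ht).deriv]; exact hpos t
  have hkpc : IsParameterChange k (Ioo (-ε) ε) := ⟨hk, fun t ht => (hderiv t ht).ne'⟩
  obtain ⟨hopen, m, hm, hmk⟩ := hkpc.exists_inverse isOpen_Ioo ordConnected_Ioo
  have hgc : ∀ t ∈ Ioo (-ε) ε,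
      ContMDiffAt 𝓘(ℝ, ℝ) (𝓘(ℝ, E).prod 𝓘(ℝ, ℝ)) ∞ (graphCurve φ ρ 0) t := fun t ht =>
    contMDiffAt_graphCurve h.isOpen h.flow (h.contMDiffAt ht) ht (h.mem t ht) 0
  have hγ : ∀ t ∈ Ioo (-ε) ε, ContMDiffAt 𝓘(ℝ, ℝ) (𝓘(ℝ, E).prod 𝓘(ℝ, ℝ)) ∞
      (graphCurve φ ρ 0 ∘ m) (k t) := fun t ht => by
    have h1 := hgc t ht
    rw [← hmk t ht] at h1
    exact h1.comp (k t) (hm.contDiffAt (hopen.mem_nhds ⟨t, ht, rfl⟩)).contMDiffAt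
  have hev : ∀ t ∈ Ioo (-ε) ε, graphCurve φ ρ 0 =ᶠ[𝓝 t] (graphCurve φ ρ 0 ∘ m) ∘ k := by
    intro t ht
    filter_upwards [isOpen_Ioo.mem_nhds ht] with s hs
    rw [Function.comp_apply, Function.comp_apply, hmk s hs]
  have hratio : ∀ t ∈ Ioo (-ε) ε, deriv (deriv k) t / deriv k t =
      deriv (curveFactor g₀ β δ σ φ ρ) t / curveFactor g₀ β δ σ φ ρ t - σ / 2 := by
    intro t ht
    have h1 : deriv k =ᶠ[𝓝 t]
        fun t => curveFactor g₀ β δ σ φ ρ t * Real.exp (-(σ / 2) * t) := by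
      filter_upwards [isOpen_Ioo.mem_nhds ht] with s hs using (hk' s hs).deriv
    have h2 : HasDerivAt (fun s : ℝ => -(σ / 2) * s) (-(σ / 2)) t := by
      simpa using (hasDerivAt_id t).const_mul (-(σ / 2))
    have h3 := ((hfac t ht).differentiableAt (by simp)).hasDerivAt.fun_mul h2.exp
    rw [h1.deriv_eq, h1.self_of_nhds, h3.deriv]
    have h4 := (curveFactor_pos (φ := φ) hd ρ t).ne'
    have h5 := (Real.exp_pos (-(σ / 2) * t)).ne'
    field_simp
    ring
  refine ⟨graphCurve φ ρ 0 ∘ m, k, hkpc, ⟨⟨?_, ?_⟩, ?_⟩, ?_⟩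
  · rintro _ ⟨t, ht, rfl⟩
    exact (hγ t ht).contMDiffWithinAt
  · rintro _ ⟨t, ht, rfl⟩ q hq w
    have hq' : graphCurve φ ρ 0 t ∈ (extChartAt (𝓘(ℝ, E).prod 𝓘(ℝ, ℝ)) q).source := by
      rw [(hev t ht).self_of_nhds]; exact hq
    have hg : ∀ y ∈ (extChartAt (𝓘(ℝ, E).prod 𝓘(ℝ, ℝ)) q).target, SymmFormAt
        (chartComponents (𝓘(ℝ, E).prod 𝓘(ℝ, ℝ)) (stationaryMetric g₀ β δ) q) y := fun y hy =>
      symmFormAt_stationaryMetric hd.smooth_lapse hd.smooth_shift hy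
    refine (eulerLagrange_chart_eq_zero_iff_comp (hγ t ht) (hkpc.contDiffAt isOpen_Ioo ht)
      (hderiv t ht).ne' (hev t ht) hq' hg w).2 ?_
    have hp := mem_extChartAt_source (I := 𝓘(ℝ, E)) (ρ t)
    exact (eulerLagrange_graphCurve hd h.isOpen h.flow (h.contMDiffAt ht) ht (h.mem t ht) hp hq'
      (h.conformalMetric_velocity hd ht) _).2 ⟨fun w => h.eulerLagrange_eq hd ht hp w,
        hratio t ht⟩ w
  · rintro _ ⟨t, ht, rfl⟩
    have hkd := (hk' t ht).differentiableAt
    have hγd := (hγ t ht).mdifferentiableAt (by simp)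
    constructor
    · intro h0
      have h1 := velocity_comp hγd hkd (hev t ht)
      have h2 := velocity_graphCurve_snd ((hgc t ht).mdifferentiableAt (by simp))
      have h3 : (velocity (𝓘(ℝ, E).prod 𝓘(ℝ, ℝ)) (graphCurve φ ρ 0 ∘ m) (k t) : E × ℝ) = 0 := h0
      rw [h3, smul_zero] at h1
      rw [h1] at h2
      exact zero_ne_one h2
    · have h1 := stationaryMetric_velocity_comp (g₀ := g₀) (β := β) (δ := δ) hγd hkd (hev t ht)
      rw [stationaryMetric_velocity_graphCurve hd h.isOpen h.flow (h.contMDiffAt ht) ht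
        (h.mem t ht), h.conformalMetric_velocity hd ht, sub_self, mul_zero] at h1
      exact (mul_eq_zero.1 h1.symm).resolve_left (pow_ne_zero _ (hderiv t ht).ne')
  · intro t ht
    refine ⟨hderiv t ht, ?_, ?_⟩
    · rw [← Function.comp_apply (f := graphCurve φ ρ 0 ∘ m), ← (hev t ht).self_of_nhds]
      rfl
    · have h1 : (fun r => ((graphCurve φ ρ 0 ∘ m) (k r)).2) =ᶠ[𝓝 t] fun r => r + 0 := by
        filter_upwards [hev t ht] with s hs
        exact (congrArg Prod.snd hs).symm
      rw [h1.deriv_eq]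
      simp

end ToLightRay

section LocalFlow

variable {E : Type*} [NormedAddCommGroup E] [NormedSpace ℝ E]
  {M : Type*} [TopologicalSpace M] [ChartedSpace E M] [IsManifold 𝓘(ℝ, E) ∞ M]
  {X : (x : M) → TangentSpace 𝓘(ℝ, E) x}

/-- A function that is smooth on an open set agrees near a point with a globally smooth one. -/
lemma exists_contDiff_eqOn_closedBall [FiniteDimensional ℝ E] {D : E → E} {s : Set E} {y : E}
    (hs : s ∈ 𝓝 y) (hD : ∀ z ∈ s, ContDiffAt ℝ ∞ D z) :
    ∃ f : E → E, ContDiff ℝ ∞ f ∧ ∃ r > 0, Metric.ball y r ⊆ s ∧ ∀ z ∈ Metric.ball y r, f z = D z := by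
  obtain ⟨R, hR, hRs⟩ := Metric.mem_nhds_iff.1 hs
  let b : ContDiffBump y := ⟨R / 3, R / 2, by positivity, by linarith⟩
  refine ⟨fun z => b z • D z, ?_, R / 3, by positivity, ?_, ?_⟩
  · rw [contDiff_iff_contDiffAt]
    intro z
    by_cases hz : z ∈ Metric.ball y R
    · exact b.contDiffAt.smul (hD z (hRs hz))
    · have h1 : (Metric.closedBall y (R / 2))ᶜ ∈ 𝓝 z := by
        refine Metric.isClosed_closedBall.isOpen_compl.mem_nhds fun hz' => hz ?_
        exact Metric.closedBall_subset_ball (by linarith) hz'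
      refine (contDiffAt_const (c := (0 : E))).congr_of_eventuallyEq ?_
      filter_upwards [h1] with w hw
      have hw' : R / 2 ≤ dist w y := by
        simp only [mem_compl_iff, Metric.mem_closedBall, not_le] at hw
        exact hw.le
      rw [b.zero_of_le_dist hw', zero_smul]
  · exact (Metric.ball_subset_ball (by linarith)).trans hRs
  · intro z hz
    have h1 : b z = 1 := b.one_of_mem_closedBall (Metric.ball_subset_closedBall hz)
    simp only [h1, one_smul]

/-- A smooth vector field has a smooth local flow. -/
lemma exists_isLocalFlow [FiniteDimensional ℝ E] (hX : ∀ x, SmoothFieldAt 𝓘(ℝ, E) X x) (x₀ : M) :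
    ∃ (ε : ℝ) (U : Set M) (φ : ℝ → M → M), 0 < ε ∧ IsOpen U ∧ x₀ ∈ U ∧
      IsLocalFlow 𝓘(ℝ, E) X φ ε U := by
  have := FiniteDimensional.complete ℝ E
  set ψ := extChartAt 𝓘(ℝ, E) x₀ with hψ
  obtain ⟨f, hf, r, hr, hrs, hfD⟩ := exists_contDiff_eqOn_closedBall
    (extChartAt_target_mem_nhds (I := 𝓘(ℝ, E)) x₀)
    (fun z hz => contDiffAt_fieldComponents hX hz)
  obtain ⟨ε₁, hε₁, α, hα, hαflow⟩ := exists_smooth_flow hf (ψ x₀)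
  have hnhds : Ioo (-ε₁) ε₁ ×ˢ Metric.ball (ψ x₀) ε₁ ∈ 𝓝 ((0 : ℝ), ψ x₀) :=
    (isOpen_Ioo.prod Metric.isOpen_ball).mem_nhds
      ⟨⟨by linarith, hε₁⟩, Metric.mem_ball_self hε₁⟩
  have hcont : ContinuousAt (fun q : ℝ × E => α q.1 q.2) (0, ψ x₀) :=
    hα.continuousOn.continuousAt hnhds
  have hα0 : α 0 (ψ x₀) = ψ x₀ := (hαflow _ (Metric.mem_ball_self hε₁)).1
  have hball : ∀ᶠ q : ℝ × E in 𝓝 (0, ψ x₀), q ∈ Ioo (-ε₁) ε₁ ×ˢ Metric.ball (ψ x₀) ε₁ ∧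
      α q.1 q.2 ∈ Metric.ball (ψ x₀) r := by
    refine Filter.Eventually.and hnhds (hcont.eventually_mem ?_)
    simp only [hα0]
    exact Metric.ball_mem_nhds _ hr
  obtain ⟨ε, hε, hεball⟩ := Metric.mem_nhds_iff.1 hball
  have hmem : ∀ t ∈ Ioo (-ε) ε, ∀ z ∈ Metric.ball (ψ x₀) ε,
      (t, z) ∈ Ioo (-ε₁) ε₁ ×ˢ Metric.ball (ψ x₀) ε₁ ∧ α t z ∈ Metric.ball (ψ x₀) r := by
    intro t ht z hz
    refine hεball (?_ : (t, z) ∈ Metric.ball ((0 : ℝ), ψ x₀) ε)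
    rw [← ball_prod_same]
    refine ⟨?_, hz⟩
    rw [Real.ball_eq_Ioo]
    simpa using ht
  set U : Set M := ψ.source ∩ ψ ⁻¹' Metric.ball (ψ x₀) ε with hU
  have hUopen : IsOpen U := (continuousOn_extChartAt x₀).isOpen_inter_preimage
    (isOpen_extChartAt_source x₀) Metric.isOpen_ball
  refine ⟨ε, U, fun t x => ψ.symm (α t (ψ x)), hε, hUopen,
    ⟨mem_extChartAt_source x₀, Metric.mem_ball_self hε⟩, ?_, ?_⟩
  · rintro ⟨t, x⟩ ⟨ht, hx⟩
    have hm := hmem t ht (ψ x) hx.2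
    have h1 : ContMDiffAt 𝓘(ℝ, ℝ × E) 𝓘(ℝ, E) ∞ (fun q : ℝ × E => α q.1 q.2) (t, ψ x) :=
      (hα.contDiffAt ((isOpen_Ioo.prod Metric.isOpen_ball).mem_nhds hm.1)).contMDiffAt
    have h2 : ContMDiffAt (𝓘(ℝ, ℝ).prod 𝓘(ℝ, E)) 𝓘(ℝ, E) ∞ (fun q : ℝ × M => ψ q.2) (t, x) :=
      (contMDiffAt_chart hx.1).comp (t, x) (f := fun q : ℝ × M => q.2) contMDiffAt_snd
    have h3 : ContMDiffAt (𝓘(ℝ, ℝ).prod 𝓘(ℝ, E)) 𝓘(ℝ, ℝ × E) ∞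
        (fun q : ℝ × M => (q.1, ψ q.2)) (t, x) := contMDiffAt_fst.prodMk_space h2
    have h4 := h1.comp (t, x) (f := fun q : ℝ × M => (q.1, ψ q.2)) h3
    have h5 : ContMDiffAt 𝓘(ℝ, E) 𝓘(ℝ, E) ∞ ψ.symm (α t (ψ x)) :=
      contMDiffAt_chart_symm (hrs hm.2)
    exact (ContMDiffAt.comp (t, x) (g := ψ.symm) (f := fun q : ℝ × M => α q.1 (ψ q.2))
      h5 h4).contMDiffWithinAt
  · intro x hx
    refine ⟨?_, fun t ht => HasMFDerivAt.hasMFDerivWithinAt ?_⟩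
    · have hm := hmem 0 ⟨by linarith, hε⟩ (ψ x) hx.2
      change ψ.symm (α 0 (ψ x)) = x
      rw [(hαflow _ hm.1.2).1, ψ.left_inv hx.1]
    · have hm := hmem t ht (ψ x) hx.2
      have htar := hrs hm.2
      have h1 := ((hαflow _ hm.1.2).2 t hm.1.1).hasFDerivAt.hasMFDerivAt
      have h2 := (mdifferentiableAt_chart_symm htar).hasMFDerivAt.comp t h1
      refine h2.congr_mfderiv ?_
      have h3 : mfderiv 𝓘(ℝ, E) 𝓘(ℝ, E) ψ.symm (α t (ψ x)) (f (α t (ψ x))) =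
          X (ψ.symm (α t (ψ x))) := by
        rw [hfD _ hm.2]
        have h4 := mfderiv_symm_mfderiv_chart (ψ.map_target htar) (X (ψ.symm (α t (ψ x))))
        rw [ψ.right_inv htar] at h4
        exact h4
      ext
      exact (congrArg (mfderiv 𝓘(ℝ, E) 𝓘(ℝ, E) ψ.symm (α t (ψ x))) (one_smul ℝ _)).trans
        (h3.trans (one_smul ℝ _).symm)

lemma IsLocalFlow.mono {φ : ℝ → M → M} {ε ε' : ℝ} {U V : Set M}
    (h : IsLocalFlow 𝓘(ℝ, E) X φ ε U) (hε : ε' ≤ ε) (hV : V ⊆ U) :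
    IsLocalFlow 𝓘(ℝ, E) X φ ε' V := by
  have hsub : Ioo (-ε') ε' ⊆ Ioo (-ε) ε := Ioo_subset_Ioo (by linarith) hε
  exact ⟨h.1.mono (prod_mono hsub hV), fun p hp => ⟨(h.2 p (hV hp)).1,
    (h.2 p (hV hp)).2.mono hsub⟩⟩

/-- The flow at time `-t` is inverted by the flow at time `t`. -/
lemma IsLocalFlow.apply_apply_neg [CompleteSpace E] [T2Space M]
    (hX : ∀ x, SmoothFieldAt 𝓘(ℝ, E) X x) {φ : ℝ → M → M} {ε : ℝ} {U : Set M}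
    (h : IsLocalFlow 𝓘(ℝ, E) X φ ε U) {t : ℝ} (ht : t ∈ Ioo (-(ε / 2)) (ε / 2)) {x : M}
    (hx : x ∈ U) (hx' : φ (-t) x ∈ U) : φ t (φ (-t) x) = x := by
  have hXs : ContMDiff 𝓘(ℝ, E) 𝓘(ℝ, E).tangent 1
      (fun x => (⟨x, X x⟩ : TangentBundle 𝓘(ℝ, E) M)) := fun x => (hX x).of_le (by decide)
  have h0 : (0 : ℝ) ∈ Ioo (-(ε / 2)) (ε / 2) := by constructor <;> linarith [ht.1, ht.2]
  have h1 : IsMIntegralCurveOn (fun s => φ s (φ (-t) x)) X (Ioo (-(ε / 2)) (ε / 2)) :=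
    (h.2 _ hx').2.mono (Ioo_subset_Ioo (by linarith [h0.1]) (by linarith [h0.2]))
  have h2 : IsMIntegralCurveOn ((fun s => φ s x) ∘ (· + -t)) X (Ioo (-(ε / 2)) (ε / 2)) :=
    ((h.2 _ hx).2.comp_add (-t)).mono fun s hs => by
      constructor <;> linarith [hs.1, hs.2, ht.1, ht.2]
  have h3 := isMIntegralCurveOn_Ioo_eqOn_of_contMDiff_boundaryless h0 hXs h1 h2
    (by simp [(h.2 _ hx').1]) ht
  simp only [Function.comp_apply, add_neg_cancel, (h.2 _ hx).1] at h3
  exact h3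

lemma smoothFieldAt_neg {x : M} (hX : SmoothFieldAt 𝓘(ℝ, E) X x) :
    SmoothFieldAt 𝓘(ℝ, E) (fun x => -X x) x :=
  ContMDiffAt.neg_section hX

end LocalFlow

section FromLightRay

variable {E : Type*} [NormedAddCommGroup E] [NormedSpace ℝ E]
  {M : Type*} [TopologicalSpace M] [ChartedSpace E M] [IsManifold 𝓘(ℝ, E) ∞ M]
  {g₀ : ContMDiffRiemannianMetric 𝓘(ℝ, E) ∞ E (fun x : M => TangentSpace 𝓘(ℝ, E) x)}
  {β : M → ℝ} {δ : (x : M) → TangentSpace 𝓘(ℝ, E) x}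
  {φ : ℝ → M → M} {ε σ : ℝ} {U : Set M}

/-- A curve solving the geodesic equation with friction `σ / 2` is a reparametrized geodesic. -/
lemma isReparametrizedGeodesicOn_of_eulerLagrange [FiniteDimensional ℝ E]
    (hd : IsHomotheticData g₀ β δ σ) {ρ : ℝ → M}
    (hρ : ∀ t ∈ Ioo (-ε) ε, ContMDiffAt 𝓘(ℝ, ℝ) 𝓘(ℝ, E) ∞ ρ t)
    (hEL : ∀ t ∈ Ioo (-ε) ε, ∀ p, ρ t ∈ (extChartAt 𝓘(ℝ, E) p).source → ∀ w,
      eulerLagrange (chartComponents 𝓘(ℝ, E) (conformalMetric g₀ β δ) p)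
          (fun s => extChartAt 𝓘(ℝ, E) p (ρ s)) t w =
        -(σ / 2) * chartComponents 𝓘(ℝ, E) (conformalMetric g₀ β δ) p
          (extChartAt 𝓘(ℝ, E) p (ρ t)) (deriv (fun s => extChartAt 𝓘(ℝ, E) p (ρ s)) t) w) :
    IsReparametrizedGeodesicOn 𝓘(ℝ, E) (conformalMetric g₀ β δ) ρ (Ioo (-ε) ε) := by
  have hexp : ContDiff ℝ ∞ (fun t : ℝ => Real.exp (-(σ / 2) * t)) := by fun_prop
  obtain ⟨k, hk, hk'⟩ := exists_contDiffOn_primitive (ε := ε) hexp.contDiffOn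
  have hderiv : ∀ t ∈ Ioo (-ε) ε, deriv k t ≠ 0 := fun t ht => by
    rw [(hk' t ht).deriv]; exact (Real.exp_pos _).ne'
  have hkpc : IsParameterChange k (Ioo (-ε) ε) := ⟨hk, hderiv⟩
  obtain ⟨hopen, m, hm, hmk⟩ := hkpc.exists_inverse isOpen_Ioo ordConnected_Ioo
  have hγ : ∀ t ∈ Ioo (-ε) ε, ContMDiffAt 𝓘(ℝ, ℝ) 𝓘(ℝ, E) ∞ (ρ ∘ m) (k t) := fun t ht => by
    have h1 := hρ t ht
    rw [← hmk t ht] at h1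
    exact h1.comp (k t) (hm.contDiffAt (hopen.mem_nhds ⟨t, ht, rfl⟩)).contMDiffAt
  have heq : ∀ t ∈ Ioo (-ε) ε, ρ t = (ρ ∘ m) (k t) := fun t ht => by
    rw [Function.comp_apply, hmk t ht]
  refine ⟨ρ ∘ m, k, hkpc, ⟨?_, ?_⟩, heq⟩
  · rintro _ ⟨t, ht, rfl⟩
    exact (hγ t ht).contMDiffWithinAt
  · rintro _ ⟨t, ht, rfl⟩ p hp w
    have hp' : ρ t ∈ (extChartAt 𝓘(ℝ, E) p).source := by rw [heq t ht]; exact hp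
    have hev : ρ =ᶠ[𝓝 t] (ρ ∘ m) ∘ k := by
      filter_upwards [isOpen_Ioo.mem_nhds ht] with s hs using heq s hs
    have hg : ∀ y ∈ (extChartAt 𝓘(ℝ, E) p).target,
        SymmFormAt (chartComponents 𝓘(ℝ, E) (conformalMetric g₀ β δ) p) y := fun y hy =>
      symmFormAt_conformalMetric hd.smooth_lapse hd.lapse_pos hd.smooth_shift hy
    have hratio : deriv (deriv k) t / deriv k t = -(σ / 2) := by
      have h1 : deriv k =ᶠ[𝓝 t] fun t => Real.exp (-(σ / 2) * t) := by
        filter_upwards [isOpen_Ioo.mem_nhds ht] with s hs using (hk' s hs).deriv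
      have h2 : HasDerivAt (fun s : ℝ => -(σ / 2) * s) (-(σ / 2)) t := by
        simpa using (hasDerivAt_id t).const_mul (-(σ / 2))
      rw [h1.deriv_eq, h1.self_of_nhds, h2.exp.deriv]
      exact mul_div_cancel_left₀ _ (Real.exp_pos _).ne'
    refine (eulerLagrange_chart_eq_zero_iff_comp (hγ t ht) (hkpc.contDiffAt isOpen_Ioo ht)
      (hderiv t ht) hev hp' hg w).2 ?_
    rw [hratio]
    exact hEL t ht p hp' w

variable {γ : ℝ → M × ℝ} {J : Set ℝ}

/-- Along a light ray, time has nonzero derivative. -/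
lemma IsLightRayOn.deriv_time_ne_zero (hJ : IsOpen J) (h : IsLightRayOn g₀ β δ γ J) {s : ℝ}
    (hs : s ∈ J) : deriv (fun r => (γ r).2) s ≠ 0 := by
  have hγ : MDifferentiableAt 𝓘(ℝ, ℝ) (𝓘(ℝ, E).prod 𝓘(ℝ, ℝ)) γ s :=
    ((h.1.1 s hs).contMDiffAt (hJ.mem_nhds hs)).mdifferentiableAt (by simp)
  obtain ⟨hne, hnull⟩ := h.2 s hs
  intro h0
  have h1 := mfderiv_prod_components hγ (1 : ℝ)
  have h2 := stationaryMetric_mfderiv (g₀ := g₀) (β := β) (δ := δ) hγ (1 : ℝ) (1 : ℝ)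
  have h3 : fderiv ℝ (fun z => (γ z).2) s (1 : ℝ) = 0 := h0
  have h4 := h2.symm.trans hnull
  rw [h3] at h4 h1
  simp only [stationaryForm, mul_zero, add_zero, sub_zero] at h4
  have h5 : mfderiv 𝓘(ℝ, ℝ) 𝓘(ℝ, E) (fun z => (γ z).1) s (1 : ℝ) = 0 := by
    by_contra hv
    exact (g₀.pos _ _ hv).ne' h4
  refine hne (h1.trans ?_)
  exact congrArg (fun v : E => (v, (0 : ℝ))) h5

/-- A light ray can be parametrized by time near each of its points. -/
lemma IsLightRayOn.exists_time_parameter (hJ : IsOpen J) (h : IsLightRayOn g₀ β δ γ J)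
    {s₀ : ℝ} (hs₀ : s₀ ∈ J) :
    ∃ (ε : ℝ) (k : ℝ → ℝ), 0 < ε ∧ IsParameterChange k (Ioo (-ε) ε) ∧ k 0 = s₀ ∧
      ∀ t ∈ Ioo (-ε) ε, k t ∈ J ∧ (γ (k t)).2 = t + (γ s₀).2 := by
  have hτ : ContDiffOn ℝ ∞ (fun r => (γ r).2) J := fun s hs =>
    ((h.1.1 s hs).contMDiffAt (hJ.mem_nhds hs)).snd.contDiffAt.contDiffWithinAt
  obtain ⟨r, hr, hrJ⟩ := Metric.isOpen_iff.1 hJ s₀ hs₀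
  set B := Metric.ball s₀ r with hB
  have hB' : B.OrdConnected := by rw [hB, Real.ball_eq_Ioo]; exact ordConnected_Ioo
  have hpc : IsParameterChange (fun r => (γ r).2) B :=
    ⟨hτ.mono hrJ, fun t ht => h.deriv_time_ne_zero hJ (hrJ ht)⟩
  obtain ⟨hopen, m, hm, hmτ⟩ := hpc.exists_inverse Metric.isOpen_ball hB'
  obtain ⟨ε, hε, hεsub⟩ := Metric.isOpen_iff.1 hopen _
    ⟨s₀, Metric.mem_ball_self hr, rfl⟩
  have hmem : ∀ t ∈ Ioo (-ε) ε, ∃ s ∈ B, (γ s).2 = t + (γ s₀).2 := fun t ht => by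
    have h1 : t + (γ s₀).2 ∈ Metric.ball (γ s₀).2 ε := by
      rw [Real.ball_eq_Ioo]
      constructor <;> linarith [ht.1, ht.2]
    exact hεsub h1
  have hk : ∀ t ∈ Ioo (-ε) ε, m (t + (γ s₀).2) ∈ B ∧
      (γ (m (t + (γ s₀).2))).2 = t + (γ s₀).2 := fun t ht => by
    obtain ⟨s, hs, hst⟩ := hmem t ht
    have h1 : m (t + (γ s₀).2) = s := by rw [← hst]; exact hmτ s hs
    rw [h1]
    exact ⟨hs, hst⟩
  have hsm : ContDiffOn ℝ ∞ (fun t => m (t + (γ s₀).2)) (Ioo (-ε) ε) := by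
    have h1 : ContDiffOn ℝ ∞ (fun t : ℝ => t + (γ s₀).2) (Ioo (-ε) ε) := by fun_prop
    refine hm.comp h1 fun t ht => ?_
    obtain ⟨s, hs, hst⟩ := hmem t ht
    exact ⟨s, hs, hst⟩
  refine ⟨ε, fun t => m (t + (γ s₀).2), hε, ⟨hsm, fun t ht h0 => ?_⟩, ?_, fun t ht =>
    ⟨hrJ (hk t ht).1, (hk t ht).2⟩⟩
  · have hτd : HasDerivAt (fun r => (γ r).2) _ (m (t + (γ s₀).2)) :=
      ((hτ.contDiffAt (hJ.mem_nhds (hrJ (hk t ht).1))).differentiableAt (by simp)).hasDerivAt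
    have hkd : HasDerivAt (fun t => m (t + (γ s₀).2)) _ t :=
      ((hsm.contDiffAt (isOpen_Ioo.mem_nhds ht)).differentiableAt (by simp)).hasDerivAt
    have h1 := hτd.comp t hkd
    have h2 : HasDerivAt (fun t : ℝ => t + (γ s₀).2) 1 t := (hasDerivAt_id t).add_const _
    have h3 : (fun r => (γ r).2) ∘ (fun t => m (t + (γ s₀).2)) =ᶠ[𝓝 t]
        fun t => t + (γ s₀).2 := by
      filter_upwards [isOpen_Ioo.mem_nhds ht] with s hs using (hk s hs).2
    have h4 := h1.unique (h2.congr_of_eventuallyEq h3)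
    rw [h0, mul_zero] at h4
    exact zero_ne_one h4
  · simp only [zero_add]
    exact hmτ s₀ (Metric.mem_ball_self hr)

/-- A curve whose graph, dragged along by the flow, is a reparametrized light ray. -/
lemma isDraggedGeodesic_of_graphCurve [FiniteDimensional ℝ E] (hd : IsHomotheticData g₀ β δ σ)
    (hJ : IsOpen J) (h : IsLightRayOn g₀ β δ γ J) (hε : 0 < ε) (hU : IsOpen U)
    (hφ : IsLocalFlow 𝓘(ℝ, E) (fun x => -δ x) φ ε U) {ρ : ℝ → M}
    (hρ : ∀ t ∈ Ioo (-ε) ε, ContMDiffAt 𝓘(ℝ, ℝ) 𝓘(ℝ, E) ∞ ρ t)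
    (hρU : ∀ t ∈ Ioo (-ε) ε, ρ t ∈ U) {k : ℝ → ℝ} (hk : IsParameterChange k (Ioo (-ε) ε))
    (hkJ : ∀ t ∈ Ioo (-ε) ε, k t ∈ J) {c : ℝ}
    (heq : ∀ t ∈ Ioo (-ε) ε, graphCurve φ ρ c t = γ (k t)) :
    IsDraggedGeodesic g₀ β δ σ ε ρ U φ := by
  have hγ : ∀ t ∈ Ioo (-ε) ε, ContMDiffAt 𝓘(ℝ, ℝ) (𝓘(ℝ, E).prod 𝓘(ℝ, ℝ)) ∞ γ (k t) :=
    fun t ht => (h.1.1 _ (hkJ t ht)).contMDiffAt (hJ.mem_nhds (hkJ t ht))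
  have hev : ∀ t ∈ Ioo (-ε) ε, graphCurve φ ρ c =ᶠ[𝓝 t] γ ∘ k := fun t ht => by
    filter_upwards [isOpen_Ioo.mem_nhds ht] with s hs using heq s hs
  have hnull : ∀ t ∈ Ioo (-ε) ε, conformalMetric g₀ β δ (ρ t) (velocity 𝓘(ℝ, E) ρ t)
      (velocity 𝓘(ℝ, E) ρ t) = Real.exp (-σ * t) := by
    intro t ht
    have h1 := stationaryMetric_velocity_comp (g₀ := g₀) (β := β) (δ := δ)
      ((hγ t ht).mdifferentiableAt (by simp))
      ((hk.contDiffAt isOpen_Ioo ht).differentiableAt (by simp)) (hev t ht)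
    rw [(h.2 _ (hkJ t ht)).2, mul_zero,
      stationaryMetric_velocity_graphCurve hd hU hφ (hρ t ht) ht (hρU t ht)] at h1
    exact sub_eq_zero.1 ((mul_eq_zero.1 h1).resolve_left (curveFactor_pos hd ρ t).ne')
  refine ⟨hε, isReparametrizedGeodesicOn_of_eulerLagrange hd hρ fun t ht p hp w => ?_,
    fun t ht => ?_, hU, hρU, hφ⟩
  · have hq := mem_extChartAt_source (I := 𝓘(ℝ, E).prod 𝓘(ℝ, ℝ)) (γ (k t))
    have hq' : graphCurve φ ρ c t ∈
        (extChartAt (𝓘(ℝ, E).prod 𝓘(ℝ, ℝ)) (γ (k t))).source := by rw [heq t ht]; exact hq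
    have hg : ∀ y ∈ (extChartAt (𝓘(ℝ, E).prod 𝓘(ℝ, ℝ)) (γ (k t))).target, SymmFormAt
        (chartComponents (𝓘(ℝ, E).prod 𝓘(ℝ, ℝ)) (stationaryMetric g₀ β δ) (γ (k t))) y :=
      fun y hy => symmFormAt_stationaryMetric hd.smooth_lapse hd.smooth_shift hy
    exact ((eulerLagrange_graphCurve hd hU hφ (hρ t ht) ht (hρU t ht) hp hq' (hnull t ht) _).1
      fun W => (eulerLagrange_chart_eq_zero_iff_comp (hγ t ht) (hk.contDiffAt isOpen_Ioo ht)
        (hk.2 t ht) (hev t ht) hq' hg W).1 (h.1.2 _ (hkJ t ht) _ hq W)).1 w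
  · have h1 := hnull t ht
    rw [conformalMetric, div_eq_iff (conformalFactor_pos hd.lapse_pos _).ne'] at h1
    rw [h1, mul_comm]

/-- Near each of its points, the spatial part of a light ray is a dragged geodesic. -/
lemma IsLightRayOn.exists_isDraggedGeodesic [FiniteDimensional ℝ E] [T2Space M]
    (hd : IsHomotheticData g₀ β δ σ) (hJ : IsOpen J) (h : IsLightRayOn g₀ β δ γ J)
    {s₀ : ℝ} (hs₀ : s₀ ∈ J) :
    ∃ (ε : ℝ) (ρ : ℝ → M) (U : Set M) (φ : ℝ → M → M) (k : ℝ → ℝ),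
      IsDraggedGeodesic g₀ β δ σ ε ρ U φ ∧ IsParameterChange k (Ioo (-ε) ε) ∧ k 0 = s₀ ∧
      ∀ t ∈ Ioo (-ε) ε, k t ∈ J ∧ (γ (k t)).1 = φ t (ρ t) ∧
        0 < deriv (fun r => (γ (k r)).2) t := by
  have := FiniteDimensional.complete ℝ E
  obtain ⟨ε₁, k, hε₁, hk, hk0, hkt⟩ := h.exists_time_parameter hJ hs₀
  have hX : ∀ x, SmoothFieldAt 𝓘(ℝ, E) (fun x => -δ x) x := fun x =>
    smoothFieldAt_neg (hd.smooth_shift x)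
  obtain ⟨ε₂, U, φ, hε₂, hU, hxU, hφ⟩ := exists_isLocalFlow hX (γ s₀).1
  set x : ℝ → M := fun t => (γ (k t)).1 with hx
  have hxs : ∀ t ∈ Ioo (-ε₁) ε₁, ContMDiffAt 𝓘(ℝ, ℝ) 𝓘(ℝ, E) ∞ x t := fun t ht =>
    (((h.1.1 _ (hkt t ht).1).contMDiffAt (hJ.mem_nhds (hkt t ht).1)).comp t
      (hk.contDiffAt isOpen_Ioo ht).contMDiffAt).fst
  have hρs : ∀ t ∈ Ioo (-ε₁) ε₁, x t ∈ U → -t ∈ Ioo (-ε₂) ε₂ →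
      ContMDiffAt 𝓘(ℝ, ℝ) 𝓘(ℝ, E) ∞ (fun t => φ (-t) (x t)) t := by
    intro t ht htU ht₂
    have h1 : ContMDiffAt (𝓘(ℝ, ℝ).prod 𝓘(ℝ, E)) 𝓘(ℝ, E) ∞ (fun q : ℝ × M => φ q.1 q.2)
      (-t, x t) := (hφ.1 _ ⟨ht₂, htU⟩).contMDiffAt ((isOpen_Ioo.prod hU).mem_nhds ⟨ht₂, htU⟩)
    have h2 : ContDiff ℝ ∞ (fun t : ℝ => -t) := contDiff_neg
    exact h1.comp t (f := fun t => (-t, x t)) ((h2.contMDiff t).prodMk (hxs t ht))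
  have h01 : (0 : ℝ) ∈ Ioo (-ε₁) ε₁ := ⟨by linarith, hε₁⟩
  have hx0 : x 0 = (γ s₀).1 := by rw [hx]; simp only [hk0]
  have hx0U : x 0 ∈ U := by rw [hx0]; exact hxU
  have hnear : ∀ᶠ t in 𝓝 (0 : ℝ), x t ∈ U ∧ φ (-t) (x t) ∈ U := by
    refine ((hxs 0 h01).continuousAt.eventually_mem (hU.mem_nhds hx0U)).and ?_
    refine (hρs 0 h01 hx0U (by constructor <;> linarith)).continuousAt.eventually_mem
      (hU.mem_nhds ?_)
    rw [neg_zero, (hφ.2 _ hx0U).1]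
    exact hx0U
  obtain ⟨ε₃, hε₃, hball⟩ := Metric.mem_nhds_iff.1 hnear
  set ε := min (min ε₁ (ε₂ / 2)) ε₃ with hεdef
  have hε : 0 < ε := by positivity
  have e1 : ε ≤ ε₁ := (min_le_left _ _).trans (min_le_left _ _)
  have e2 : ε ≤ ε₂ / 2 := (min_le_left _ _).trans (min_le_right _ _)
  have e3 : ε ≤ ε₃ := min_le_right _ _
  have m1 : ∀ t ∈ Ioo (-ε) ε, t ∈ Ioo (-ε₁) ε₁ := fun t ht => by
    constructor <;> linarith [ht.1, ht.2]
  have m2 : ∀ t ∈ Ioo (-ε) ε, t ∈ Ioo (-(ε₂ / 2)) (ε₂ / 2) := fun t ht => by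
    constructor <;> linarith [ht.1, ht.2]
  have m3 : ∀ t ∈ Ioo (-ε) ε, x t ∈ U ∧ φ (-t) (x t) ∈ U := fun t ht => by
    refine hball (?_ : t ∈ Metric.ball 0 ε₃)
    rw [Real.ball_eq_Ioo]
    constructor <;> linarith [ht.1, ht.2]
  have hφρ : ∀ t ∈ Ioo (-ε) ε, φ t (φ (-t) (x t)) = x t := fun t ht =>
    hφ.apply_apply_neg hX (m2 t ht) (m3 t ht).1 (m3 t ht).2
  have hk' : IsParameterChange k (Ioo (-ε) ε) :=
    ⟨hk.1.mono fun t ht => m1 t ht, fun t ht => hk.2 t (m1 t ht)⟩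
  refine ⟨ε, fun t => φ (-t) (x t), U, φ, k, ?_, hk', hk0, fun t ht =>
    ⟨(hkt t (m1 t ht)).1, (hφρ t ht).symm, ?_⟩⟩
  · refine isDraggedGeodesic_of_graphCurve hd hJ h hε hU
      (hφ.mono (by linarith) subset_rfl) (fun t ht => hρs t (m1 t ht) (m3 t ht).1 ?_)
      (fun t ht => (m3 t ht).2) hk' (fun t ht => (hkt t (m1 t ht)).1) (c := (γ s₀).2)
      fun t ht => Prod.ext (hφρ t ht) (hkt t (m1 t ht)).2.symm
    constructor <;> linarith [(m2 t ht).1, (m2 t ht).2]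
  · have h1 : (fun r => (γ (k r)).2) =ᶠ[𝓝 t] fun r => r + (γ s₀).2 := by
      filter_upwards [isOpen_Ioo.mem_nhds ht] with r hr using (hkt r (m1 r hr)).2
    rw [h1.deriv_eq]
    simp

end FromLightRay

end Stationary

theorem corollary3p3
    {E : Type*} [NormedAddCommGroup E] [NormedSpace ℝ E] [FiniteDimensional ℝ E]
    {M : Type*} [TopologicalSpace M] [ChartedSpace E M] [IsManifold 𝓘(ℝ, E) ∞ M] [T2Space M]
    (g₀ : ContMDiffRiemannianMetric 𝓘(ℝ, E) ∞ E (fun x : M => TangentSpace 𝓘(ℝ, E) x))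
    (β : M → ℝ) (hβ : ContMDiff 𝓘(ℝ, E) 𝓘(ℝ, ℝ) ∞ β) (hβ_pos : ∀ x, 0 < β x)
    (δ : (x : M) → TangentSpace 𝓘(ℝ, E) x) (hδ : ∀ x, Stationary.SmoothFieldAt 𝓘(ℝ, E) δ x)
    (σ : ℝ)
    -- `L_δ g₀ = (δ(β + |δ|₀²) / (β + |δ|₀²) - σ) g₀`
    (hL : ∀ (x : M) (Y Z : (x : M) → TangentSpace 𝓘(ℝ, E) x),
      Stationary.SmoothFieldAt 𝓘(ℝ, E) Y x → Stationary.SmoothFieldAt 𝓘(ℝ, E) Z x →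
      Stationary.lieDerivative 𝓘(ℝ, E) δ (fun y u v => g₀.inner y u v) Y Z x
        = (mvfderiv 𝓘(ℝ, E) (Stationary.conformalFactor g₀ β δ) x (δ x)
            / Stationary.conformalFactor g₀ β δ x - σ) * g₀.inner x (Y x) (Z x)) :
    -- every light ray has, near each of its parameters, such a spatial part
    (∀ (γ : ℝ → M × ℝ) (J : Set ℝ), IsOpen J → J.OrdConnected →
      Stationary.IsLightRayOn g₀ β δ γ J → ∀ s₀ ∈ J,
      ∃ (ε : ℝ) (ρ : ℝ → M) (U : Set M) (φ : ℝ → M → M) (h : ℝ → ℝ),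
        Stationary.IsDraggedGeodesic g₀ β δ σ ε ρ U φ ∧
        Stationary.IsParameterChange h (Ioo (-ε) ε) ∧ h 0 = s₀ ∧
        ∀ t ∈ Ioo (-ε) ε, h t ∈ J ∧ (γ (h t)).1 = φ t (ρ t) ∧
          0 < deriv (fun r => (γ (h r)).2) t) ∧
    -- and every such curve is, on its whole domain, the spatial part of a light ray
    (∀ (ε : ℝ) (ρ : ℝ → M) (U : Set M) (φ : ℝ → M → M),
      Stationary.IsDraggedGeodesic g₀ β δ σ ε ρ U φ →
      ∃ (γ : ℝ → M × ℝ) (h : ℝ → ℝ),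
        Stationary.IsParameterChange h (Ioo (-ε) ε) ∧
        Stationary.IsLightRayOn g₀ β δ γ (h '' Ioo (-ε) ε) ∧
        ∀ t ∈ Ioo (-ε) ε, 0 < deriv h t ∧ (γ (h t)).1 = φ t (ρ t) ∧
          0 < deriv (fun r => (γ (h r)).2) t) := by
  have hd : Stationary.IsHomotheticData g₀ β δ σ := ⟨hβ, hβ_pos, hδ, hL⟩
  exact ⟨fun γ J hJ _ hγ s₀ hs₀ => hγ.exists_isDraggedGeodesic hd hJ hs₀,
    fun ε ρ U φ h => h.exists_lightRay hd⟩
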